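/- **Setting.** Let $\Gamma\subset \mathrm{SL}_2(\mathbb R)$ be a Fuchsian group of the first kind, i.e. a discrete subgroup such that $\Gamma\backslash\mathbb H$ has finite hyperbolic volume, and let $k\ge 4$ be an even integer. Write $j(g,z)=cz+d$ for $g=\begin{pmatrix}a&b\\c&d\end{pmatrix}$ and $(f|_kg)(z)=j(g,z)^{-k}f(gz)$. Complex powers $w^s=e^{s\log w}$ use the principal branch, $-\pi<\arg w\le\pi$, and $\mathbf e(x)=e^{2\pi i x}$. Let $\eta=(\eta_1,\eta_2)$ and $\eta'=(\eta_1',\eta_2')$ be ordered hyperbolic fixed pairs for $\Gamma$ (pairs of distinct points of $\mathbb R\cup\{\infty\}$ that are both fixed by a common hyperbolic element of $\Gamma$). Put $\eta^*=(\eta_2,\eta_1)$, let $\Gamma_\eta$ be the subgroup of $\Gamma$ fixing $\eta_1$ and $\eta_2$, and write $\eta'\equiv\eta \bmod\Gamma$ if $\gamma\eta'=\eta$ for some $\gamma\in\Gamma$. Let $\sigma_\eta\in\mathrm{SL}_2(\mathbb R)$ be a scaling matrix: $\sigma_\eta 0=\eta_1$, $\sigma_\eta\infty=\eta_2$. The number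 $\ell_\eta>0$ is determined by $$\{\pm \sigma_\eta^{-1}\gamma\sigma_\eta : \gamma\in\Gamma_\eta\}=\Big\{\pm\begin{pmatrix}e^{j\ell_\eta/2}&0\\0&e^{-j\ell_\eta/2}\end{pmatrix} : j\in\mathbb Z\Big\}.$$ Likewise for $\eta'$. For $m\in\mathbb Z$ the hyperbolic Poincaré series is $$P_{\eta,m}(z)=\sum_{\gamma\in\Gamma_\eta\backslash\Gamma}\frac{(\sigma_\eta^{-1}\gamma z)^{-k/2+2\pi i m/\ell_\eta}}{j(\sigma_\eta^{-1}\gamma,z)^k}\qquad(z\in\mathbb H),$$ and the hyperbolic Fourier coefficients $c_{\eta'}(n;f)$ of $f$ at $\eta'$ are defined by the expansion $$(f|_k\sigma_{\eta'})(z)=\sum_{n\in\mathbb Z}c_{\eta'}(n;f)\,z^{-k/2+2\pi i n/\ell_{\eta'}}\qquad(z\in\mathbb H).$$ Put $C_{\eta\eta'}=\{ad : \begin{pmatrix}a&b\\c&d\end{pmatrix}\in\sigma_\eta^{-1}\Gamma\sigma_{\eta'},\ abcd\ne0\}$. For $C\in C_{\eta\eta'}$, $\alpha,\beta\in\{1,-1\}$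 and $n\in\mathbb Z$ let $$S_{\eta\eta'}(m,n;C,\alpha,\beta)=\sum \mathbf e\Big(\frac{m}{2\ell_\eta}\log\Big|\frac{ab}{cd}\Big|+\frac{n}{2\ell_{\eta'}}\log\Big|\frac{ac}{bd}\Big|\Big),$$ the sum being over the double cosets $\gamma\in\Gamma_\eta\backslash\Gamma/\Gamma_{\eta'}$ for which $\begin{pmatrix}a&b\\c&d\end{pmatrix}=\sigma_\eta^{-1}\gamma\sigma_{\eta'}$ satisfies $ad=C$, $\operatorname{sgn}(ac)=\alpha$, $\operatorname{sgn}(cd)=\beta$. For real $r\ne0,1$ and $\alpha\beta=\operatorname{sgn}(r)$ let, for any $0<y<\pi$, $$I_{\eta\eta'}(m,n;r,\alpha,\beta)=\int_{-\infty+iy}^{\infty+iy}\frac{\Big(\big|\frac r{r-1}\big|^{1/2}\,\frac{N(u)}{D(u)}\Big)^{2\pi i m/\ell_\eta}e^{u(k/2-2\pi i n/\ell_{\eta'})}}{N(u)^{k/2}\,D(u)^{k/2}}\,\frac{du}{\ell_{\eta'}},$$ $$N(u)=\alpha e^u+\operatorname{sgn}(r-1)\Big|\frac{r-1}r\Big|^{1/2},\qquad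 D(u)=e^u+\beta\Big|\frac r{r-1}\Big|^{1/2}.$$ If $\alpha\beta\neq\operatorname{sgn}(C)$ then $S_{\eta\eta'}(m,n;C,\alpha,\beta)$ is an empty sum and the corresponding term below is $0$. Finally let $a,b$ be non-zero real numbers such that $\sigma_\eta\begin{pmatrix}a&0\\0&1/a\end{pmatrix}\sigma_{\eta'}^{-1}\in\Gamma$ if $\eta'\equiv\eta\bmod\Gamma$, and $\sigma_\eta\begin{pmatrix}0&b\\-1/b&0\end{pmatrix}\sigma_{\eta'}^{-1}\in\Gamma$ if $\eta'\equiv\eta^*\bmod\Gamma$; such numbers exist. **Theorem.** The series $P_{\eta,m}$ converges absolutely at every point of $\mathbb H$, the sums $S_{\eta\eta'}(m,n;C,\alpha,\beta)$ are finite, and for $C\in C_{\eta\eta'}$ and $\alpha\beta=\operatorname{sgn}(C)$ the integrals $I_{\eta\eta'}(m,n;C,\alpha,\beta)$ converge absolutely. The function $P_{\eta,m}$ has a unique hyperbolic Fourier expansion at $\eta'$, valid on all of $\mathbb H$, and for all $m,n\in\mathbb Z$, every admissible choice of $a,b$ and every $0<y<\pi$, $$c_{\eta'}(n;P_{\eta,m})=\sum_{C\in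 C_{\eta\eta'},\ \alpha,\beta=\pm1}I_{\eta\eta'}(m,n;C,\alpha,\beta)\,\frac{S_{\eta\eta'}(m,n;C,\alpha,\beta)}{|C(C-1)|^{k/4}}+E_1+E_2,$$ where the sum converges absolutely, $$E_1=\begin{cases}(a^2)^{2\pi i n/\ell_{\eta'}}&\text{if }\eta'\equiv\eta\bmod\Gamma\text{ and }n=m,\\0&\text{otherwise,}\end{cases}$$ $$E_2=\begin{cases}(-1)^{k/2}e^{2\pi^2n/\ell_{\eta'}}(b^2)^{-2\pi i n/\ell_{\eta'}}&\text{if }\eta'\equiv\eta^*\bmod\Gamma\text{ and }n=-m,\\0&\text{otherwise.}\end{cases}$$ -/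

import Mathlib

open scoped MatrixGroups UpperHalfPlane

noncomputable section

namespace HypPoincare

open MeasureTheory

/-- The underlying matrix of an element of `SL(2, ℝ)`. -/
abbrev mat (g : SL(2, ℝ)) : Matrix (Fin 2) (Fin 2) ℝ := g.1

/-- The action of `SL(2, ℝ)` by linear fractional transformations on ordered pairs of points
of `ℝ ∪ {∞}`. -/
def actPair (g : SL(2, ℝ)) (η : OnePoint ℝ × OnePoint ℝ) : OnePoint ℝ × OnePoint ℝ :=
  (g : GL (Fin 2) ℝ) • η

/-- A Fuchsian group of the first kind: a discrete subgroup of `SL(2, ℝ)` for which `Γ \ ℍ` has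
finite hyperbolic volume, i.e. there is a measurable fundamental domain of finite area with
respect to `dx dy / y ^ 2` (which is the `volume` of `ℍ`). -/
structure IsFuchsianFirstKind (Γ : Subgroup SL(2, ℝ)) : Prop where
  discrete : DiscreteTopology Γ
  finite_volume : ∃ F : Set ℍ, MeasurableSet F ∧ (∀ z : ℍ, ∃ γ ∈ Γ, γ • z ∈ F) ∧
    (∀ γ ∈ Γ, γ ≠ 1 → γ ≠ -1 → volume ((fun z : ℍ ↦ γ • z) '' F ∩ F) = 0) ∧
    volume F < ⊤

/-- `η = (η₁, η₂)` is an ordered hyperbolic fixed pair for `Γ`. -/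
def IsHyperbolicPair (Γ : Subgroup SL(2, ℝ)) (η : OnePoint ℝ × OnePoint ℝ) : Prop :=
  η.1 ≠ η.2 ∧ ∃ γ ∈ Γ, (mat γ).IsHyperbolic ∧ actPair γ η = η

/-- `σ` is a scaling matrix for `η`: `σ 0 = η₁` and `σ ∞ = η₂`. -/
def IsScaling (σ : SL(2, ℝ)) (η : OnePoint ℝ × OnePoint ℝ) : Prop :=
  actPair σ (((0 : ℝ) : OnePoint ℝ), OnePoint.infty) = η

/-- `η' ≡ η mod Γ`. -/
def PairEquiv (Γ : Subgroup SL(2, ℝ)) (η' η : OnePoint ℝ × OnePoint ℝ) : Prop :=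
  ∃ γ ∈ Γ, actPair γ η' = η

/-- The subgroup `Γ_η` of all elements of `Γ` fixing both points of `η`. -/
def pairStabilizer (Γ : Subgroup SL(2, ℝ)) (η : OnePoint ℝ × OnePoint ℝ) : Subgroup Γ :=
  (MulAction.stabilizer (GL (Fin 2) ℝ) η).comap
    (Matrix.SpecialLinearGroup.toGL.comp Γ.subtype)

/-- The diagonal matrix with entries `e^{t/2}` and `e^{-t/2}`. -/
def expDiag (t : ℝ) : Matrix (Fin 2) (Fin 2) ℝ :=
  !![Real.exp (t / 2), 0; 0, Real.exp (-(t / 2))]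

/-- The length `ℓ_η`, where `σ` is a scaling matrix for `η`: the least `ℓ > 0` such that
`± diag(e^{ℓ/2}, e^{-ℓ/2})` lies in `σ⁻¹ Γ σ`. See `hypLength_spec`. -/
def hypLength (Γ : Subgroup SL(2, ℝ)) (σ : SL(2, ℝ)) : ℝ :=
  sInf {t : ℝ | 0 < t ∧ ∃ γ ∈ Γ, mat (σ⁻¹ * γ * σ) = expDiag t ∨ mat (σ⁻¹ * γ * σ) = -expDiag t}

theorem expDiag_add (s t : ℝ) : expDiag (s + t) = expDiag s * expDiag t := by
  simp only [expDiag, Matrix.mul_fin_two, mul_zero, zero_mul, add_zero, zero_add,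
    ← Real.exp_add]
  congr 3 <;> ring_nf

theorem expDiag_zero : expDiag 0 = 1 := by
  simp [expDiag, Matrix.one_fin_two]

theorem fixes_iff (g : SL(2, ℝ)) :
    actPair g (((0 : ℝ) : OnePoint ℝ), OnePoint.infty) = (((0 : ℝ) : OnePoint ℝ), OnePoint.infty) ↔
      mat g 0 1 = 0 ∧ mat g 1 0 = 0 := by
  have hdet := g.2
  rw [Matrix.det_fin_two] at hdet
  simp only [actPair, Prod.smul_mk, Prod.mk.injEq, OnePoint.smul_infty_eq_self_iff,
    OnePoint.smul_some_eq_ite, mul_zero, zero_add]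
  refine and_congr_left fun hc ↦ ?_
  change g.1 1 0 = 0 at hc
  change (if g.1 1 1 = 0 then OnePoint.infty else ((g.1 0 1 / g.1 1 1 : ℝ) : OnePoint ℝ)) = _ ↔ _
  rw [hc] at hdet
  have hd : g.1 1 1 ≠ 0 := by rintro h; simp [h] at hdet
  simp [hd]

theorem mem_pairStabilizer_iff {Γ : Subgroup SL(2, ℝ)} {η : OnePoint ℝ × OnePoint ℝ}
    {σ : SL(2, ℝ)} (hσ : IsScaling σ η) (γ : Γ) :
    γ ∈ pairStabilizer Γ η ↔
      mat (σ⁻¹ * γ * σ) 0 1 = 0 ∧ mat (σ⁻¹ * γ * σ) 1 0 = 0 := by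
  rw [← fixes_iff, ← hσ]
  simp only [pairStabilizer, actPair, Subgroup.mem_comap, MulAction.mem_stabilizer_iff]
  change Matrix.SpecialLinearGroup.toGL (γ : SL(2, ℝ)) •
    (Matrix.SpecialLinearGroup.toGL σ • _) = Matrix.SpecialLinearGroup.toGL σ • _ ↔
    Matrix.SpecialLinearGroup.toGL (σ⁻¹ * (γ : SL(2, ℝ)) * σ) • _ = _
  rw [map_mul, map_mul, map_inv, mul_smul, mul_smul, inv_smul_eq_iff]

theorem exists_expDiag (g : SL(2, ℝ)) (h1 : mat g 0 1 = 0) (h2 : mat g 1 0 = 0) :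
    ∃ t : ℝ, mat g = expDiag t ∨ mat g = -expDiag t := by
  have hdet := g.2
  rw [Matrix.det_fin_two] at hdet
  simp only [mat] at h1 h2
  rw [h1, zero_mul, sub_zero] at hdet
  have ha : g.1 0 0 ≠ 0 := by rintro h; simp [h] at hdet
  have hd : g.1 1 1 = (g.1 0 0)⁻¹ := eq_inv_of_mul_eq_one_right hdet
  refine ⟨2 * Real.log (g.1 0 0), ?_⟩
  have e : 2 * Real.log (g.1 0 0) / 2 = Real.log (g.1 0 0) := by ring
  rcases lt_or_gt_of_ne ha with h | h
  · right
    ext i j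
    fin_cases i <;> fin_cases j <;>
      simp [expDiag, e, h1, h2, hd, Real.exp_neg, Real.exp_log_of_neg h]
  · left
    ext i j
    fin_cases i <;> fin_cases j <;>
      simp [expDiag, e, h1, h2, hd, Real.exp_neg, Real.exp_log h]

theorem det_expDiag (t : ℝ) : (expDiag t).det = 1 := by
  simp [expDiag, Matrix.det_fin_two, ← Real.exp_add]

/-- `expDiag t` as an element of `SL(2, ℝ)`. -/
def expSL (t : ℝ) : SL(2, ℝ) := ⟨expDiag t, det_expDiag t⟩

/-- The defining property of `ℓ_η`: up to sign, `σ⁻¹ Γ_η σ` is the group of all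
`diag(e^{jℓ/2}, e^{-jℓ/2})` with `j ∈ ℤ`. -/
theorem hypLength_spec {Γ : Subgroup SL(2, ℝ)} (hΓ : DiscreteTopology Γ)
    {η : OnePoint ℝ × OnePoint ℝ} (hη : IsHyperbolicPair Γ η) {σ : SL(2, ℝ)}
    (hσ : IsScaling σ η) :
    0 < hypLength Γ σ ∧ ∀ M : Matrix (Fin 2) (Fin 2) ℝ,
      (∃ γ ∈ pairStabilizer Γ η, M = mat (σ⁻¹ * γ * σ) ∨ M = -mat (σ⁻¹ * γ * σ)) ↔
        ∃ j : ℤ, M = expDiag (j * hypLength Γ σ) ∨ M = -expDiag (j * hypLength Γ σ) := by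
  have hmul (x y : SL(2, ℝ)) : mat (σ⁻¹ * (x * y) * σ) =
      mat (σ⁻¹ * x * σ) * mat (σ⁻¹ * y * σ) := by
    have key : σ⁻¹ * (x * y) * σ = (σ⁻¹ * x * σ) * (σ⁻¹ * y * σ) := by group
    rw [key]
    exact Matrix.SpecialLinearGroup.coe_mul _ _
  let A : AddSubgroup ℝ :=
    { carrier := {t | ∃ γ ∈ Γ, mat (σ⁻¹ * γ * σ) = expDiag t ∨ mat (σ⁻¹ * γ * σ) = -expDiag t}
      zero_mem' := ⟨1, Γ.one_mem, Or.inl (by simp [expDiag_zero])⟩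
      add_mem' := by
        rintro s t ⟨x, hx, hx'⟩ ⟨y, hy, hy'⟩
        refine ⟨x * y, Γ.mul_mem hx hy, ?_⟩
        rw [hmul, expDiag_add]
        rcases hx' with h | h <;> rcases hy' with h' | h' <;> simp [h, h']
      neg_mem' := by
        rintro t ⟨x, hx, hx'⟩
        refine ⟨x⁻¹, Γ.inv_mem hx, ?_⟩
        have h1 : mat (σ⁻¹ * x⁻¹ * σ) * mat (σ⁻¹ * x * σ) = 1 := by
          rw [← hmul]; simp
        have h2 : expDiag t * expDiag (-t) = 1 := by
          rw [← expDiag_add, add_neg_cancel, expDiag_zero]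
        rcases hx' with h | h
        · left
          calc _ = mat (σ⁻¹ * x⁻¹ * σ) * (expDiag t * expDiag (-t)) := by rw [h2, mul_one]
            _ = _ := by rw [← mul_assoc, ← h, h1, one_mul]
        · right
          calc _ = mat (σ⁻¹ * x⁻¹ * σ) * (expDiag t * expDiag (-t)) := by rw [h2, mul_one]
            _ = -((mat (σ⁻¹ * x⁻¹ * σ) * -expDiag t) * expDiag (-t)) := by
              simp [mul_assoc]
            _ = _ := by rw [← h, h1, one_mul] }
  have hA (t : ℝ) : t ∈ A ↔
      ∃ γ ∈ Γ, mat (σ⁻¹ * γ * σ) = expDiag t ∨ mat (σ⁻¹ * γ * σ) = -expDiag t := Iff.rfl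
  have hne : A ≠ ⊥ := by
    obtain ⟨-, γ, hγ, hhyp, hfix⟩ := hη
    have hst : (⟨γ, hγ⟩ : Γ) ∈ pairStabilizer Γ η := hfix
    obtain ⟨t, ht⟩ := exists_expDiag _ ((mem_pairStabilizer_iff hσ _).1 hst).1
      ((mem_pairStabilizer_iff hσ _).1 hst).2
    intro hbot
    have : t ∈ A := ⟨γ, hγ, ht⟩
    rw [hbot, AddSubgroup.mem_bot] at this
    subst this
    rw [expDiag_zero] at ht
    have hconj : γ = σ * (σ⁻¹ * γ * σ) * σ⁻¹ := by group
    have hγ1 : mat γ = 1 ∨ mat γ = -1 := by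
      have : mat γ = mat σ * mat (σ⁻¹ * γ * σ) * mat σ⁻¹ := by
        conv_lhs => rw [hconj]
        rw [mat, Matrix.SpecialLinearGroup.coe_mul, Matrix.SpecialLinearGroup.coe_mul]
      have hs : mat σ * mat σ⁻¹ = 1 := by
        rw [mat, mat, ← Matrix.SpecialLinearGroup.coe_mul, mul_inv_cancel]; rfl
      rcases ht with h | h
      · left
        change mat (σ⁻¹ * γ * σ) = 1 at h
        rw [this, h, mul_one, hs]
      · right
        change mat (σ⁻¹ * γ * σ) = -1 at h
        rw [this, h, mul_neg, mul_one, neg_mul, hs]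
    rw [Matrix.IsHyperbolic, Matrix.discr_fin_two] at hhyp
    rcases hγ1 with h | h <;> rw [h] at hhyp <;> norm_num [Matrix.trace_fin_two, Matrix.det_fin_two] at hhyp
  obtain ⟨ε, hε, hdisj⟩ : ∃ ε : ℝ, 0 < ε ∧ Disjoint (A : Set ℝ) (Set.Ioo 0 ε) := by
    let F : ℝ → SL(2, ℝ) := fun t ↦ σ * expSL (2 * t) * σ⁻¹
    have hE0 : Continuous fun t : ℝ ↦ expDiag (2 * t) := by
      refine continuous_matrix fun i j ↦ ?_
      fin_cases i <;> fin_cases j <;> simp [expDiag] <;> fun_prop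
    have hF : Continuous F := by
      have hE : Continuous fun t : ℝ ↦ expSL (2 * t) := by
        refine Continuous.subtype_mk ?_ _
        exact hE0
      exact (continuous_const.mul hE).mul continuous_const
    have hF0 : F 0 = 1 := by
      have : expSL (2 * 0) = 1 := by
        apply Subtype.ext; simp [expSL, expDiag_zero]
      simp only [F, this]; simp
    obtain ⟨U, hU, hU1⟩ : ∃ U ∈ nhds (1 : SL(2, ℝ)), ∀ x ∈ U, x ∈ Γ → x = 1 := by
      have h1 : ({1} : Set Γ) ∈ nhds (1 : Γ) := (isOpen_discrete _).mem_nhds rfl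
      rw [nhds_subtype_eq_comap, Filter.mem_comap] at h1
      obtain ⟨U, hU, hU'⟩ := h1
      refine ⟨U, hU, fun x hx hxΓ ↦ ?_⟩
      have : (⟨x, hxΓ⟩ : Γ) ∈ ({1} : Set Γ) := hU' hx
      simpa using congrArg Subtype.val (Set.mem_singleton_iff.1 this)
    have := hF.continuousAt.preimage_mem_nhds (x := 0) (t := U) (by rw [hF0]; exact hU)
    obtain ⟨ε, hε, hball⟩ := Metric.mem_nhds_iff.1 this
    refine ⟨ε, hε, Set.disjoint_left.2 fun t ht hlt ↦ ?_⟩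
    obtain ⟨γ, hγ, h⟩ := ht
    have hsq : mat (σ⁻¹ * (γ * γ) * σ) = expDiag (2 * t) := by
      rw [hmul, two_mul, expDiag_add]
      rcases h with h | h <;> simp [h]
    have hFt : F t = γ * γ := by
      have : expSL (2 * t) = σ⁻¹ * (γ * γ) * σ :=
        Subtype.ext hsq.symm
      simp only [F, this]; group
    have h1 := hU1 (F t) (hball (by simpa [abs_of_pos hlt.1] using hlt.2))
      (hFt ▸ Γ.mul_mem hγ hγ)
    rw [hFt] at h1
    rw [h1] at hsq
    have h00 := congrFun (congrFun hsq 0) 0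
    simp [expDiag] at h00
    exact absurd h00 (Real.one_lt_exp_iff.2 hlt.1).ne
  obtain ⟨b, hb⟩ := AddSubgroup.exists_isLeast_pos hne hε hdisj
  have hlen : hypLength Γ σ = b := by
    rw [hypLength, ← hb.csInf_eq]
    congr 1
    ext t
    exact and_comm
  have hcl := AddSubgroup.cyclic_of_min hb
  rw [hlen]
  refine ⟨hb.1.2, fun M ↦ ⟨?_, ?_⟩⟩
  · rintro ⟨γ, hγ, hM⟩
    obtain ⟨h1, h2⟩ := (mem_pairStabilizer_iff hσ γ).1 hγ
    obtain ⟨t, ht⟩ := exists_expDiag _ h1 h2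
    have htA : t ∈ A := ⟨γ, γ.2, ht⟩
    rw [hcl, AddSubgroup.mem_closure_singleton] at htA
    obtain ⟨j, rfl⟩ := htA
    rw [zsmul_eq_mul] at ht
    refine ⟨j, ?_⟩
    rcases ht with h | h <;> rcases hM with h' | h' <;> rw [h', h] <;> simp
  · rintro ⟨j, hM⟩
    have hj : (j : ℝ) * b ∈ A := by
      rw [← zsmul_eq_mul]; exact A.zsmul_mem hb.1.1 j
    obtain ⟨γ, hγ, h⟩ := (hA _).1 hj
    refine ⟨⟨γ, hγ⟩, (mem_pairStabilizer_iff hσ _).2 ?_, ?_⟩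
    · rcases h with h | h <;> simp only [h] <;> simp [expDiag]
    · rcases h with h | h <;> rcases hM with h' | h' <;> simp only [h, h'] <;> simp

/-- The function `z ↦ z^{-k/2 + 2 π i m / ℓ}` on `ℍ` (principal branch). -/
def hypMode (k : ℕ) (ℓ : ℝ) (m : ℤ) (z : ℍ) : ℂ :=
  (z : ℂ) ^ (-(k : ℂ) / 2 + 2 * (Real.pi : ℂ) * Complex.I * (m : ℂ) / (ℓ : ℂ))

/-- The set `Γ_η \ Γ`. -/
abbrev CosetSpace (Γ : Subgroup SL(2, ℝ)) (η : OnePoint ℝ × OnePoint ℝ) : Type :=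
  Quotient (QuotientGroup.rightRel (pairStabilizer Γ η))

/-- The summand `z^{-k/2 + 2 π i m / ℓ_η} |_k σ_η⁻¹ γ` of the Poincaré series, for the class
of `γ` in `Γ_η \ Γ`. For even `k` it does not depend on the representative. -/
def poincareTerm (Γ : Subgroup SL(2, ℝ)) (η : OnePoint ℝ × OnePoint ℝ) (σ : SL(2, ℝ))
    (k : ℕ) (m : ℤ) (q : CosetSpace Γ η) : ℍ → ℂ :=
  SlashAction.map (k : ℤ) ((σ⁻¹ * (q.out : SL(2, ℝ)) : SL(2, ℝ)) : GL (Fin 2) ℝ)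
    (hypMode k (hypLength Γ σ) m)

/-- The hyperbolic Poincaré series `P_{η,m}` of weight `k`. -/
def poincareSeries (Γ : Subgroup SL(2, ℝ)) (η : OnePoint ℝ × OnePoint ℝ) (σ : SL(2, ℝ))
    (k : ℕ) (m : ℤ) (z : ℍ) : ℂ :=
  ∑' q : CosetSpace Γ η, poincareTerm Γ η σ k m q z

/-- `c` is the family of coefficients of the hyperbolic Fourier expansion of `f` at the pair with
scaling matrix `σ`: for all `z ∈ ℍ`, `(f |_k σ)(z) = ∑ₙ c(n) z^{-k/2 + 2 π i n / ℓ}`. -/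
def IsHypExpansion (Γ : Subgroup SL(2, ℝ)) (σ : SL(2, ℝ)) (k : ℕ) (f : ℍ → ℂ) (c : ℤ → ℂ) :
    Prop :=
  ∀ z : ℍ, HasSum (fun n : ℤ ↦ c n * hypMode k (hypLength Γ σ) n z)
    (SlashAction.map (k : ℤ) (σ : GL (Fin 2) ℝ) f z)

/-- The set `C_{ηη'}` of all `ad` with `(a b; c d) ∈ σ⁻¹ Γ σ'` and `abcd ≠ 0`. -/
def cSet (Γ : Subgroup SL(2, ℝ)) (σ σ' : SL(2, ℝ)) : Set ℝ :=
  {C | ∃ γ ∈ Γ, mat (σ⁻¹ * γ * σ') 0 0 * mat (σ⁻¹ * γ * σ') 0 1 *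
      mat (σ⁻¹ * γ * σ') 1 0 * mat (σ⁻¹ * γ * σ') 1 1 ≠ 0 ∧
    mat (σ⁻¹ * γ * σ') 0 0 * mat (σ⁻¹ * γ * σ') 1 1 = C}

/-- The set `Γ_η \ Γ / Γ_η'`. -/
abbrev DoubleCosets (Γ : Subgroup SL(2, ℝ)) (η η' : OnePoint ℝ × OnePoint ℝ) : Type :=
  DoubleCoset.Quotient (G := Γ) (pairStabilizer Γ η : Set Γ) (pairStabilizer Γ η' : Set Γ)

/-- The matrix `(a b; c d) = σ⁻¹ γ σ'` for a representative `γ` of a double coset. -/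
def repMat {Γ : Subgroup SL(2, ℝ)} {η η' : OnePoint ℝ × OnePoint ℝ} (σ σ' : SL(2, ℝ))
    (q : DoubleCosets Γ η η') : Matrix (Fin 2) (Fin 2) ℝ :=
  mat (σ⁻¹ * ((Quotient.out q : Γ) : SL(2, ℝ)) * σ')

/-- The double cosets with `ad = C`, `sgn(ac) = α`, `sgn(cd) = β`; these conditions do not depend
on the representative. -/
def kloostermanIndex (Γ : Subgroup SL(2, ℝ)) (η η' : OnePoint ℝ × OnePoint ℝ) (σ σ' : SL(2, ℝ))
    (C : ℝ) (α β : ℤˣ) : Set (DoubleCosets Γ η η') :=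
  {q | repMat σ σ' q 0 0 * repMat σ σ' q 1 1 = C ∧
    Real.sign (repMat σ σ' q 0 0 * repMat σ σ' q 1 0) = ((α : ℤ) : ℝ) ∧
    Real.sign (repMat σ σ' q 1 0 * repMat σ σ' q 1 1) = ((β : ℤ) : ℝ)}

/-- The Kloosterman sum `S_{ηη'}(m, n; C, α, β)`, the sum of
`e((m / 2ℓ_η) log |ab/cd| + (n / 2ℓ_η') log |ac/bd|)` with `e(x) = exp(2 π i x)`. -/
def kloostermanSum (Γ : Subgroup SL(2, ℝ)) (η η' : OnePoint ℝ × OnePoint ℝ) (σ σ' : SL(2, ℝ))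
    (m n : ℤ) (C : ℝ) (α β : ℤˣ) : ℂ :=
  ∑ᶠ q ∈ kloostermanIndex Γ η η' σ σ' C α β,
    Complex.exp (2 * (Real.pi : ℂ) * Complex.I *
      (((m : ℝ) / (2 * hypLength Γ σ) *
          Real.log |(repMat σ σ' q 0 0 * repMat σ σ' q 0 1) /
            (repMat σ σ' q 1 0 * repMat σ σ' q 1 1)| +
        (n : ℝ) / (2 * hypLength Γ σ') *
          Real.log |(repMat σ σ' q 0 0 * repMat σ σ' q 1 0) /
            (repMat σ σ' q 0 1 * repMat σ σ' q 1 1)| : ℝ) : ℂ))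

/-- The factor `α e^u + sgn(r-1) |(r-1)/r|^{1/2}`. -/
def numFactor (r : ℝ) (α : ℤˣ) (u : ℂ) : ℂ :=
  ((α : ℤ) : ℂ) * Complex.exp u + ((Real.sign (r - 1) * Real.sqrt |(r - 1) / r| : ℝ) : ℂ)

/-- The factor `e^u + β |r/(r-1)|^{1/2}`. -/
def denFactor (r : ℝ) (β : ℤˣ) (u : ℂ) : ℂ :=
  Complex.exp u + ((β : ℤ) : ℂ) * ((Real.sqrt |r / (r - 1)| : ℝ) : ℂ)

/-- The integrand (with respect to `du`, including the factor `1/ℓ'`) of the integral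
`I_{ηη'}(m, n; r, α, β)`, where `ℓ = ℓ_η` and `ℓ' = ℓ_η'`. -/
def hhIntegrand (k : ℕ) (ℓ ℓ' : ℝ) (m n : ℤ) (r : ℝ) (α β : ℤˣ) (u : ℂ) : ℂ :=
  (((Real.sqrt |r / (r - 1)| : ℝ) : ℂ) * (numFactor r α u / denFactor r β u)) ^
      (2 * (Real.pi : ℂ) * Complex.I * (m : ℂ) / (ℓ : ℂ)) *
    Complex.exp (u * ((k : ℂ) / 2 - 2 * (Real.pi : ℂ) * Complex.I * (n : ℂ) / (ℓ' : ℂ))) /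
    (numFactor r α u ^ ((k : ℂ) / 2) * denFactor r β u ^ ((k : ℂ) / 2)) / (ℓ' : ℂ)

/-- The integral `I_{ηη'}(m, n; r, α, β)` along the horizontal line `Im u = y`. -/
def hhIntegral (k : ℕ) (ℓ ℓ' : ℝ) (m n : ℤ) (r : ℝ) (α β : ℤˣ) (y : ℝ) : ℂ :=
  ∫ x : ℝ, hhIntegrand k ℓ ℓ' m n r α β ((x : ℂ) + (y : ℂ) * Complex.I)

/-- The number `a`: if `η' ≡ η mod Γ`, then `σ (a 0; 0 1/a) σ'⁻¹ ∈ Γ`. -/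
def IsDiagParam (Γ : Subgroup SL(2, ℝ)) (η η' : OnePoint ℝ × OnePoint ℝ) (σ σ' : SL(2, ℝ))
    (a : ℝ) : Prop :=
  a ≠ 0 ∧ (PairEquiv Γ η' η → ∃ δ ∈ Γ, mat (σ⁻¹ * δ * σ') = !![a, 0; 0, 1 / a])

/-- The number `b`: if `η' ≡ η* mod Γ`, then `σ (0 b; -1/b 0) σ'⁻¹ ∈ Γ`, where `η*` is the
reversed pair. -/
def IsAntidiagParam (Γ : Subgroup SL(2, ℝ)) (η η' : OnePoint ℝ × OnePoint ℝ) (σ σ' : SL(2, ℝ))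
    (b : ℝ) : Prop :=
  b ≠ 0 ∧ (PairEquiv Γ η' η.swap → ∃ δ ∈ Γ, mat (σ⁻¹ * δ * σ') = !![0, b; -(1 / b), 0])

open Classical in
/-- The extra term for `η' ≡ η mod Γ` and `n = m`. -/
def extraDiag (Γ : Subgroup SL(2, ℝ)) (η η' : OnePoint ℝ × OnePoint ℝ) (ℓ' : ℝ)
    (m n : ℤ) (a : ℝ) : ℂ :=
  if PairEquiv Γ η' η ∧ n = m then
    ((a ^ 2 : ℝ) : ℂ) ^ (2 * (Real.pi : ℂ) * Complex.I * (n : ℂ) / (ℓ' : ℂ))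
  else 0

open Classical in
/-- The extra term for `η' ≡ η* mod Γ` and `n = -m`. -/
def extraAntidiag (Γ : Subgroup SL(2, ℝ)) (η η' : OnePoint ℝ × OnePoint ℝ) (k : ℕ) (ℓ' : ℝ)
    (m n : ℤ) (b : ℝ) : ℂ :=
  if PairEquiv Γ η' η.swap ∧ n = -m then
    (-1) ^ (k / 2) * ((Real.exp (2 * Real.pi ^ 2 * (n : ℝ) / ℓ') : ℝ) : ℂ) *
      ((b ^ 2 : ℝ) : ℂ) ^ (-(2 * (Real.pi : ℂ) * Complex.I * (n : ℂ) / (ℓ' : ℂ)))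
  else 0

/-- The term `I_{ηη'}(m,n;C,α,β) S_{ηη'}(m,n;C,α,β) / |C(C-1)|^{k/4}`. -/
def mainTerm (Γ : Subgroup SL(2, ℝ)) (η η' : OnePoint ℝ × OnePoint ℝ) (σ σ' : SL(2, ℝ))
    (k : ℕ) (m n : ℤ) (y C : ℝ) (α β : ℤˣ) : ℂ :=
  hhIntegral k (hypLength Γ σ) (hypLength Γ σ') m n C α β y *
    kloostermanSum Γ η η' σ σ' m n C α β / ((|C * (C - 1)| ^ ((k : ℝ) / 4) : ℝ) : ℂ)

end HypPoincare

end

open scoped MatrixGroups UpperHalfPlane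

noncomputable section

namespace HypPoincare

open MeasureTheory

/-! Put `z = e^u`. The upper half-plane becomes the strip `0 < Im u < π`. After multiplication by
`e^{ku/2}`, the hyperbolic expansion of `f` at `η'` becomes an ordinary Fourier expansion of a
function of `u` with period `ℓ' = ℓ_η'`. Existence and uniqueness of the expansion are then Fourier
theory for holomorphic periodic functions on a strip (`hasSum_stripCoeff`,
`eq_stripCoeff_of_hasSum`), and the coefficients are integrals over one period of any horizontal
line.

Convergence. Write `σ⁻¹ γ σ' = (a b; c d)` and `k = 2h`. On compact sets the summand of `γ` is
`O((‖(a, b)‖ ‖(c, d)‖)^{-h})` with `h ≥ 2`. Left multiplication by `Γ_η` rescales the two rows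
inversely, so each coset has a representative with rows of comparable length, for which the product
of row norms is comparable to the square of the matrix norm. It remains to see that `∑ ‖γ‖⁻⁴`
converges over a discrete group. This follows by comparing the sum with the hyperbolic integral of
`(y / (1 + |z|²))²` (`summable_size`, `summable_rowNorm`).

Coefficients. Discreteness forces two hyperbolic pairs that share one point to share both, so `(a b;
c d)` is diagonal, antidiagonal, or has no zero entry (`mat_trichotomy`). The first two kinds fill
at most one coset each; their summands are single exponentials and give `E₁` and `E₂`. For the third
kind, `Γ_η' / ±1` acts freely from the right on the cosets inside a double coset, and acts on the
summands as translation by multiples of `ℓ'` (`exists_genericEquiv`, `stripTerm_mul_expSL`). The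
integrals over one period therefore unfold to one integral over a full line
(`hasSum_stripCoeff_mul`). A real shift of `u` makes the integrand depend only on `C = ad` and two
signs. The constants left over are the Kloosterman phase and `|C(C-1)|^{-k/4}`
(`stripTerm_shift_mul_expMode`). Collecting double cosets with the same `C`, `α`, `β` gives the
formula (`hasSum_mainTerm`). -/

/-! ### Matrix norms and the convergence of `∑ ‖γ‖⁻⁴`. -/

/-- The `ℓ¹` norm of the `i`-th row of `g`. -/
def rowNorm (g : SL(2, ℝ)) (i : Fin 2) : ℝ := |mat g i 0| + |mat g i 1|

/-- The sum of the absolute values of the entries of `g`. -/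
def size (g : SL(2, ℝ)) : ℝ := rowNorm g 0 + rowNorm g 1

theorem det_mat (g : SL(2, ℝ)) : mat g 0 0 * mat g 1 1 - mat g 0 1 * mat g 1 0 = 1 := by
  have := g.2
  rwa [Matrix.det_fin_two] at this

theorem rowNorm_pos (g : SL(2, ℝ)) (i : Fin 2) : 0 < rowNorm g i := by
  have h := det_mat g
  have h0 : 0 ≤ rowNorm g i := by unfold rowNorm; positivity
  refine h0.lt_of_ne fun h1 ↦ ?_
  have ha : mat g i 0 = 0 := abs_nonpos_iff.1 (by
    have := abs_nonneg (mat g i 1); unfold rowNorm at h1; linarith)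
  have hb : mat g i 1 = 0 := abs_nonpos_iff.1 (by
    have := abs_nonneg (mat g i 0); unfold rowNorm at h1; linarith)
  fin_cases i
  · simp only [Fin.zero_eta] at ha hb
    rw [ha, hb] at h; norm_num at h
  · simp only [Fin.mk_one] at ha hb
    rw [ha, hb] at h; norm_num at h

theorem size_pos (g : SL(2, ℝ)) : 0 < size g := add_pos (rowNorm_pos g 0) (rowNorm_pos g 1)

theorem abs_mat_le_size (g : SL(2, ℝ)) (i j : Fin 2) : |mat g i j| ≤ size g := by
  have := abs_nonneg (mat g 0 0)
  have := abs_nonneg (mat g 0 1)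
  have := abs_nonneg (mat g 1 0)
  have := abs_nonneg (mat g 1 1)
  unfold size rowNorm
  fin_cases i <;> fin_cases j <;> simp only [Fin.zero_eta, Fin.mk_one] <;> linarith

theorem mat_mul (g g' : SL(2, ℝ)) (i j : Fin 2) :
    mat (g * g') i j = mat g i 0 * mat g' 0 j + mat g i 1 * mat g' 1 j := by
  simp [mat, Matrix.mul_apply, Fin.sum_univ_two]

theorem size_mul_le (g g' : SL(2, ℝ)) : size (g * g') ≤ size g * size g' := by
  have key (i : Fin 2) : rowNorm (g * g') i ≤ rowNorm g i * size g' := by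
    unfold rowNorm size rowNorm
    rw [mat_mul, mat_mul]
    have h1 := abs_add_le (mat g i 0 * mat g' 0 0) (mat g i 1 * mat g' 1 0)
    have h2 := abs_add_le (mat g i 0 * mat g' 0 1) (mat g i 1 * mat g' 1 1)
    simp only [abs_mul] at h1 h2
    have := mul_nonneg (abs_nonneg (mat g i 0)) (abs_nonneg (mat g' 1 0))
    have := mul_nonneg (abs_nonneg (mat g i 0)) (abs_nonneg (mat g' 1 1))
    have := mul_nonneg (abs_nonneg (mat g i 1)) (abs_nonneg (mat g' 0 0))
    have := mul_nonneg (abs_nonneg (mat g i 1)) (abs_nonneg (mat g' 0 1))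
    nlinarith
  calc size (g * g') ≤ rowNorm g 0 * size g' + rowNorm g 1 * size g' :=
        add_le_add (key 0) (key 1)
    _ = _ := by unfold size; ring

/-- A discrete subgroup of `SL(2, ℝ)` has finitely many elements of bounded size. -/
theorem finite_size_le {Γ : Subgroup SL(2, ℝ)} (hΓ : DiscreteTopology Γ) (R : ℝ) :
    {γ : Γ | size (γ : SL(2, ℝ)) ≤ R}.Finite := by
  have hK : IsCompact {m : Matrix (Fin 2) (Fin 2) ℝ | ∀ i j, m i j ∈ Set.Icc (-R) R} := by
    have : {m : Matrix (Fin 2) (Fin 2) ℝ | ∀ i j, m i j ∈ Set.Icc (-R) R} =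
        Set.pi Set.univ fun _ ↦ Set.pi Set.univ fun _ ↦ Set.Icc (-R) R := by
      ext m
      exact ⟨fun h i _ j _ ↦ h i j, fun h i j ↦ h i trivial j trivial⟩
    rw [this]
    exact isCompact_univ_pi fun _ ↦ isCompact_univ_pi fun _ ↦ isCompact_Icc
  have hK' := Matrix.SpecialLinearGroup.isClosedEmbedding_val.isCompact_preimage hK
  -- The inclusion of a discrete subgroup is proper: a compact set contains only finitely many of
  -- its elements.
  have h := Subgroup.tendsto_coe_cofinite_of_discrete Γ
    (isDiscrete_iff_discreteTopology.mpr hΓ) hK'.compl_mem_cocompact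
  replace h := Filter.mem_cofinite.1 (Filter.mem_map.1 h)
  refine h.subset fun γ hγ ↦ ?_
  exact fun h' ↦ h' fun i j ↦ abs_le.1 ((abs_mat_le_size _ i j).trans hγ)

theorem coe_smul_eq (g : SL(2, ℝ)) (z : ℍ) :
    ((g • z : ℍ) : ℂ) = (mat g 0 0 * z + mat g 0 1) / (mat g 1 0 * z + mat g 1 1) := by
  rw [UpperHalfPlane.coe_specialLinearGroup_apply]; rfl

theorem lin_ne_zero (g : SL(2, ℝ)) (i : Fin 2) {z : ℂ} (hz : z.im ≠ 0) :
    (mat g i 0 : ℂ) * z + mat g i 1 ≠ 0 := by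
  intro h
  have h1 := congrArg Complex.im h
  simp [hz] at h1
  have h2 := congrArg Complex.re h
  simp [h1] at h2
  have := rowNorm_pos g i
  simp [rowNorm, mat, h1, h2] at this

theorem norm_lin_le (g : SL(2, ℝ)) (i : Fin 2) (z : ℂ) :
    ‖(mat g i 0 : ℂ) * z + mat g i 1‖ ≤ (1 + ‖z‖) * rowNorm g i := by
  refine (norm_add_le _ _).trans ?_
  rw [norm_mul, Complex.norm_real, Complex.norm_real, Real.norm_eq_abs, Real.norm_eq_abs]
  unfold rowNorm
  nlinarith [mul_nonneg (abs_nonneg (mat g i 1)) (norm_nonneg z), abs_nonneg (mat g i 0)]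

/-- The imaginary part of `az + b` is `a Im z`, which controls `a`; the triangle inequality then
controls `b`. Together with `norm_lin_le` this makes `|az + b|` comparable to the row norm,
uniformly for `z` in a compact set. -/
theorem rowNorm_le_norm_lin (g : SL(2, ℝ)) (i : Fin 2) {z : ℂ} (hz : 0 < z.im) :
    rowNorm g i ≤ ‖(mat g i 0 : ℂ) * z + mat g i 1‖ * (1 + (1 + ‖z‖) / z.im) := by
  set w := (mat g i 0 : ℂ) * z + mat g i 1 with hw
  have h1 : |mat g i 0| * z.im ≤ ‖w‖ := by
    have := Complex.abs_im_le_norm w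
    rwa [show w.im = mat g i 0 * z.im by simp [hw], abs_mul, abs_of_pos hz] at this
  have h2 : |mat g i 1| ≤ ‖w‖ + |mat g i 0| * ‖z‖ := by
    have := norm_sub_le w ((mat g i 0 : ℂ) * z)
    rwa [show w - (mat g i 0 : ℂ) * z = mat g i 1 by rw [hw]; ring, norm_mul, Complex.norm_real,
      Complex.norm_real, Real.norm_eq_abs, Real.norm_eq_abs] at this
  have h3 : |mat g i 0| ≤ ‖w‖ / z.im := by rwa [le_div_iff₀ hz]
  calc rowNorm g i ≤ ‖w‖ + |mat g i 0| * (1 + ‖z‖) := by unfold rowNorm; linarith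
    _ ≤ ‖w‖ + ‖w‖ / z.im * (1 + ‖z‖) := by gcongr
    _ = _ := by ring

/-- The function `(y / (1 + |z|²))²` on `ℍ`. -/
def decay (z : ℍ) : ℝ := (z.im / (1 + ‖(z : ℂ)‖ ^ 2)) ^ 2

/-- Both `Im (gz)` and `1 + |gz|²` carry the denominator `|cz + d|²`, which cancels in the quotient.
-/
theorem decay_smul (g : SL(2, ℝ)) (z : ℍ) :
    decay (g • z) = (z.im / (‖(mat g 0 0 : ℂ) * z + mat g 0 1‖ ^ 2 +
      ‖(mat g 1 0 : ℂ) * z + mat g 1 1‖ ^ 2)) ^ 2 := by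
  have hd : 0 < ‖(mat g 1 0 : ℂ) * z + mat g 1 1‖ :=
    norm_pos_iff.2 (lin_ne_zero g 1 z.im_ne_zero)
  have him : (g • z : ℍ).im = z.im / ‖(mat g 1 0 : ℂ) * z + mat g 1 1‖ ^ 2 := by
    rw [MulAction.compHom_smul_def, UpperHalfPlane.im_smul_eq_div_normSq,
      Matrix.SpecialLinearGroup.det_mapGL, Units.val_one, abs_one, one_mul,
      Complex.normSq_eq_norm_sq]
    rfl
  rw [decay, him, coe_smul_eq, norm_div]
  congr 1
  field_simp
  ring

theorem le_decay_smul (g : SL(2, ℝ)) (z : ℍ) :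
    (z.im / (1 + ‖(z : ℂ)‖) ^ 2) ^ 2 / size g ^ 4 ≤ decay (g • z) := by
  have h0 := norm_lin_le g 0 z
  have h1 := norm_lin_le g 1 z
  have hs := size_pos g
  have hd : 0 < ‖(mat g 1 0 : ℂ) * z + mat g 1 1‖ :=
    norm_pos_iff.2 (lin_ne_zero g 1 z.im_ne_zero)
  have hz := z.im_pos
  rw [decay_smul, show (z.im / (1 + ‖(z : ℂ)‖) ^ 2) ^ 2 / size g ^ 4 =
    (z.im / ((1 + ‖(z : ℂ)‖) ^ 2 * size g ^ 2)) ^ 2 by field_simp]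
  gcongr
  calc _ ≤ ((1 + ‖(z : ℂ)‖) * rowNorm g 0) ^ 2 + ((1 + ‖(z : ℂ)‖) * rowNorm g 1) ^ 2 := by gcongr
    _ ≤ _ := by
      have := rowNorm_pos g 0
      have := rowNorm_pos g 1
      unfold size
      have : 0 ≤ (1 + ‖(z : ℂ)‖) ^ 2 * (rowNorm g 0 * rowNorm g 1) := by positivity
      nlinarith

theorem measurable_decay : Measurable decay := by
  have h1 : Measurable fun z : ℍ ↦ z.im := UpperHalfPlane.continuous_im.measurable
  have h2 := UpperHalfPlane.measurable_coe
  unfold decay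
  fun_prop

/-- The factor `y²` of `decay` cancels the density `y⁻²` of the hyperbolic measure. What remains is
`(1 + |z|²)⁻²`, which is integrable over the plane because `4 > 2`. -/
theorem lintegral_decay_lt_top : ∫⁻ z : ℍ, ENNReal.ofReal (decay z) < ⊤ := by
  have hm : Measurable fun z : ℍ ↦ (1 / NNReal.mk z.im z.im_pos.le : NNReal) ^ 2 := by
    have h1 : Measurable fun z : ℍ ↦ z.im := UpperHalfPlane.continuous_im.measurable
    have h2 : Measurable fun z : ℍ ↦ NNReal.mk z.im z.im_pos.le := h1.subtype_mk
    fun_prop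
  rw [UpperHalfPlane.volume_def, lintegral_withDensity_eq_lintegral_mul₀
    (by exact hm.coe_nnreal_ennreal.aemeasurable) (by exact measurable_decay.ennreal_ofReal.aemeasurable)]
  have he : ∀ z : ℍ, ((fun z : ℍ ↦ (((1 / NNReal.mk z.im z.im_pos.le : NNReal) ^ 2 : NNReal) :
      ENNReal)) * fun z ↦ ENNReal.ofReal (decay z)) z =
      ENNReal.ofReal ((1 + ‖(z : ℂ)‖ ^ 2) ^ (-(4 : ℝ) / 2)) := by
    intro z
    have hz := z.im_pos
    rw [Pi.mul_apply, ← ENNReal.ofReal_coe_nnreal, ← ENNReal.ofReal_mul (by positivity)]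
    congr 1
    rw [show (-(4 : ℝ) / 2) = -((2 : ℕ) : ℝ) by norm_num, Real.rpow_neg (by positivity),
      Real.rpow_natCast]
    simp only [decay, NNReal.coe_pow, NNReal.coe_div, NNReal.coe_one, NNReal.coe_mk]
    field_simp
  simp_rw [he]
  have hint : Integrable (fun x : ℂ ↦ ((1 : ℝ) + ‖x‖ ^ 2) ^ (-(4 : ℝ) / 2)) :=
    integrable_rpow_neg_one_add_norm_sq (by rw [Complex.finrank_real_complex]; norm_num)
  have hmp : MeasurePreserving UpperHalfPlane.coe (volume.comap UpperHalfPlane.coe)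
      (volume.restrict (.range UpperHalfPlane.coe)) :=
    ⟨UpperHalfPlane.measurable_coe, by rw [UpperHalfPlane.measurableEmbedding_coe.map_comap]⟩
  rw [hmp.lintegral_comp_emb UpperHalfPlane.measurableEmbedding_coe
    (fun x : ℂ ↦ ENNReal.ofReal ((1 + ‖x‖ ^ 2) ^ (-(4 : ℝ) / 2)))]
  refine (setLIntegral_le_lintegral _ _).trans_lt ?_
  have h := hint.2
  rw [hasFiniteIntegral_iff_ofReal (.of_forall fun x ↦ by positivity)] at h
  exact h

/-- The half-plane is a countable union of compact sets, so if all of them were null its hyperbolic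
volume would vanish. -/
theorem exists_compact_volume_pos :
    ∃ K : Set ℍ, IsCompact K ∧ K.Nonempty ∧ 0 < volume K := by
  by_contra! h
  have h0 : volume (Set.univ : Set ℍ) = 0 := by
    rw [← iUnion_compactCovering, measure_iUnion_null_iff]
    intro n
    rcases (compactCovering ℍ n).eq_empty_or_nonempty with he | hne
    · rw [he, measure_empty]
    · exact le_zero_iff.1 (h _ (isCompact_compactCovering _ n) hne)
  rw [UpperHalfPlane.volume_eq_lintegral, Set.image_univ] at h0
  have hopen : IsOpen (Set.range UpperHalfPlane.coe) :=
    UpperHalfPlane.isOpenEmbedding_coe.isOpen_range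
  have hpos : 0 < ∫⁻ z : ℂ in Set.range UpperHalfPlane.coe,
      (((1 / ‖z.im‖₊) ^ 2 : NNReal) : ENNReal) := by
    rw [setLIntegral_pos_iff (by fun_prop)]
    have hsub : Set.range UpperHalfPlane.coe ⊆ Function.support
        (fun z : ℂ ↦ (((1 / ‖z.im‖₊) ^ 2 : NNReal) : ENNReal)) := by
      rintro _ ⟨z, rfl⟩
      simp [z.im_ne_zero]
    rw [Set.inter_eq_self_of_subset_right hsub]
    exact hopen.measure_pos _ (Set.range_nonempty _)
  exact hpos.ne' h0

/-- For a discrete group `Γ ⊂ SL(2, ℝ)` the sum of `‖γ‖⁻⁴` over `Γ` converges. -/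
theorem summable_size {Γ : Subgroup SL(2, ℝ)} (hΓ : DiscreteTopology Γ) :
    Summable fun γ : Γ ↦ (size (γ : SL(2, ℝ)) ^ 4)⁻¹ := by
  classical
  obtain ⟨K, hK, hne, hpos⟩ := exists_compact_volume_pos
  -- Proper discontinuity: `N` bounds how many translates of `K` can cover one point.
  have hS : Set.Finite {γ : Γ | ((γ • ·) '' K ∩ K).Nonempty} :=
    ProperlyDiscontinuousSMul.finite_disjoint_inter_image hK hK
  set N : ℕ := hS.toFinset.card with hN
  obtain ⟨z₀, hz₀, hmin⟩ := hK.exists_isMinOn hne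
    (f := fun z : ℍ ↦ (z.im / (1 + ‖(z : ℂ)‖) ^ 2) ^ 2) (by
      refine Continuous.continuousOn ?_
      have h1 := UpperHalfPlane.continuous_im
      have h2 := UpperHalfPlane.continuous_coe
      refine ((h1.div ((continuous_const.add h2.norm).pow 2) fun z ↦ ?_).pow 2)
      change (1 + ‖(z : ℂ)‖) ^ 2 ≠ 0
      positivity)
  set c : ℝ := (z₀.im / (1 + ‖(z₀ : ℂ)‖) ^ 2) ^ 2 with hc
  have hc0 : 0 < c := by have := z₀.im_pos; positivity
  -- If `w` lies in `γ₀ K` and in `γ K`, then `γ₀⁻¹ γ K` meets `K`. So `γ ↦ γ₀⁻¹ γ` injects the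
  -- translates covering `w` into the finite set `hS`.
  have hmult (w : ℍ) (s : Finset Γ) :
      (∑ γ ∈ s, ((γ • ·) '' K).indicator (fun z ↦ ENNReal.ofReal (decay z)) w) ≤
        N * ENNReal.ofReal (decay w) := by
    have hcard : (s.filter fun γ : Γ ↦ w ∈ (γ • ·) '' K).card ≤ N := by
      rcases (s.filter fun γ : Γ ↦ w ∈ (γ • ·) '' K).eq_empty_or_nonempty with he | ⟨γ₀, h₀⟩
      · rw [he]; simp
      · obtain ⟨z₁, hz₁, hw⟩ := (Finset.mem_filter.1 h₀).2
        refine Finset.card_le_card_of_injOn (fun γ ↦ γ₀⁻¹ * γ) (fun γ hγ ↦ ?_)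
          (fun x _ y _ h ↦ mul_left_cancel h)
        obtain ⟨z₂, hz₂, hw₂⟩ := (Finset.mem_filter.1 hγ).2
        simp only [Set.Finite.coe_toFinset, Set.mem_ofPred_eq]
        refine ⟨z₁, ⟨z₂, hz₂, ?_⟩, hz₁⟩
        simp only [mul_smul] at hw hw₂ ⊢
        rw [hw₂, ← hw, inv_smul_smul]
    calc _ = ∑ γ ∈ s.filter (fun γ : Γ ↦ w ∈ (γ • ·) '' K), ENNReal.ofReal (decay w) := by
          rw [Finset.sum_filter]
          exact Finset.sum_congr rfl fun γ _ ↦ by rw [Set.indicator_apply]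
      _ ≤ _ := by
          rw [Finset.sum_const, nsmul_eq_mul]
          gcongr
  have hmeas (γ : Γ) : MeasurableSet ((γ • ·) '' K) :=
    (hK.image (continuous_const_smul γ)).isClosed.measurableSet
  -- By invariance of the measure, the integral of `decay` over `γ K` is that of `decay (γ z)` over
  -- `K`, where `le_decay_smul` bounds the integrand below by `c ‖γ‖⁻⁴`.
  have hterm (γ : Γ) : ENNReal.ofReal (c * (size (γ : SL(2, ℝ)) ^ 4)⁻¹) * volume K ≤
      ∫⁻ z : ℍ, ((γ • ·) '' K).indicator (fun z ↦ ENNReal.ofReal (decay z)) z := by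
    rw [lintegral_indicator (hmeas γ)]
    have hmp : MeasurePreserving (fun z : ℍ ↦ γ • z) volume volume :=
      measurePreserving_smul (Matrix.SpecialLinearGroup.mapGL ℝ (γ : SL(2, ℝ))) volume
    have hemb : MeasurableEmbedding (fun z : ℍ ↦ γ • z) :=
      (Homeomorph.smul γ).measurableEmbedding
    rw [← hmp.setLIntegral_comp_emb hemb, ← setLIntegral_const]
    refine setLIntegral_mono' hK.isClosed.measurableSet fun z hz ↦ ENNReal.ofReal_le_ofReal ?_
    refine le_trans ?_ (le_decay_smul (γ : SL(2, ℝ)) z)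
    rw [← div_eq_mul_inv]
    have := size_pos (γ : SL(2, ℝ))
    gcongr
    exact hmin hz
  set J := ∫⁻ z : ℍ, ENNReal.ofReal (decay z) with hJ
  have hJtop : (N : ENNReal) * J ≠ ⊤ :=
    ENNReal.mul_ne_top (by simp) lintegral_decay_lt_top.ne
  have hKtop : volume K ≠ ⊤ := hK.measure_lt_top.ne
  have hsum (s : Finset Γ) : ENNReal.ofReal (∑ γ ∈ s, c * (size (γ : SL(2, ℝ)) ^ 4)⁻¹) *
      volume K ≤ N * J := by
    rw [ENNReal.ofReal_sum_of_nonneg fun γ _ ↦ by have := size_pos (γ : SL(2, ℝ)); positivity,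
      Finset.sum_mul]
    calc _ ≤ ∑ γ ∈ s, ∫⁻ z : ℍ,
          ((γ • ·) '' K).indicator (fun z ↦ ENNReal.ofReal (decay z)) z :=
          Finset.sum_le_sum fun γ _ ↦ hterm γ
      _ = ∫⁻ z : ℍ, ∑ γ ∈ s, ((γ • ·) '' K).indicator (fun z ↦ ENNReal.ofReal (decay z)) z :=
          (lintegral_finsetSum _ fun γ _ ↦
            measurable_decay.ennreal_ofReal.indicator (hmeas γ)).symm
      _ ≤ ∫⁻ z : ℍ, N * ENNReal.ofReal (decay z) := lintegral_mono fun w ↦ hmult w s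
      _ = _ := lintegral_const_mul _ measurable_decay.ennreal_ofReal
  have hS' : Summable fun γ : Γ ↦ c * (size (γ : SL(2, ℝ)) ^ 4)⁻¹ := by
    refine summable_of_sum_le (c := ((N : ENNReal) * J).toReal / (volume K).toReal)
      (fun γ ↦ by have := size_pos (γ : SL(2, ℝ)); positivity) fun s ↦ ?_
    have h := ENNReal.toReal_mono hJtop (hsum s)
    rw [ENNReal.toReal_mul, ENNReal.toReal_ofReal (Finset.sum_nonneg fun γ _ ↦ by
      have := size_pos (γ : SL(2, ℝ)); positivity)] at h
    rwa [le_div_iff₀ (ENNReal.toReal_pos hpos.ne' hKtop)]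
  exact (summable_mul_left_iff hc0.ne').1 hS'

/-- The summability of `‖γ‖⁻⁴`, for a two-sided translate of `Γ`. -/
theorem summable_size_translate {Γ : Subgroup SL(2, ℝ)} (hΓ : DiscreteTopology Γ)
    (g g' : SL(2, ℝ)) : Summable fun γ : Γ ↦ (size (g * (γ : SL(2, ℝ)) * g') ^ 4)⁻¹ := by
  refine Summable.of_nonneg_of_le
    (fun γ ↦ by have := size_pos (g * (γ : SL(2, ℝ)) * g'); positivity) (fun γ ↦ ?_)
    ((summable_size hΓ).mul_left ((size g⁻¹ * size g'⁻¹) ^ 4))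
  have h : size (γ : SL(2, ℝ)) ≤ size g⁻¹ * size (g * (γ : SL(2, ℝ)) * g') * size g'⁻¹ := by
    calc size (γ : SL(2, ℝ)) = size (g⁻¹ * (g * (γ : SL(2, ℝ)) * g') * g'⁻¹) := by
          congr 1; group
      _ ≤ size (g⁻¹ * (g * (γ : SL(2, ℝ)) * g')) * size g'⁻¹ := size_mul_le _ _
      _ ≤ _ := by
        have := size_pos g'⁻¹
        gcongr
        exact size_mul_le _ _
  have h1 := size_pos (γ : SL(2, ℝ))
  have h2 := size_pos (g * (γ : SL(2, ℝ)) * g')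
  have h3 := size_pos g⁻¹
  have h4 := size_pos g'⁻¹
  rw [← div_eq_mul_inv, inv_eq_one_div, div_le_div_iff₀ (by positivity) (by positivity), one_mul,
    ← mul_pow]
  gcongr
  linarith

theorem finite_size_translate_le {Γ : Subgroup SL(2, ℝ)} (hΓ : DiscreteTopology Γ)
    (g g' : SL(2, ℝ)) (R : ℝ) : {γ : Γ | size (g * (γ : SL(2, ℝ)) * g') ≤ R}.Finite := by
  refine (finite_size_le hΓ (size g⁻¹ * R * size g'⁻¹)).subset fun γ hγ ↦ ?_
  have hγ' : size (g * (γ : SL(2, ℝ)) * g') ≤ R := hγ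
  have h3 := size_pos g⁻¹
  have h4 := size_pos g'⁻¹
  calc size (γ : SL(2, ℝ)) = size (g⁻¹ * (g * (γ : SL(2, ℝ)) * g') * g'⁻¹) := by
        congr 1; group
    _ ≤ size (g⁻¹ * (g * (γ : SL(2, ℝ)) * g')) * size g'⁻¹ := size_mul_le _ _
    _ ≤ size g⁻¹ * size (g * (γ : SL(2, ℝ)) * g') * size g'⁻¹ := by
      gcongr
      exact size_mul_le _ _
    _ ≤ _ := by gcongr

/-! ### Entries of products with diagonal matrices. -/

theorem mat_inv (g : SL(2, ℝ)) : mat g⁻¹ 0 0 = mat g 1 1 ∧ mat g⁻¹ 0 1 = -mat g 0 1 ∧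
    mat g⁻¹ 1 0 = -mat g 1 0 ∧ mat g⁻¹ 1 1 = mat g 0 0 := by
  simp [mat, Matrix.SpecialLinearGroup.coe_inv, Matrix.adjugate_fin_two]

theorem mat_neg (g : SL(2, ℝ)) (i j : Fin 2) : mat (-g) i j = -mat g i j := by
  simp [mat]

theorem rowNorm_neg (g : SL(2, ℝ)) (i : Fin 2) : rowNorm (-g) i = rowNorm g i := by
  simp [rowNorm, mat_neg, -Matrix.SpecialLinearGroup.coe_neg]

theorem size_neg (g : SL(2, ℝ)) : size (-g) = size g := by
  simp [size, rowNorm_neg]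

theorem mat_expSL (t : ℝ) : mat (expSL t) = expDiag t := rfl

theorem expSL_add (s t : ℝ) : expSL (s + t) = expSL s * expSL t :=
  Subtype.ext (expDiag_add s t)

theorem expSL_zero : expSL 0 = 1 := Subtype.ext expDiag_zero

theorem expSL_neg (t : ℝ) : expSL (-t) = (expSL t)⁻¹ :=
  eq_inv_of_mul_eq_one_left (by rw [← expSL_add, neg_add_cancel, expSL_zero])

theorem mat_expSL_mul_zero (t : ℝ) (g : SL(2, ℝ)) (j : Fin 2) :
    mat (expSL t * g) 0 j = Real.exp (t / 2) * mat g 0 j := by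
  rw [mat_mul, mat_expSL]; simp [expDiag]

theorem mat_expSL_mul_one (t : ℝ) (g : SL(2, ℝ)) (j : Fin 2) :
    mat (expSL t * g) 1 j = Real.exp (-(t / 2)) * mat g 1 j := by
  rw [mat_mul, mat_expSL]; simp [expDiag]

theorem mat_mul_expSL_zero (t : ℝ) (g : SL(2, ℝ)) (i : Fin 2) :
    mat (g * expSL t) i 0 = mat g i 0 * Real.exp (t / 2) := by
  rw [mat_mul, mat_expSL]; simp [expDiag]

theorem mat_mul_expSL_one (t : ℝ) (g : SL(2, ℝ)) (i : Fin 2) :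
    mat (g * expSL t) i 1 = mat g i 1 * Real.exp (-(t / 2)) := by
  rw [mat_mul, mat_expSL]; simp [expDiag]

theorem eq_or_eq_neg_of_mat {g : SL(2, ℝ)} {t : ℝ} :
    (g = expSL t ∨ g = -expSL t) ↔ (mat g = expDiag t ∨ mat g = -expDiag t) := by
  refine or_congr ⟨fun h ↦ by rw [h]; rfl, fun h ↦ Subtype.ext h⟩
    ⟨fun h ↦ by rw [h]; exact Matrix.SpecialLinearGroup.coe_neg _, fun h ↦ Subtype.ext ?_⟩
  rw [Matrix.SpecialLinearGroup.coe_neg]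
  exact h

/-! ### Stabilizers of hyperbolic pairs and the sum over `Γ_η \ Γ`. -/

section Stabilizer

variable {Γ : Subgroup SL(2, ℝ)} {η η' : OnePoint ℝ × OnePoint ℝ} {σ σ' : SL(2, ℝ)}

theorem hypLength_pos (hΓ : DiscreteTopology Γ) (hη : IsHyperbolicPair Γ η)
    (hσ : IsScaling σ η) : 0 < hypLength Γ σ := (hypLength_spec hΓ hη hσ).1

theorem exists_mem_pairStabilizer (hΓ : DiscreteTopology Γ) (hη : IsHyperbolicPair Γ η)
    (hσ : IsScaling σ η) (j : ℤ) : ∃ τ ∈ pairStabilizer Γ η,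
      σ⁻¹ * τ * σ = expSL (j * hypLength Γ σ) ∨ σ⁻¹ * τ * σ = -expSL (j * hypLength Γ σ) := by
  obtain ⟨τ, hτ, h⟩ := ((hypLength_spec hΓ hη hσ).2 (expDiag (j * hypLength Γ σ))).2 ⟨j, Or.inl rfl⟩
  refine ⟨τ, hτ, eq_or_eq_neg_of_mat.2 ?_⟩
  rcases h with h | h
  · exact Or.inl h.symm
  · exact Or.inr (by rw [h, neg_neg])

theorem exists_eq_expSL_of_mem (hΓ : DiscreteTopology Γ) (hη : IsHyperbolicPair Γ η)
    (hσ : IsScaling σ η) {γ : Γ} (hγ : γ ∈ pairStabilizer Γ η) : ∃ j : ℤ,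
      σ⁻¹ * γ * σ = expSL (j * hypLength Γ σ) ∨ σ⁻¹ * γ * σ = -expSL (j * hypLength Γ σ) := by
  obtain ⟨j, h⟩ := ((hypLength_spec hΓ hη hσ).2 (mat (σ⁻¹ * γ * σ))).1 ⟨γ, hγ, Or.inl rfl⟩
  exact ⟨j, eq_or_eq_neg_of_mat.2 h⟩

/-- An element of `σ⁻¹ Γ σ` fixing one of the points `0`, `∞` fixes both. -/
theorem offDiag_eq_zero_iff (hΓ : DiscreteTopology Γ) (hη : IsHyperbolicPair Γ η)
    (hσ : IsScaling σ η) (γ : Γ) :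
    mat (σ⁻¹ * γ * σ) 0 1 = 0 ↔ mat (σ⁻¹ * γ * σ) 1 0 = 0 := by
  have hℓ := hypLength_pos hΓ hη hσ
  set ℓ := hypLength Γ σ with hℓdef
  set g := σ⁻¹ * (γ : SL(2, ℝ)) * σ with hg
  choose τ hτ hτe using exists_mem_pairStabilizer hΓ hη hσ
  -- Conjugation by powers of the hyperbolic generator fixes the diagonal entries and multiplies the
  -- off-diagonal ones by `e^{jℓ}` and `e^{-jℓ}`.
  have hconj (j : ℤ) : σ⁻¹ * ((τ j * γ * (τ j)⁻¹ : Γ) : SL(2, ℝ)) * σ =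
      expSL (j * ℓ) * g * expSL (-(j * ℓ)) := by
    have h1 : σ⁻¹ * ((τ j * γ * (τ j)⁻¹ : Γ) : SL(2, ℝ)) * σ =
      (σ⁻¹ * τ j * σ) * g * (σ⁻¹ * τ j * σ)⁻¹ := by
      simp only [Subgroup.coe_mul, Subgroup.coe_inv, hg]; group
    rw [h1, expSL_neg]
    rcases hτe j with h | h
    · rw [h]
    · rw [h]; simp [hℓdef]
  have hent (j : ℤ) : mat (expSL (j * ℓ) * g * expSL (-(j * ℓ))) 0 0 = mat g 0 0 ∧
      mat (expSL (j * ℓ) * g * expSL (-(j * ℓ))) 1 1 = mat g 1 1 ∧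
      mat (expSL (j * ℓ) * g * expSL (-(j * ℓ))) 0 1 = mat g 0 1 * Real.exp (j * ℓ) ∧
      mat (expSL (j * ℓ) * g * expSL (-(j * ℓ))) 1 0 = mat g 1 0 * Real.exp (-(j * ℓ)) := by
    simp only [mat_mul_expSL_zero, mat_mul_expSL_one, mat_expSL_mul_zero, mat_expSL_mul_one]
    refine ⟨?_, ?_, ?_, ?_⟩
    · rw [mul_right_comm, ← Real.exp_add]; ring_nf; simp
    · rw [mul_right_comm, ← Real.exp_add]; ring_nf; simp
    · rw [mul_right_comm, ← Real.exp_add, mul_comm]; ring_nf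
    · rw [mul_right_comm, ← Real.exp_add, mul_comm]; ring_nf
  -- If exactly one off-diagonal entry vanishes, letting `j` tend to infinity in the direction that
  -- shrinks the other one yields infinitely many elements of bounded size, against discreteness.
  have hinf (f : ℕ → ℤ) (hf : Function.Injective f) (R : ℝ)
      (hR : ∀ n, size (expSL (f n * ℓ) * g * expSL (-(f n * ℓ))) ≤ R)
      (hne : mat g 0 1 ≠ 0 ∨ mat g 1 0 ≠ 0) : False := by
    have hinj : Function.Injective fun n ↦ τ (f n) * γ * (τ (f n))⁻¹ := by
      intro n n' h
      have h' := congrArg (fun x : Γ ↦ σ⁻¹ * (x : SL(2, ℝ)) * σ) h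
      simp only [hconj] at h'
      refine hf ?_
      rcases hne with hne | hne
      · have h2 := congrArg (fun x ↦ mat x 0 1) h'
        simp only [hent] at h2
        have h3 := Real.exp_injective (mul_left_cancel₀ hne h2)
        exact_mod_cast mul_right_cancel₀ hℓ.ne' h3
      · have h2 := congrArg (fun x ↦ mat x 1 0) h'
        simp only [hent] at h2
        have h3 := neg_injective (Real.exp_injective (mul_left_cancel₀ hne h2))
        exact_mod_cast mul_right_cancel₀ hℓ.ne' h3
    refine Set.infinite_of_injective_forall_mem hinj (fun n ↦ ?_)
      (finite_size_translate_le hΓ σ⁻¹ σ R)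
    change size (σ⁻¹ * ((τ (f n) * γ * (τ (f n))⁻¹ : Γ) : SL(2, ℝ)) * σ) ≤ R
    rw [hconj]
    exact hR n
  constructor
  · intro h
    by_contra hne
    refine hinf (fun n ↦ n) Nat.cast_injective (size g) (fun n ↦ ?_) (Or.inr hne)
    obtain ⟨h1, h2, h3, h4⟩ := hent n
    simp only [size, rowNorm, h1, h2, h3, h4, h, zero_mul, abs_zero, abs_mul, Real.abs_exp]
    have : Real.exp (-(((n : ℤ) : ℝ) * ℓ)) ≤ 1 := Real.exp_le_one_iff.2 (by
      have : 0 ≤ ((n : ℤ) : ℝ) * ℓ := by push_cast; positivity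
      linarith)
    have := mul_le_mul_of_nonneg_left this (abs_nonneg (mat g 1 0))
    linarith
  · intro h
    by_contra hne
    refine hinf (fun n ↦ -n) (fun a b h ↦ by simpa using h) (size g) (fun n ↦ ?_) (Or.inl hne)
    obtain ⟨h1, h2, h3, h4⟩ := hent (-n)
    simp only [size, rowNorm, h1, h2, h3, h4, h, zero_mul, abs_zero, abs_mul, Real.abs_exp]
    have : Real.exp (((-(n : ℤ) : ℤ) : ℝ) * ℓ) ≤ 1 := Real.exp_le_one_iff.2 (by
      have : 0 ≤ (n : ℝ) * ℓ := by positivity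
      push_cast; linarith)
    have := mul_le_mul_of_nonneg_left this (abs_nonneg (mat g 0 1))
    linarith

/-- If `γ η'` and `η` share a point, they share both: a row of `σ⁻¹ γ σ'` contains `0` if and
only if the other row does. -/
theorem row_mul_eq_zero_iff (hΓ : DiscreteTopology Γ) (hη : IsHyperbolicPair Γ η)
    (hσ : IsScaling σ η) (hη' : IsHyperbolicPair Γ η') (hσ' : IsScaling σ' η') (γ : Γ) :
    mat (σ⁻¹ * γ * σ') 0 0 * mat (σ⁻¹ * γ * σ') 0 1 = 0 ↔
      mat (σ⁻¹ * γ * σ') 1 0 * mat (σ⁻¹ * γ * σ') 1 1 = 0 := by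
  obtain ⟨τ, -, hτ⟩ := exists_mem_pairStabilizer hΓ hη' hσ' 1
  set M := σ⁻¹ * (γ : SL(2, ℝ)) * σ' with hM
  have hℓ := hypLength_pos hΓ hη' hσ'
  set ℓ := hypLength Γ σ'
  -- For `τ` a generator of `Γ_η'` up to sign, `γ τ γ⁻¹` is hyperbolic with fixed pair `γ η'`. In
  -- the coordinates of `η` its off-diagonal entries are, up to sign, `ab(s' - s)` and `-cd(s' -
  -- s)`.
  have key := offDiag_eq_zero_iff hΓ hη hσ (γ * τ * γ⁻¹)
  have h1 : σ⁻¹ * ((γ * τ * γ⁻¹ : Γ) : SL(2, ℝ)) * σ = M * (σ'⁻¹ * τ * σ') * M⁻¹ := by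
    simp only [Subgroup.coe_mul, Subgroup.coe_inv, hM]; group
  set s := Real.exp (((1 : ℤ) : ℝ) * ℓ / 2) with hs
  set s' := Real.exp (-(((1 : ℤ) : ℝ) * ℓ / 2)) with hs'
  have hne : s' - s ≠ 0 := by
    refine sub_ne_zero.2 fun h ↦ ?_
    have := Real.exp_injective h
    push_cast at this
    linarith
  have h2 : mat (M * expSL (((1 : ℤ) : ℝ) * ℓ) * M⁻¹) 0 1 = mat M 0 0 * mat M 0 1 * (s' - s) := by
    rw [mat_mul, mat_mul_expSL_zero, mat_mul_expSL_one]
    obtain ⟨e1, e2, e3, e4⟩ := mat_inv M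
    simp only [e2, e4]; ring
  have h3 : mat (M * expSL (((1 : ℤ) : ℝ) * ℓ) * M⁻¹) 1 0 = -(mat M 1 0 * mat M 1 1 * (s' - s)) := by
    rw [mat_mul, mat_mul_expSL_zero, mat_mul_expSL_one]
    obtain ⟨e1, e2, e3, e4⟩ := mat_inv M
    simp only [e1, e3]; ring
  rw [h1] at key
  rcases hτ with h | h
  · rw [h, h2, h3] at key
    simpa [hne] using key
  · rw [h, mul_neg, neg_mul, mat_neg, mat_neg, h2, h3] at key
    simpa [hne] using key

/-- The three kinds of elements of `σ⁻¹ Γ σ'`. -/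
theorem mat_trichotomy (hΓ : DiscreteTopology Γ) (hη : IsHyperbolicPair Γ η)
    (hσ : IsScaling σ η) (hη' : IsHyperbolicPair Γ η') (hσ' : IsScaling σ' η') (γ : Γ) :
    mat (σ⁻¹ * γ * σ') 0 0 * mat (σ⁻¹ * γ * σ') 0 1 *
        mat (σ⁻¹ * γ * σ') 1 0 * mat (σ⁻¹ * γ * σ') 1 1 ≠ 0 ∨
      (mat (σ⁻¹ * γ * σ') 0 1 = 0 ∧ mat (σ⁻¹ * γ * σ') 1 0 = 0) ∨
      (mat (σ⁻¹ * γ * σ') 0 0 = 0 ∧ mat (σ⁻¹ * γ * σ') 1 1 = 0) := by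
  have h := row_mul_eq_zero_iff hΓ hη hσ hη' hσ' γ
  set M := σ⁻¹ * (γ : SL(2, ℝ)) * σ'
  have hd := det_mat M
  by_cases h0 : mat M 0 0 * mat M 0 1 = 0
  · right
    have h1 := h.1 h0
    rcases mul_eq_zero.1 h0 with h2 | h2 <;> rcases mul_eq_zero.1 h1 with h3 | h3
    · rw [h2, h3] at hd; norm_num at hd
    · exact Or.inr ⟨h2, h3⟩
    · exact Or.inl ⟨h2, h3⟩
    · rw [h2, h3] at hd; norm_num at hd
  · left
    rw [mul_assoc _ (mat M 1 0)]
    exact mul_ne_zero h0 fun h1 ↦ h0 (h.2 h1)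

/-- Conjugation by `δ⁻¹` carries one defining set of lengths to the other; a change of `t` to `-t`
is harmless because `Γ` is closed under inverses. This is needed since a diagonal or antidiagonal
summand oscillates with period parameter `ℓ_η`, whereas the expansion at `η'` uses `ℓ_η'`. -/
theorem hypLength_eq_of_conj {δ X : SL(2, ℝ)} (hδ : δ ∈ Γ) (hX : σ'⁻¹ * δ⁻¹ * σ = X)
    (h : ∀ t, X * expSL t * X⁻¹ = expSL t ∨
      X * expSL t * X⁻¹ = expSL (-t)) :
    hypLength Γ σ = hypLength Γ σ' := by
  have inv_case (ρ : SL(2, ℝ)) {x : SL(2, ℝ)} (hx : x ∈ Γ) {t : ℝ}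
      (hx' : ρ⁻¹ * x * ρ = expSL (-t) ∨ ρ⁻¹ * x * ρ = -expSL (-t)) :
      ∃ y ∈ Γ, ρ⁻¹ * y * ρ = expSL t ∨ ρ⁻¹ * y * ρ = -expSL t := by
    refine ⟨x⁻¹, Γ.inv_mem hx, ?_⟩
    have h1 : ρ⁻¹ * x⁻¹ * ρ = (ρ⁻¹ * x * ρ)⁻¹ := by group
    rw [h1]
    rcases hx' with h | h
    · left; rw [h, expSL_neg, inv_inv]
    · right; rw [h, expSL_neg, inv_neg, inv_inv]
  unfold hypLength
  congr 1
  ext t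
  simp only [Set.mem_ofPred_eq, ← eq_or_eq_neg_of_mat]
  refine and_congr_right fun _ ↦ ⟨?_, ?_⟩
  · rintro ⟨γ, hγ, hγ'⟩
    have h1 : σ'⁻¹ * (δ⁻¹ * γ * δ) * σ' =
        X * (σ⁻¹ * γ * σ) * X⁻¹ := by rw [← hX]; group
    have hmem : δ⁻¹ * γ * δ ∈ Γ := Γ.mul_mem (Γ.mul_mem (Γ.inv_mem hδ) hγ) hδ
    rcases h t with h | h
    · refine ⟨δ⁻¹ * γ * δ, hmem, ?_⟩
      rw [h1]
      rcases hγ' with h2 | h2 <;> rw [h2] <;> simp [h]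
    · refine inv_case σ' hmem ?_
      rw [h1]
      rcases hγ' with h2 | h2 <;> rw [h2] <;> simp [h]
  · rintro ⟨γ, hγ, hγ'⟩
    have h1 : σ⁻¹ * (δ * γ * δ⁻¹) * σ =
        X⁻¹ * (σ'⁻¹ * γ * σ') * X := by rw [← hX]; group
    have hmem : δ * γ * δ⁻¹ ∈ Γ := Γ.mul_mem (Γ.mul_mem hδ hγ) (Γ.inv_mem hδ)
    have hswap {s t : SL(2, ℝ)} (h : X * s * X⁻¹ = t) : X⁻¹ * t * X = s := by
      rw [← h]; group
    rcases h t with h | h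
    · refine ⟨δ * γ * δ⁻¹, hmem, ?_⟩
      rw [h1]
      rcases hγ' with h2 | h2 <;> rw [h2] <;> simp [hswap h]
    · have h' : X⁻¹ * expSL t * X = expSL (-t) := by
        rw [expSL_neg] at h ⊢
        have h2 := congrArg (fun x ↦ x⁻¹) (hswap h)
        simp only [mul_inv_rev, inv_inv] at h2
        rw [← h2]; group
      refine inv_case σ hmem ?_
      rw [h1]
      rcases hγ' with h2 | h2 <;> rw [h2] <;> simp [h']

theorem hypLength_eq_of_diag {δ : SL(2, ℝ)} (hδ : δ ∈ Γ)
    (h1 : mat (σ⁻¹ * δ * σ') 0 1 = 0) (h2 : mat (σ⁻¹ * δ * σ') 1 0 = 0) :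
    hypLength Γ σ = hypLength Γ σ' := by
  have h3 : σ'⁻¹ * δ⁻¹ * σ = (σ⁻¹ * δ * σ')⁻¹ := by group
  refine hypLength_eq_of_conj hδ h3 fun t ↦ Or.inl ?_
  set M := σ⁻¹ * δ * σ'
  rw [mul_inv_eq_iff_eq_mul]
  apply Subtype.ext
  ext i j
  change mat (M⁻¹ * expSL t) i j = mat (expSL t * M⁻¹) i j
  obtain ⟨e1, e2, e3, e4⟩ := mat_inv M
  fin_cases i <;> fin_cases j <;>
    simp only [Fin.zero_eta, Fin.mk_one, mat_mul_expSL_zero, mat_mul_expSL_one, mat_expSL_mul_zero,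
      mat_expSL_mul_one, e1, e2, e3, e4, h1, h2] <;> ring

theorem hypLength_eq_of_antidiag {δ : SL(2, ℝ)} (hδ : δ ∈ Γ)
    (h1 : mat (σ⁻¹ * δ * σ') 0 0 = 0) (h2 : mat (σ⁻¹ * δ * σ') 1 1 = 0) :
    hypLength Γ σ = hypLength Γ σ' := by
  have h3 : σ'⁻¹ * δ⁻¹ * σ = (σ⁻¹ * δ * σ')⁻¹ := by group
  refine hypLength_eq_of_conj hδ h3 fun t ↦ Or.inr ?_
  set M := σ⁻¹ * δ * σ'
  rw [mul_inv_eq_iff_eq_mul]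
  apply Subtype.ext
  ext i j
  change mat (M⁻¹ * expSL t) i j = mat (expSL (-t) * M⁻¹) i j
  obtain ⟨e1, e2, e3, e4⟩ := mat_inv M
  fin_cases i <;> fin_cases j <;>
    simp only [Fin.zero_eta, Fin.mk_one, mat_mul_expSL_zero, mat_mul_expSL_one, mat_expSL_mul_zero,
      mat_expSL_mul_one, e1, e2, e3, e4, h1, h2, neg_div, neg_neg] <;> ring

theorem mk_eq_mk_iff (γ γ' : Γ) :
    (Quotient.mk _ γ : CosetSpace Γ η) = Quotient.mk _ γ' ↔ γ' * γ⁻¹ ∈ pairStabilizer Γ η := by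
  rw [Quotient.eq, QuotientGroup.rightRel_apply]

theorem conj_mul (γ γ' : Γ) : σ⁻¹ * ((γ * γ' : Γ) : SL(2, ℝ)) * σ' =
    (σ⁻¹ * γ * σ) * (σ⁻¹ * γ' * σ') := by
  rw [Subgroup.coe_mul]; group

/-- Two representatives of a class in `Γ_η \ Γ` differ by a diagonal matrix. -/
theorem exists_expSL_mul_of_mk_eq (hΓ : DiscreteTopology Γ) (hη : IsHyperbolicPair Γ η)
    (hσ : IsScaling σ η) {γ γ' : Γ}
    (h : (Quotient.mk _ γ : CosetSpace Γ η) = Quotient.mk _ γ') (σ' : SL(2, ℝ)) :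
    ∃ j : ℤ, σ⁻¹ * γ' * σ' = expSL (j * hypLength Γ σ) * (σ⁻¹ * γ * σ') ∨
      σ⁻¹ * γ' * σ' = -(expSL (j * hypLength Γ σ) * (σ⁻¹ * γ * σ')) := by
  obtain ⟨j, hj⟩ := exists_eq_expSL_of_mem hΓ hη hσ ((mk_eq_mk_iff γ γ').1 h)
  refine ⟨j, ?_⟩
  have : σ⁻¹ * (γ' : SL(2, ℝ)) * σ' =
      (σ⁻¹ * ((γ' * γ⁻¹ : Γ) : SL(2, ℝ)) * σ) * (σ⁻¹ * γ * σ') := by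
    rw [← conj_mul]; simp
  rw [this]
  rcases hj with h | h
  · left; rw [h]
  · right; rw [h, neg_mul]

theorem rowNorm_expSL_mul_zero (t : ℝ) (g : SL(2, ℝ)) :
    rowNorm (expSL t * g) 0 = Real.exp (t / 2) * rowNorm g 0 := by
  simp only [rowNorm, mat_expSL_mul_zero, abs_mul, Real.abs_exp]; ring

theorem rowNorm_expSL_mul_one (t : ℝ) (g : SL(2, ℝ)) :
    rowNorm (expSL t * g) 1 = Real.exp (-(t / 2)) * rowNorm g 1 := by
  simp only [rowNorm, mat_expSL_mul_one, abs_mul, Real.abs_exp]; ring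

/-- For a real `x > 0` there is an integer `j` with `1 ≤ e^{jℓ} x ≤ e^ℓ`. -/
theorem exists_int_exp_mul_mem {ℓ : ℝ} (hℓ : 0 < ℓ) {x : ℝ} (hx : 0 < x) :
    ∃ j : ℤ, 1 ≤ Real.exp (j * ℓ) * x ∧ Real.exp (j * ℓ) * x ≤ Real.exp ℓ := by
  obtain ⟨L, rfl⟩ : ∃ L, Real.exp L = x := ⟨_, Real.exp_log hx⟩
  refine ⟨-⌊L / ℓ⌋, ?_⟩
  have h1 := Int.floor_le (L / ℓ)
  have h2 := (Int.lt_floor_add_one (L / ℓ)).le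
  rw [le_div_iff₀ hℓ] at h1
  rw [div_le_iff₀ hℓ] at h2
  rw [← Real.exp_add, Real.one_le_exp_iff, Real.exp_le_exp]
  push_cast
  constructor <;> linarith

/-- When the two rows have comparable length, `(P + R)² ≤ 4P² ≤ 4E · PR`, so the product of the row
norms controls the square of the matrix norm. -/
theorem inv_sq_mul_le {P R E : ℝ} (hP : 0 < P) (hR : 0 < R) (h1 : R ≤ P)
    (h2 : P ≤ E * R) : ((P * R) ^ 2)⁻¹ ≤ 16 * E ^ 2 * ((P + R) ^ 4)⁻¹ := by
  have h3 : (P + R) ^ 2 ≤ 4 * E * (P * R) := by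
    calc (P + R) ^ 2 ≤ (P + P) ^ 2 := by gcongr
      _ = 4 * P * P := by ring
      _ ≤ 4 * P * (E * R) := by gcongr
      _ = _ := by ring
  rw [← div_eq_mul_inv, inv_eq_one_div, div_le_div_iff₀ (by positivity) (by positivity), one_mul]
  calc (P + R) ^ 4 = ((P + R) ^ 2) ^ 2 := by ring
    _ ≤ (4 * E * (P * R)) ^ 2 := by gcongr
    _ = _ := by ring

/-- The sum of `(‖(a, b)‖ ‖(c, d)‖)⁻²` over the cosets `Γ_η \ Γ` converges, where
`(a b; c d) = σ⁻¹ γ σ'`. -/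
theorem summable_rowNorm (hΓ : DiscreteTopology Γ) (hη : IsHyperbolicPair Γ η)
    (hσ : IsScaling σ η) (σ' : SL(2, ℝ)) :
    Summable fun q : CosetSpace Γ η ↦
      ((rowNorm (σ⁻¹ * q.out * σ') 0 * rowNorm (σ⁻¹ * q.out * σ') 1) ^ 2)⁻¹ := by
  have hℓ := hypLength_pos hΓ hη hσ
  set ℓ := hypLength Γ σ
  have key (q : CosetSpace Γ η) : ∃ γ : Γ, Quotient.mk _ γ = q ∧
      ((rowNorm (σ⁻¹ * q.out * σ') 0 * rowNorm (σ⁻¹ * q.out * σ') 1) ^ 2)⁻¹ ≤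
        16 * Real.exp ℓ ^ 2 * (size (σ⁻¹ * γ * σ') ^ 4)⁻¹ := by
    set M := σ⁻¹ * (q.out : SL(2, ℝ)) * σ' with hM
    have h0 := rowNorm_pos M 0
    have h1 := rowNorm_pos M 1
    -- Left multiplication by `expSL (j * ℓ)` keeps the product of the row norms and multiplies
    -- their ratio by `e^{jℓ}`, so the ratio can be brought into `[1, e^ℓ]`.
    obtain ⟨j, hj1, hj2⟩ := exists_int_exp_mul_mem hℓ (div_pos h0 h1)
    obtain ⟨τ, hτ, hτe⟩ := exists_mem_pairStabilizer hΓ hη hσ j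
    have hsize : size (σ⁻¹ * ((τ * q.out : Γ) : SL(2, ℝ)) * σ') = size (expSL (j * ℓ) * M) := by
      rw [conj_mul]
      rcases hτe with h | h
      · rw [h]
      · rw [h, neg_mul, size_neg]
    refine ⟨τ * q.out, ?_, ?_⟩
    · nth_rewrite 2 [← Quotient.out_eq q]
      rw [eq_comm, mk_eq_mk_iff]
      simpa using hτ
    rw [hsize, size, rowNorm_expSL_mul_zero, rowNorm_expSL_mul_one]
    rw [show (j : ℝ) * ℓ = j * ℓ / 2 + j * ℓ / 2 by ring, Real.exp_add] at hj1 hj2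
    rw [Real.exp_neg]
    set s := Real.exp ((j : ℝ) * ℓ / 2)
    have hs : 0 < s := Real.exp_pos _
    set p := rowNorm M 0
    set r := rowNorm M 1
    have hE := Real.exp_pos ℓ
    set E := Real.exp ℓ
    have hpr : p * r = (s * p) * (s⁻¹ * r) := by field_simp
    have e1 : s⁻¹ * r ≤ s * p := by
      rw [mul_div_assoc', le_div_iff₀ h1] at hj1
      rw [inv_mul_le_iff₀ hs]; nlinarith
    have e2 : s * p ≤ E * (s⁻¹ * r) := by
      rw [mul_div_assoc', div_le_iff₀ h1] at hj2
      rw [← mul_assoc, mul_comm E, mul_assoc, ← div_eq_inv_mul, le_div_iff₀ hs]; nlinarith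
    rw [hpr]
    set P := s * p
    set R := s⁻¹ * r
    have hP : 0 < P := by positivity
    have hR : 0 < R := by positivity
    exact inv_sq_mul_le hP hR e1 e2
  choose f hf hle using key
  -- Different cosets have different representatives, so the sum over cosets is dominated by part of
  -- a convergent sum over `Γ`.
  have hinj : Function.Injective f := fun q q' h ↦ by rw [← hf q, h, hf q']
  exact Summable.of_nonneg_of_le (fun q ↦ by positivity) hle
    (((summable_size_translate hΓ σ⁻¹ σ').comp_injective hinj).mul_left _)

end Stabilizer

/-! ### Fourier expansions of periodic holomorphic functions on a strip. -/

/-- The strip `0 < Im u < π`. -/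
def strip : Set ℂ := {u | 0 < u.im ∧ u.im < Real.pi}

theorem isOpen_strip : IsOpen strip :=
  (isOpen_lt continuous_const Complex.continuous_im).inter
    (isOpen_lt Complex.continuous_im continuous_const)

/-- The point `x + iy`. -/
abbrev line (y x : ℝ) : ℂ := (x : ℂ) + (y : ℂ) * Complex.I

theorem line_im (y x : ℝ) : (line y x).im = y := by simp [line]

theorem line_re (y x : ℝ) : (line y x).re = x := by simp [line]

theorem line_mem_strip {y : ℝ} (h0 : 0 < y) (h1 : y < Real.pi) (x : ℝ) : line y x ∈ strip := by
  simp [strip, h0, h1]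

theorem continuous_line (y : ℝ) : Continuous (line y) := by unfold line; fun_prop

theorem continuous_comp_line {F : ℂ → ℂ} (hF : ContinuousOn F strip) {y : ℝ} (h0 : 0 < y)
    (h1 : y < Real.pi) : Continuous fun x ↦ F (line y x) :=
  hF.comp_continuous (continuous_line y) (line_mem_strip h0 h1)

/-- The exponential `e^{2 π i n u / ℓ}`. -/
def expMode (ℓ : ℝ) (n : ℤ) (u : ℂ) : ℂ :=
  Complex.exp (2 * (Real.pi : ℂ) * Complex.I * (n : ℂ) / (ℓ : ℂ) * u)

theorem differentiable_expMode (ℓ : ℝ) (n : ℤ) : Differentiable ℂ (expMode ℓ n) := by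
  unfold expMode; fun_prop

theorem norm_expMode (ℓ : ℝ) (n : ℤ) (u : ℂ) :
    ‖expMode ℓ n u‖ = Real.exp (-(2 * Real.pi * n / ℓ * u.im)) := by
  rw [expMode, Complex.norm_exp, show 2 * (Real.pi : ℂ) * Complex.I * (n : ℂ) / (ℓ : ℂ) * u =
    ((2 * Real.pi * n / ℓ : ℝ) : ℂ) * (Complex.I * u) by push_cast; ring, Complex.re_ofReal_mul]
  simp

theorem expMode_add (ℓ : ℝ) (m n : ℤ) (u : ℂ) :
    expMode ℓ (m + n) u = expMode ℓ m u * expMode ℓ n u := by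
  simp only [expMode, ← Complex.exp_add]; congr 1; push_cast; ring

theorem expMode_periodic {ℓ : ℝ} (hℓ : 0 < ℓ) (n : ℤ) (u : ℂ) :
    expMode ℓ n (u + ℓ) = expMode ℓ n u := by
  have : (ℓ : ℂ) ≠ 0 := by exact_mod_cast hℓ.ne'
  rw [expMode, expMode, show 2 * (Real.pi : ℂ) * Complex.I * (n : ℂ) / (ℓ : ℂ) * (u + ℓ) =
    2 * (Real.pi : ℂ) * Complex.I * (n : ℂ) / (ℓ : ℂ) * u + n * (2 * Real.pi * Complex.I) by
      field_simp, Complex.exp_add, Complex.exp_int_mul_two_pi_mul_I, mul_one]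

theorem integral_expMode {ℓ : ℝ} (hℓ : 0 < ℓ) (n : ℤ) (y : ℝ) :
    ∫ x in (0 : ℝ)..ℓ, expMode ℓ n (line y x) = if n = 0 then (ℓ : ℂ) else 0 := by
  split_ifs with hn
  · simp [hn, expMode]
  · have hc : 2 * (Real.pi : ℂ) * Complex.I * (n : ℂ) / (ℓ : ℂ) ≠ 0 := by
      have : (ℓ : ℂ) ≠ 0 := by exact_mod_cast hℓ.ne'
      have : (Real.pi : ℂ) ≠ 0 := by exact_mod_cast Real.pi_ne_zero
      have : (n : ℂ) ≠ 0 := by exact_mod_cast hn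
      exact div_ne_zero (mul_ne_zero (mul_ne_zero (mul_ne_zero two_ne_zero ‹_›) Complex.I_ne_zero)
        ‹_›) ‹_›
    set c := 2 * (Real.pi : ℂ) * Complex.I * (n : ℂ) / (ℓ : ℂ) with hcdef
    have hd (x : ℝ) : HasDerivAt (fun x : ℝ ↦ expMode ℓ n (line y x) / c)
        (expMode ℓ n (line y x)) x := by
      have h1 : HasDerivAt (fun u : ℂ ↦ Complex.exp (c * (u + y * Complex.I)))
          (Complex.exp (c * (x + y * Complex.I)) * c) (x : ℂ) := by
        have h2 := (((hasDerivAt_id (x : ℂ)).add_const (y * Complex.I)).const_mul c).cexp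
        simpa using h2
      have h3 := (h1.comp_ofReal).div_const c
      rw [mul_div_assoc, div_self hc, mul_one] at h3
      exact h3
    rw [intervalIntegral.integral_eq_sub_of_hasDerivAt (fun x _ ↦ hd x)
      (((differentiable_expMode ℓ n).continuous.comp (continuous_line y)).intervalIntegrable _ _)]
    have := expMode_periodic hℓ n (line y 0)
    rw [show line y ℓ = line y 0 + ℓ by simp [line]; ring, this, sub_self]

/-- The mean over a period of a holomorphic periodic function on the strip does not depend on the
height. -/
theorem integral_line_eq {g : ℂ → ℂ} {ℓ : ℝ} (hg : DifferentiableOn ℂ g strip)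
    (hper : ∀ u ∈ strip, g (u + ℓ) = g u) {y y' : ℝ} (h0 : 0 < y) (h1 : y < Real.pi)
    (h0' : 0 < y') (h1' : y' < Real.pi) :
    ∫ x in (0 : ℝ)..ℓ, g (line y x) = ∫ x in (0 : ℝ)..ℓ, g (line y' x) := by
  have hsub : ∀ t ∈ Set.uIcc y y', 0 < t ∧ t < Real.pi := fun t ht ↦
    ⟨(lt_min h0 h0').trans_le ht.1, ht.2.trans_lt (max_lt h1 h1')⟩
  have h := Complex.integral_boundary_rect_eq_zero_of_differentiableOn g ((0 : ℝ) + y * Complex.I)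
    (ℓ + y' * Complex.I) (hg.mono (by
      rintro u ⟨-, hu⟩
      exact hsub u.im (by simpa using hu)))
  simp only [Complex.add_re, Complex.ofReal_re, Complex.mul_re, Complex.I_re, mul_zero,
    Complex.ofReal_im, Complex.I_im, mul_one, sub_self, add_zero, Complex.add_im, Complex.mul_im,
    zero_add] at h
  -- In Cauchy's theorem for the rectangle of width `ℓ`, the vertical sides cancel by periodicity.
  have hv : ∫ t in y..y', g ((ℓ : ℂ) + t * Complex.I) =
      ∫ t in y..y', g (((0 : ℝ) : ℂ) + t * Complex.I) := by
    refine intervalIntegral.integral_congr fun t ht ↦ ?_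
    have := hper (line t 0) (line_mem_strip (hsub t ht).1 (hsub t ht).2 0)
    simp only [line] at this
    rw [← this]
    simp [add_comm]
  rw [hv, add_sub_cancel_right, sub_eq_zero] at h
  exact h

/-- The `n`-th Fourier coefficient of a periodic function on the strip, computed on the line
`Im u = y`. -/
def stripCoeff (F : ℂ → ℂ) (ℓ : ℝ) (n : ℤ) (y : ℝ) : ℂ :=
  (1 / (ℓ : ℂ)) * ∫ x in (0 : ℝ)..ℓ, F (line y x) * expMode ℓ (-n) (line y x)

section

variable {F : ℂ → ℂ} {ℓ : ℝ}

theorem stripCoeff_eq (hℓ : 0 < ℓ) (hF : DifferentiableOn ℂ F strip)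
    (hper : ∀ u ∈ strip, F (u + ℓ) = F u) (n : ℤ) {y y' : ℝ} (h0 : 0 < y) (h1 : y < Real.pi)
    (h0' : 0 < y') (h1' : y' < Real.pi) : stripCoeff F ℓ n y = stripCoeff F ℓ n y' := by
  unfold stripCoeff
  congr 1
  refine integral_line_eq (g := fun u ↦ F u * expMode ℓ (-n) u)
    (hF.mul (differentiable_expMode ℓ _).differentiableOn) (fun u hu ↦ ?_) h0 h1 h0' h1'
  rw [hper u hu, expMode_periodic hℓ]

theorem exists_norm_stripCoeff_le (hℓ : 0 < ℓ) (hF : ContinuousOn F strip) {y : ℝ} (h0 : 0 < y)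
    (h1 : y < Real.pi) :
    ∃ B : ℝ, ∀ n : ℤ, ‖stripCoeff F ℓ n y‖ ≤ B * Real.exp (2 * Real.pi * n / ℓ * y) := by
  obtain ⟨B, hB⟩ := (isCompact_Icc (a := (0 : ℝ)) (b := ℓ)).exists_bound_of_continuousOn
    (continuous_comp_line hF h0 h1).continuousOn
  refine ⟨B, fun n ↦ ?_⟩
  have h : ‖∫ x in (0 : ℝ)..ℓ, F (line y x) * expMode ℓ (-n) (line y x)‖ ≤
      B * Real.exp (2 * Real.pi * n / ℓ * y) * |ℓ - 0| := by
    refine intervalIntegral.norm_integral_le_of_norm_le_const fun x hx ↦ ?_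
    rw [Set.uIoc_of_le hℓ.le] at hx
    rw [norm_mul, norm_expMode, line_im]
    refine mul_le_mul (hB x (Set.Ioc_subset_Icc_self hx)) (le_of_eq ?_) (Real.exp_pos _).le
      ((norm_nonneg _).trans (hB x (Set.Ioc_subset_Icc_self hx)))
    congr 1; push_cast; ring
  rw [sub_zero, abs_of_pos hℓ] at h
  rw [stripCoeff, norm_mul, norm_div, norm_one, Complex.norm_real, Real.norm_eq_abs, abs_of_pos hℓ,
    one_div, inv_mul_le_iff₀ hℓ]
  linarith

/-- The coefficient can be computed at any height `y'`, which bounds the `n`-th term by a constant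
times `e^{2πn(y' - y)/ℓ}`. Heights below `y` give geometric decay for `n ≥ 0`, heights above `y` for
`n ≤ 0`. -/
theorem summable_stripCoeff (hℓ : 0 < ℓ) (hF : DifferentiableOn ℂ F strip)
    (hper : ∀ u ∈ strip, F (u + ℓ) = F u) {y : ℝ} (h0 : 0 < y) (h1 : y < Real.pi) :
    Summable fun n : ℤ ↦ stripCoeff F ℓ n y * ((Real.exp (-(2 * Real.pi * n / ℓ * y)) : ℝ) : ℂ) := by
  have main (y' : ℝ) (h0' : 0 < y') (h1' : y' < Real.pi) (f : ℕ → ℤ) (s : ℝ)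
      (hf : ∀ j : ℕ, ((f j : ℤ) : ℝ) = s * j) (hs : s * (y' - y) < 0) : Summable fun j : ℕ ↦
        stripCoeff F ℓ (f j) y * ((Real.exp (-(2 * Real.pi * (f j : ℤ) / ℓ * y)) : ℝ) : ℂ) := by
    obtain ⟨B, hB⟩ := exists_norm_stripCoeff_le hℓ hF.continuousOn h0' h1'
    have ha : 2 * Real.pi / ℓ * (s * (y' - y)) < 0 :=
      mul_neg_of_pos_of_neg (by have := Real.pi_pos; positivity) hs
    refine Summable.of_norm_bounded ((Real.summable_exp_nat_mul_iff.2 ha).mul_left B) fun j ↦ ?_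
    rw [stripCoeff_eq hℓ hF hper _ h0 h1 h0' h1', norm_mul, Complex.norm_real, Real.norm_eq_abs,
      Real.abs_exp]
    refine (mul_le_mul_of_nonneg_right (hB (f j)) (Real.exp_pos _).le).trans (le_of_eq ?_)
    rw [mul_assoc, ← Real.exp_add, hf]
    congr 2; ring
  refine Summable.of_nat_of_neg ?_ ?_
  · exact main (y / 2) (by linarith) (by linarith) (fun j ↦ j) 1 (fun j ↦ by simp) (by linarith)
  · exact main ((y + Real.pi) / 2) (by linarith) (by linarith) (fun j ↦ -j) (-1) (fun j ↦ by simp)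
      (by linarith)

/-- The Fourier expansion of a holomorphic periodic function on the strip. -/
theorem hasSum_stripCoeff (hℓ : 0 < ℓ) (hF : DifferentiableOn ℂ F strip)
    (hper : ∀ u ∈ strip, F (u + ℓ) = F u) {y₀ : ℝ} (h0 : 0 < y₀) (h1 : y₀ < Real.pi) {u : ℂ}
    (hu : u ∈ strip) : HasSum (fun n : ℤ ↦ stripCoeff F ℓ n y₀ * expMode ℓ n u) (F u) := by
  have : Fact (0 < ℓ) := ⟨hℓ⟩
  have hu0 := hu.1
  have hu1 := hu.2
  have hp : Function.Periodic (fun x : ℝ ↦ F (line u.im x)) ℓ := fun x ↦ by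
    simp only [← hper _ (line_mem_strip hu0 hu1 x)]
    congr 1; simp [line]; ring
  let f : C(AddCircle ℓ, ℂ) := ⟨hp.lift, continuous_coinduced_dom.mpr
    (continuous_comp_line hF.continuousOn hu0 hu1)⟩
  have hf (x : ℝ) : f (x : AddCircle ℓ) = F (line u.im x) := hp.lift_coe x
  have hmode (n : ℤ) (x : ℝ) : (fourier n (x : AddCircle ℓ) : ℂ) *
      ((Real.exp (-(2 * Real.pi * n / ℓ * u.im)) : ℝ) : ℂ) = expMode ℓ n (line u.im x) := by
    rw [fourier_coe_apply, Complex.ofReal_exp, ← Complex.exp_add, expMode]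
    congr 1
    push_cast
    linear_combination (-2 * Real.pi * n / ℓ * u.im) * Complex.I_sq
  -- On the line through `u` the mode `expMode ℓ n` is the `n`-th character of the circle times a
  -- positive constant; that constant moves into the Fourier coefficient.
  have hcoeff (n : ℤ) : fourierCoeff f n =
      stripCoeff F ℓ n u.im * ((Real.exp (-(2 * Real.pi * n / ℓ * u.im)) : ℝ) : ℂ) := by
    rw [fourierCoeff_eq_intervalIntegral f n 0, zero_add, stripCoeff, Complex.real_smul, mul_assoc,
      ← intervalIntegral.integral_mul_const]
    congr 1
    · simp
    refine intervalIntegral.integral_congr fun x _ ↦ ?_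
    simp only [smul_eq_mul]
    rw [hf, ← hmode, mul_assoc, mul_assoc, ← Complex.ofReal_mul, ← Real.exp_add]
    push_cast
    rw [show -(2 * (Real.pi : ℂ) * -(n : ℂ) / ℓ * u.im) + -(2 * Real.pi * n / ℓ * u.im) = 0 by ring]
    simp [mul_comm]
  have hsum : Summable (fourierCoeff f) := by
    rw [funext hcoeff]
    exact summable_stripCoeff hℓ hF hper hu0 hu1
  have h := has_pointwise_sum_fourier_series_of_summable hsum (u.re : AddCircle ℓ)
  rw [hf, show line u.im u.re = u from Complex.re_add_im u] at h
  convert! h using 2 with n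
  rw [hcoeff, stripCoeff_eq hℓ hF hper n h0 h1 hu0 hu1, smul_eq_mul, mul_assoc,
    mul_comm ((Real.exp _ : ℝ) : ℂ), hmode, show line u.im u.re = u from Complex.re_add_im u]

/-- The coefficients of an exponential expansion on the strip are the Fourier coefficients. -/
theorem eq_stripCoeff_of_hasSum (hℓ : 0 < ℓ) {c : ℤ → ℂ} {y : ℝ}
    (h : ∀ x, HasSum (fun n : ℤ ↦ c n * expMode ℓ n (line y x)) (F (line y x))) (n : ℤ) :
    c n = stripCoeff F ℓ n y := by
  -- Norms of the modes are constant along a horizontal line, so absolute convergence at `x = 0`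
  -- dominates the series on the whole period and allows termwise integration.
  have hs : Summable fun m : ℤ ↦ ‖c m * expMode ℓ m (line y 0)‖ * ‖expMode ℓ (-n) (line y 0)‖ :=
    (h 0).summable.norm.mul_right _
  have hnorm (m : ℤ) (x : ℝ) : ‖c m * expMode ℓ m (line y x) * expMode ℓ (-n) (line y x)‖ =
      ‖c m * expMode ℓ m (line y 0)‖ * ‖expMode ℓ (-n) (line y 0)‖ := by
    simp only [norm_mul, norm_expMode, line_im]
  have key := intervalIntegral.hasSum_integral_of_dominated_convergence (μ := volume) (a := 0)
    (b := ℓ) (F := fun (m : ℤ) x ↦ c m * expMode ℓ m (line y x) * expMode ℓ (-n) (line y x))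
    (f := fun x ↦ F (line y x) * expMode ℓ (-n) (line y x))
    (fun m _ ↦ ‖c m * expMode ℓ m (line y 0)‖ * ‖expMode ℓ (-n) (line y 0)‖)
    (fun m ↦ by
      have h1 := (differentiable_expMode ℓ m).continuous.comp (continuous_line y)
      have h2 := (differentiable_expMode ℓ (-n)).continuous.comp (continuous_line y)
      exact ((continuous_const.mul h1).mul h2).aestronglyMeasurable)
    (fun m ↦ .of_forall fun x _ ↦ (hnorm m x).le) (.of_forall fun _ _ ↦ hs)
    intervalIntegrable_const (.of_forall fun x _ ↦ (h x).mul_right _)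
  have hterm (m : ℤ) : ∫ x in (0 : ℝ)..ℓ, c m * expMode ℓ m (line y x) * expMode ℓ (-n) (line y x) =
      if m = n then c n * ℓ else 0 := by
    simp only [mul_assoc, ← expMode_add]
    rw [intervalIntegral.integral_const_mul, integral_expMode hℓ]
    by_cases hmn : m = n
    · simp [hmn]
    · rw [if_neg (by omega), if_neg hmn, mul_zero]
  simp only [hterm] at key
  have h2 := key.unique (hasSum_ite_eq n (c n * ℓ))
  have : (ℓ : ℂ) ≠ 0 := by exact_mod_cast hℓ.ne'
  rw [stripCoeff, h2]
  field_simp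

end

/-! ### The summands of the Poincaré series in the coordinate `u = log z`. -/

theorem exp_im_pos {u : ℂ} (hu : u ∈ strip) : 0 < (Complex.exp u).im := by
  rw [Complex.exp_im]
  exact mul_pos (Real.exp_pos _) (Real.sin_pos_of_pos_of_lt_pi hu.1 hu.2)

/-- The point `e^u` of the upper half-plane. -/
def expPoint (u : ℂ) (hu : u ∈ strip) : ℍ := ⟨Complex.exp u, exp_im_pos hu⟩

theorem log_exp_of_mem {u : ℂ} (hu : u ∈ strip) : Complex.log (Complex.exp u) = u :=
  Complex.log_exp (by have := Real.pi_pos; linarith [hu.1]) hu.2.le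

/-- The linear form `x z + y`, where `(x, y)` is the `i`-th row of `M`. -/
def linForm (M : SL(2, ℝ)) (i : Fin 2) (z : ℂ) : ℂ := (mat M i 0 : ℂ) * z + mat M i 1

theorem linForm_ne_zero (M : SL(2, ℝ)) (i : Fin 2) {u : ℂ} (hu : u ∈ strip) :
    linForm M i (Complex.exp u) ≠ 0 := lin_ne_zero M i (exp_im_pos hu).ne'

theorem moebius_im_pos (M : SL(2, ℝ)) {u : ℂ} (hu : u ∈ strip) :
    0 < (linForm M 0 (Complex.exp u) / linForm M 1 (Complex.exp u)).im := by
  have h := (M • expPoint u hu).im_pos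
  rw [← UpperHalfPlane.coe_im, coe_smul_eq] at h
  exact h

/-- The function `e^{hu} (f |_{2h} M)(e^u)` for `f(z) = z^{-h + iκ}`. -/
def stripTerm (h : ℕ) (κ : ℝ) (M : SL(2, ℝ)) (u : ℂ) : ℂ :=
  Complex.exp (h * u) *
    (linForm M 0 (Complex.exp u) / linForm M 1 (Complex.exp u)) ^ ((κ : ℂ) * Complex.I) /
    (linForm M 0 (Complex.exp u) ^ h * linForm M 1 (Complex.exp u) ^ h)

theorem linForm_neg (M : SL(2, ℝ)) (i : Fin 2) (z : ℂ) : linForm (-M) i z = -linForm M i z := by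
  simp only [linForm, mat_neg]; push_cast; ring

theorem stripTerm_neg (h : ℕ) (κ : ℝ) (M : SL(2, ℝ)) (u : ℂ) :
    stripTerm h κ (-M) u = stripTerm h κ M u := by
  simp only [stripTerm, linForm_neg, neg_div_neg_eq, ← mul_pow, neg_mul_neg]

/-- The factor `e^{hu}` absorbs the automorphy factor of the diagonal matrix, so that right
multiplication becomes a pure translation. -/
theorem stripTerm_mul_expSL (h : ℕ) (κ : ℝ) (M : SL(2, ℝ)) (t : ℝ) (u : ℂ) :
    stripTerm h κ (M * expSL t) u = stripTerm h κ M (u + t) := by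
  have hl (i : Fin 2) : linForm (M * expSL t) i (Complex.exp u) =
      Complex.exp (-(t / 2)) * linForm M i (Complex.exp (u + t)) := by
    simp only [linForm, mat_mul_expSL_zero, mat_mul_expSL_one]
    have : Complex.exp (u + t) = Complex.exp (t / 2) * Complex.exp (t / 2) * Complex.exp u := by
      rw [← Complex.exp_add, ← Complex.exp_add]; ring_nf
    have h1 : Complex.exp (-(t / 2 : ℂ)) * Complex.exp (t / 2) = 1 := by
      rw [← Complex.exp_add, neg_add_cancel, Complex.exp_zero]
    rw [this]
    push_cast
    linear_combination (-(mat M i 0 : ℂ) * Complex.exp u * Complex.exp (t / 2)) * h1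
  have h0 := Complex.exp_ne_zero (-(t / 2 : ℂ))
  have h2 : Complex.exp (h * u) = Complex.exp (h * (u + t)) * Complex.exp (-(t / 2)) ^ (2 * h) := by
    rw [← Complex.exp_nat_mul, ← Complex.exp_add]; congr 1; push_cast; ring
  simp only [stripTerm, hl, mul_div_mul_left _ _ h0]
  rw [h2, mul_pow, mul_pow, two_mul, pow_add]
  field_simp

/-- The Möbius value is multiplied by the positive number `e^{jℓ}`, so the principal logarithm
splits, and `e^{jℓ}` to the power `2πim/ℓ` is `e^{2πijm} = 1`. The scalings of the two rows cancel
in the denominator. -/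
theorem stripTerm_expSL_mul {ℓ : ℝ} (hℓ : 0 < ℓ) (h : ℕ) (m j : ℤ) (M : SL(2, ℝ)) {u : ℂ}
    (hu : u ∈ strip) : stripTerm h (2 * Real.pi * m / ℓ) (expSL (j * ℓ) * M) u =
      stripTerm h (2 * Real.pi * m / ℓ) M u := by
  have h0 : linForm (expSL (j * ℓ) * M) 0 (Complex.exp u) =
      Real.exp (j * ℓ / 2) * linForm M 0 (Complex.exp u) := by
    simp only [linForm, mat_expSL_mul_zero]; push_cast; ring
  have h1 : linForm (expSL (j * ℓ) * M) 1 (Complex.exp u) =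
      Real.exp (-(j * ℓ / 2)) * linForm M 1 (Complex.exp u) := by
    simp only [linForm, mat_expSL_mul_one]; push_cast; ring
  have hℓ' : (ℓ : ℂ) ≠ 0 := by exact_mod_cast hℓ.ne'
  have hA := linForm_ne_zero M 0 hu
  have hB := linForm_ne_zero M 1 hu
  have hq : Real.exp (j * ℓ / 2) * linForm M 0 (Complex.exp u) /
      (Real.exp (-(j * ℓ / 2)) * linForm M 1 (Complex.exp u)) =
      (Real.exp (j * ℓ) : ℝ) * (linForm M 0 (Complex.exp u) / linForm M 1 (Complex.exp u)) := by
    rw [show (j : ℝ) * ℓ = j * ℓ / 2 - -(j * ℓ / 2) by ring, Real.exp_sub]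
    push_cast
    have := Complex.exp_ne_zero (-(j * ℓ / 2 : ℂ))
    field_simp
    ring_nf
  have hp : ((Real.exp (j * ℓ / 2) : ℝ) : ℂ) * (Real.exp (-(j * ℓ / 2)) : ℝ) = 1 := by
    rw [← Complex.ofReal_mul, ← Real.exp_add, add_neg_cancel, Real.exp_zero, Complex.ofReal_one]
  have hW : linForm M 0 (Complex.exp u) / linForm M 1 (Complex.exp u) ≠ 0 := div_ne_zero hA hB
  simp only [stripTerm, h0, h1]
  congr 1
  · congr 1
    rw [hq, Complex.cpow_def_of_ne_zero (mul_ne_zero (by exact_mod_cast (Real.exp_pos _).ne') hW),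
      Complex.cpow_def_of_ne_zero hW, Complex.log_ofReal_mul (Real.exp_pos _) hW, Real.log_exp,
      add_mul, Complex.exp_add]
    have : (((j : ℝ) * ℓ : ℝ) : ℂ) * (((2 * Real.pi * m / ℓ : ℝ) : ℂ) * Complex.I) =
        ((j * m : ℤ) : ℂ) * (2 * Real.pi * Complex.I) := by
      push_cast; field_simp
    rw [this, Complex.exp_int_mul_two_pi_mul_I, one_mul]
  · rw [← mul_pow, ← mul_pow]
    congr 1
    linear_combination (linForm M 0 (Complex.exp u) * linForm M 1 (Complex.exp u)) * hp

theorem norm_cpow_mul_I_le {z : ℂ} (hz : z ≠ 0) (κ : ℝ) :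
    ‖z ^ ((κ : ℂ) * Complex.I)‖ ≤ Real.exp (Real.pi * |κ|) := by
  rw [Complex.norm_cpow_of_ne_zero hz]
  simp only [Complex.re_ofReal_mul, Complex.I_re, mul_zero, Real.rpow_zero, Complex.im_ofReal_mul,
    Complex.I_im, mul_one, one_div, ← Real.exp_neg]
  refine Real.exp_le_exp.2 ((neg_le_abs _).trans ?_)
  rw [abs_mul]
  exact mul_le_mul_of_nonneg_right (Complex.abs_arg_le_pi z) (abs_nonneg κ)

theorem norm_stripTerm_le (h : ℕ) (κ : ℝ) (M : SL(2, ℝ)) {u : ℂ} (hu : u ∈ strip) :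
    ‖stripTerm h κ M u‖ ≤ Real.exp (Real.pi * |κ|) * Real.exp (h * u.re) /
      (‖linForm M 0 (Complex.exp u)‖ * ‖linForm M 1 (Complex.exp u)‖) ^ h := by
  have hA := linForm_ne_zero M 0 hu
  have hB := linForm_ne_zero M 1 hu
  rw [stripTerm, norm_div, norm_mul, norm_mul, norm_pow, norm_pow, ← mul_pow, Complex.norm_exp,
    mul_comm (Real.exp (Real.pi * |κ|)), show ((h : ℂ) * u).re = h * u.re by simp]
  gcongr
  exact norm_cpow_mul_I_le (div_ne_zero hA hB) κ

/-- From `ad - bc = 1`. This is what allows a higher power of the inverse product to be replaced by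
its square. -/
theorem one_le_rowNorm_mul (M : SL(2, ℝ)) : 1 ≤ rowNorm M 0 * rowNorm M 1 := by
  have h := det_mat M
  have h1 := le_abs_self (mat M 0 0 * mat M 1 1)
  have h2 := neg_le_abs (mat M 0 1 * mat M 1 0)
  rw [abs_mul] at h1 h2
  unfold rowNorm
  have := mul_nonneg (abs_nonneg (mat M 0 0)) (abs_nonneg (mat M 1 0))
  have := mul_nonneg (abs_nonneg (mat M 0 1)) (abs_nonneg (mat M 1 1))
  nlinarith

/-- On compact subsets of the strip, `stripTerm h κ M` is bounded by a multiple of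
`(‖(a, b)‖ ‖(c, d)‖)⁻²`. -/
theorem exists_norm_stripTerm_le {h : ℕ} (hh : 2 ≤ h) (κ : ℝ) {K : Set ℂ} (hK : IsCompact K)
    (hKs : K ⊆ strip) : ∃ c : ℝ, ∀ M : SL(2, ℝ), ∀ u ∈ K,
      ‖stripTerm h κ M u‖ ≤ c * ((rowNorm M 0 * rowNorm M 1) ^ 2)⁻¹ := by
  -- `L` bounds on `K` the constant that compares a row norm with the corresponding linear form at
  -- `e^u`.
  obtain ⟨L, hL⟩ := hK.exists_bound_of_continuousOn
    (f := fun u ↦ 1 + (1 + ‖Complex.exp u‖) / (Complex.exp u).im) (by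
      refine continuousOn_const.add (ContinuousOn.div ?_ ?_ fun u hu ↦ (exp_im_pos (hKs hu)).ne')
      · exact (continuous_const.add Complex.continuous_exp.norm).continuousOn
      · exact (Complex.continuous_im.comp Complex.continuous_exp).continuousOn)
  obtain ⟨E, hE⟩ := hK.exists_bound_of_continuousOn (f := fun u : ℂ ↦ Real.exp (h * u.re))
    (by fun_prop)
  refine ⟨Real.exp (Real.pi * |κ|) * E * (L * L) ^ h, fun M u hu ↦ ?_⟩
  have h0 := rowNorm_pos M 0
  have h1 := rowNorm_pos M 1
  have hone := one_le_rowNorm_mul M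
  have hrow (i : Fin 2) : rowNorm M i ≤ ‖linForm M i (Complex.exp u)‖ * L :=
    (rowNorm_le_norm_lin M i (exp_im_pos (hKs hu))).trans
      (mul_le_mul_of_nonneg_left ((le_abs_self _).trans (hL u hu)) (norm_nonneg _))
  have hE' := (le_abs_self _).trans (hE u hu)
  have hE0 : 0 ≤ E := (Real.exp_pos _).le.trans hE'
  have hA := norm_pos_iff.2 (linForm_ne_zero M 0 (hKs hu))
  have hB := norm_pos_iff.2 (linForm_ne_zero M 1 (hKs hu))
  have hL0 : 0 < L := by
    by_contra hL0
    have := hrow 0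
    have := mul_nonpos_of_nonneg_of_nonpos hA.le (not_lt.1 hL0)
    linarith
  refine (norm_stripTerm_le h κ M (hKs hu)).trans ?_
  set A := ‖linForm M 0 (Complex.exp u)‖
  set B := ‖linForm M 1 (Complex.exp u)‖
  have h2 : (rowNorm M 0 * rowNorm M 1) ^ 2 ≤ (A * B) ^ h * (L * L) ^ h := by
    calc (rowNorm M 0 * rowNorm M 1) ^ 2 ≤ (rowNorm M 0 * rowNorm M 1) ^ h :=
          pow_le_pow_right₀ hone hh
      _ ≤ ((A * L) * (B * L)) ^ h := by
          gcongr
          · exact hrow 0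
          · exact hrow 1
      _ = _ := by rw [← mul_pow]; ring
  rw [← div_eq_mul_inv, div_le_div_iff₀ (by positivity) (by positivity)]
  calc _ ≤ Real.exp (Real.pi * |κ|) * E * ((A * B) ^ h * (L * L) ^ h) := by gcongr
    _ = _ := by ring

theorem differentiable_linForm_exp (M : SL(2, ℝ)) (i : Fin 2) :
    Differentiable ℂ fun u ↦ linForm M i (Complex.exp u) := by
  unfold linForm; fun_prop

theorem differentiableOn_stripTerm (h : ℕ) (κ : ℝ) (M : SL(2, ℝ)) :
    DifferentiableOn ℂ (stripTerm h κ M) strip := by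
  intro u hu
  have hA := linForm_ne_zero M 0 hu
  have hB := linForm_ne_zero M 1 hu
  have dA := differentiable_linForm_exp M 0 u
  have dB := differentiable_linForm_exp M 1 u
  refine DifferentiableAt.differentiableWithinAt ?_
  unfold stripTerm
  refine DifferentiableAt.div (DifferentiableAt.mul (by fun_prop) ?_) ((dA.pow h).mul (dB.pow h))
    (mul_ne_zero (pow_ne_zero _ hA) (pow_ne_zero _ hB))
  exact (dA.div dB hB).cpow_const (Or.inr (moebius_im_pos M hu).ne')

theorem slash_SL_apply (k : ℤ) (g : SL(2, ℝ)) (f : ℍ → ℂ) (z : ℍ) :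
    SlashAction.map k (g : GL (Fin 2) ℝ) f z = f (g • z) * linForm g 1 z ^ (-k) := by
  have hdet : (Matrix.GeneralLinearGroup.det (g : GL (Fin 2) ℝ)).val = 1 := g.2
  have hz : (g : GL (Fin 2) ℝ) • z = g • z := rfl
  rw [ModularForm.slash_def, hdet]
  beta_reduce
  rw [hz]
  simp only [UpperHalfPlane.σ, hdet, zero_lt_one, if_true, abs_one, Complex.ofReal_one, one_zpow,
    mul_one]
  rfl

/-- With `A`, `B` the linear forms of the two rows, `(A/B)^{-h} B^{-2h} = A^{-h} B^{-h}`. The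
exponent `-h` is an integer, so no branch of the power interferes. -/
theorem exp_mul_slash_hypMode (h : ℕ) (ℓ : ℝ) (m : ℤ) (M : SL(2, ℝ)) {u : ℂ} (hu : u ∈ strip) :
    Complex.exp (h * u) * SlashAction.map ((2 * h : ℕ) : ℤ) (M : GL (Fin 2) ℝ)
      (hypMode (2 * h) ℓ m) (expPoint u hu) = stripTerm h (2 * Real.pi * m / ℓ) M u := by
  have hA := linForm_ne_zero M 0 hu
  have hB := linForm_ne_zero M 1 hu
  have hW := div_ne_zero hA hB
  rw [slash_SL_apply, hypMode, coe_smul_eq, stripTerm]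
  change _ * ((linForm M 0 (Complex.exp u) / linForm M 1 (Complex.exp u)) ^ _ *
    linForm M 1 (Complex.exp u) ^ _) = _
  have he : -((2 * h : ℕ) : ℂ) / 2 + 2 * (Real.pi : ℂ) * Complex.I * (m : ℂ) / (ℓ : ℂ) =
      -(h : ℂ) + ((2 * Real.pi * m / ℓ : ℝ) : ℂ) * Complex.I := by
    push_cast; ring
  rw [he, Complex.cpow_add _ _ hW, Complex.cpow_neg, Complex.cpow_natCast, zpow_neg, zpow_natCast,
    div_pow, two_mul h, pow_add]
  field_simp

theorem exp_mul_hypMode (h : ℕ) (ℓ : ℝ) (n : ℤ) {u : ℂ} (hu : u ∈ strip) :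
    Complex.exp (h * u) * hypMode (2 * h) ℓ n (expPoint u hu) = expMode ℓ n u := by
  rw [hypMode, expPoint]
  change _ * Complex.exp u ^ _ = _
  rw [Complex.cpow_def_of_ne_zero (Complex.exp_ne_zero u), log_exp_of_mem hu, ← Complex.exp_add,
    expMode]
  congr 1
  push_cast; ring

/-- Every point of `ℍ` is `e^u` for some `u` in the strip. -/
theorem exists_expPoint (z : ℍ) : ∃ u, ∃ hu : u ∈ strip, expPoint u hu = z := by
  have hz : (z : ℂ) ≠ 0 := z.ne_zero
  have him : (Complex.log z).im = (z : ℂ).arg := Complex.log_im z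
  have h1 : 0 < (z : ℂ).arg := by
    refine lt_of_le_of_ne (Complex.arg_nonneg_iff.2 z.im_pos.le) fun h ↦ ?_
    have := (Complex.arg_eq_zero_iff.1 h.symm).2
    exact z.im_pos.ne' this
  have h2 : (z : ℂ).arg < Real.pi := by
    refine lt_of_le_of_ne (Complex.arg_le_pi _) fun h ↦ ?_
    exact z.im_pos.ne' (Complex.arg_eq_pi_iff.1 h).2
  refine ⟨Complex.log z, ⟨by rwa [him], by rwa [him]⟩, ?_⟩
  ext1
  exact Complex.exp_log hz

/-! ### Absolute convergence of the integrals `I`. -/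

/-- Since the weight is even, the powers `k/2` are natural powers; they can be multiplied out later
without regard to branches. -/
theorem hhIntegrand_eq (h : ℕ) (ℓ ℓ' : ℝ) (m n : ℤ) (C : ℝ) (α β : ℤˣ) (u : ℂ) :
    hhIntegrand (2 * h) ℓ ℓ' m n C α β u =
      (((Real.sqrt |C / (C - 1)| : ℝ) : ℂ) * (numFactor C α u / denFactor C β u)) ^
        (((2 * Real.pi * m / ℓ : ℝ) : ℂ) * Complex.I) *
      (Complex.exp (h * u) * expMode ℓ' (-n) u) /
      (numFactor C α u ^ h * denFactor C β u ^ h) / ℓ' := by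
  have h1 : ((2 * h : ℕ) : ℂ) / 2 = (h : ℂ) := by push_cast; ring
  rw [hhIntegrand, h1, Complex.cpow_natCast, Complex.cpow_natCast, expMode, ← Complex.exp_add]
  congr 5
  · push_cast; ring
  · push_cast; ring

/-- The imaginary part of the sum is at least `sin(Im u) e^{Re u}` in absolute value. After rotation
by `e^{-i Im u}` the exponential is real and the imaginary part has size `sin(Im u) |p|`. The bound
is the mean of the two. -/
theorem norm_exp_add_ge {u : ℂ} (hu : u ∈ strip) {ε : ℝ} (hε : |ε| = 1) (p : ℝ) :
    Real.sin u.im / 2 * (Real.exp u.re + |p|) ≤ ‖(ε : ℂ) * Complex.exp u + p‖ := by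
  have hs := Real.sin_pos_of_pos_of_lt_pi hu.1 hu.2
  have h1 : Real.sin u.im * Real.exp u.re ≤ ‖(ε : ℂ) * Complex.exp u + p‖ := by
    refine le_trans (le_of_eq ?_) (Complex.abs_im_le_norm _)
    simp [Complex.exp_im, abs_mul, hε, abs_of_pos hs, mul_comm]
  have h2 : Real.sin u.im * |p| ≤ ‖(ε : ℂ) * Complex.exp u + p‖ := by
    have hn : ‖(ε : ℂ) * Complex.exp u + p‖ =
        ‖((ε : ℂ) * Complex.exp u + p) * Complex.exp ((-u.im : ℝ) * Complex.I)‖ := by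
      rw [norm_mul, Complex.norm_exp_ofReal_mul_I, mul_one]
    have he : ((ε : ℂ) * Complex.exp u + p) * Complex.exp ((-u.im : ℝ) * Complex.I) =
        ((ε * Real.exp u.re : ℝ) : ℂ) + p * Complex.exp ((-u.im : ℝ) * Complex.I) := by
      rw [add_mul, mul_assoc, ← Complex.exp_add]
      congr 1
      push_cast
      congr 2
      nth_rewrite 1 [← Complex.re_add_im u]
      ring
    rw [hn, he]
    refine le_trans (le_of_eq ?_) (Complex.abs_im_le_norm _)
    rw [Complex.add_im, Complex.ofReal_im, Complex.im_ofReal_mul, Complex.exp_ofReal_mul_I_im,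
      Real.sin_neg]
    simp [abs_mul, abs_of_pos hs, mul_comm]
  linarith

theorem abs_unit_cast (α : ℤˣ) : |((α : ℤ) : ℝ)| = 1 := by
  rcases Int.units_eq_one_or α with h | h <;> simp [h]

theorem abs_sign_of_ne_zero {x : ℝ} (hx : x ≠ 0) : |Real.sign x| = 1 := by
  rcases Real.sign_apply_eq_of_ne_zero x hx with h | h <;> simp [h]

theorem norm_numFactor_ge {C : ℝ} (hC1 : C ≠ 1) (α : ℤˣ) {u : ℂ} (hu : u ∈ strip) :
    Real.sin u.im / 2 * (Real.exp u.re + Real.sqrt |(C - 1) / C|) ≤ ‖numFactor C α u‖ := by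
  have h := norm_exp_add_ge hu (abs_unit_cast α) (Real.sign (C - 1) * Real.sqrt |(C - 1) / C|)
  rw [abs_mul, abs_sign_of_ne_zero (sub_ne_zero.2 hC1), one_mul,
    abs_of_nonneg (Real.sqrt_nonneg _)] at h
  simpa [numFactor] using h

theorem norm_denFactor_ge (C : ℝ) (β : ℤˣ) {u : ℂ} (hu : u ∈ strip) :
    Real.sin u.im / 2 * (Real.exp u.re + Real.sqrt |C / (C - 1)|) ≤ ‖denFactor C β u‖ := by
  have h := norm_exp_add_ge hu (ε := 1) abs_one (((β : ℤ) : ℝ) * Real.sqrt |C / (C - 1)|)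
  rw [abs_mul, abs_unit_cast, one_mul, abs_of_nonneg (Real.sqrt_nonneg _)] at h
  simpa [denFactor] using h

/-- The reciprocal of the left side is `2 + e^x + e^{-x}`, and `e^{|x|} ≥ 1 + |x| + x²/2` and
`e^{-|x|} ≥ 1 - |x|` bound it below by `4 + x²/2`. It supplies an integrable majorant. -/
theorem exp_div_sq_le (x : ℝ) : Real.exp x / (1 + Real.exp x) ^ 2 ≤ 2 * (1 + x ^ 2)⁻¹ := by
  have key : 2 + x ^ 2 / 2 ≤ Real.exp x + Real.exp (-x) := by
    have h1 := Real.quadratic_le_exp_of_nonneg (abs_nonneg x)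
    have h2 := Real.add_one_le_exp (-|x|)
    rw [sq_abs] at h1
    rcases abs_cases x with ⟨h, -⟩ | ⟨h, -⟩
    · rw [h] at h1 h2; linarith
    · rw [h] at h1 h2; rw [neg_neg] at h2; linarith
  have hx := Real.exp_pos x
  have h3 : Real.exp x * Real.exp (-x) = 1 := by rw [← Real.exp_add, add_neg_cancel, Real.exp_zero]
  rw [← div_eq_mul_inv, div_le_div_iff₀ (by positivity) (by positivity)]
  have h4 := mul_le_mul_of_nonneg_left key hx.le
  rw [mul_add, mul_add _ (Real.exp x), h3] at h4
  nlinarith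

/-- The integrals `I_{ηη'}(m, n; C, α, β)` converge absolutely. -/
theorem integrable_hhIntegrand {h : ℕ} (hh : 1 ≤ h) (ℓ ℓ' : ℝ) (m n : ℤ) {C : ℝ} (hC0 : C ≠ 0)
    (hC1 : C ≠ 1) (α β : ℤˣ) {y : ℝ} (h0 : 0 < y) (h1 : y < Real.pi) :
    Integrable fun x : ℝ ↦ hhIntegrand (2 * h) ℓ ℓ' m n C α β (line y x) := by
  have hC1' := sub_ne_zero.2 hC1
  set ρ := Real.sqrt |C / (C - 1)| with hρ
  set ρ' := Real.sqrt |(C - 1) / C| with hρ'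
  have hρ0 : 0 < ρ := Real.sqrt_pos.2 (abs_pos.2 (div_ne_zero hC0 hC1'))
  have hρ0' : 0 < ρ' := Real.sqrt_pos.2 (abs_pos.2 (div_ne_zero hC1' hC0))
  have hs := Real.sin_pos_of_pos_of_lt_pi h0 h1
  -- With this `s` both factors of the denominator are at least `s(1 + e^x)`, so the integrand is
  -- `O((e^x / (1 + e^x)²)^h)`.
  set s := Real.sin y / 2 * min 1 (min ρ ρ') with hsdef
  have hs0 : 0 < s := by have := lt_min one_pos (lt_min hρ0 hρ0'); positivity
  set κ := 2 * Real.pi * m / ℓ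
  set c := Real.exp (Real.pi * |κ|) * Real.exp (2 * Real.pi * n / ℓ' * y) * (s⁻¹ ^ 2) ^ h * |ℓ'|⁻¹
    with hc
  have hint : Integrable fun x : ℝ ↦ c * (2 * (1 + x ^ 2)⁻¹) :=
    (integrable_inv_one_add_sq.const_mul 2).const_mul c
  refine hint.mono' ?_ (.of_forall fun x ↦ ?_)
  · refine Measurable.aestronglyMeasurable ?_
    unfold hhIntegrand numFactor denFactor line
    fun_prop
  have hu := line_mem_strip h0 h1 x
  have hN := norm_numFactor_ge hC1 α hu
  have hD := norm_denFactor_ge C β hu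
  rw [line_im, line_re] at hN hD
  rw [hhIntegrand_eq]
  set N := numFactor C α (line y x)
  set D := denFactor C β (line y x)
  set E := Real.exp x with hE
  have hE0 : 0 < E := Real.exp_pos x
  have low {r : ℝ} (hr : min 1 (min ρ ρ') ≤ r) :
      s * (1 + E) ≤ Real.sin y / 2 * (E + r) := by
    rw [hsdef, mul_assoc]
    have h2 : min 1 (min ρ ρ') ≤ 1 := min_le_left _ _
    have h3 : min 1 (min ρ ρ') * (1 + E) ≤ E + r := by nlinarith
    gcongr
  have hN' : s * (1 + E) ≤ ‖N‖ := (low ((min_le_right _ _).trans (min_le_right _ _))).trans hN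
  have hD' : s * (1 + E) ≤ ‖D‖ := (low ((min_le_right _ _).trans (min_le_left _ _))).trans hD
  have hpos : 0 < s * (1 + E) := by positivity
  have hN0 : N ≠ 0 := norm_pos_iff.1 (hpos.trans_le hN')
  have hD0 : D ≠ 0 := norm_pos_iff.1 (hpos.trans_le hD')
  have hW : ((ρ : ℝ) : ℂ) * (N / D) ≠ 0 :=
    mul_ne_zero (by exact_mod_cast hρ0.ne') (div_ne_zero hN0 hD0)
  have hexp : ‖Complex.exp (h * line y x)‖ = E ^ h := by
    rw [Complex.norm_exp, hE, ← Real.exp_nat_mul]; simp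
  have hmode : ‖expMode ℓ' (-n) (line y x)‖ = Real.exp (2 * Real.pi * n / ℓ' * y) := by
    rw [norm_expMode, line_im]; congr 1; push_cast; ring
  rw [norm_div, norm_div, norm_mul, norm_mul, norm_mul, norm_pow, norm_pow, hexp, hmode,
    Complex.norm_real, Real.norm_eq_abs, ← mul_pow]
  have hq0 : 0 ≤ E / (1 + E) ^ 2 := by positivity
  have hq1 : E / (1 + E) ^ 2 ≤ 1 := by
    rw [div_le_one (by positivity)]; nlinarith
  calc _ ≤ Real.exp (Real.pi * |κ|) * (E ^ h * Real.exp (2 * Real.pi * n / ℓ' * y)) /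
        ((s * (1 + E)) * (s * (1 + E))) ^ h / |ℓ'| := by
        gcongr
        exact norm_cpow_mul_I_le hW κ
    _ = c * (E / (1 + E) ^ 2) ^ h := by
        rw [hc, div_pow, show s * (1 + E) * (s * (1 + E)) = s ^ 2 * (1 + E) ^ 2 by ring, mul_pow,
          inv_pow, inv_pow]
        field_simp
    _ ≤ c * (E / (1 + E) ^ 2) := by
        have hc0 : 0 ≤ c := by positivity
        gcongr
        exact pow_le_of_le_one hq0 hq1 (by omega)
    _ ≤ _ := by
        have hc0 : 0 ≤ c := by positivity
        gcongr
        exact exp_div_sq_le x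

/-! ### Normalization of a summand whose matrix has no zero entry. -/

theorem eq_sign_mul_abs (x : ℝ) : x = Real.sign x * |x| := by
  rcases lt_trichotomy x 0 with h | h | h
  · rw [Real.sign_of_neg h, abs_of_neg h]; ring
  · simp [h]
  · rw [Real.sign_of_pos h, abs_of_pos h]; ring

theorem sign_mul' (x y : ℝ) : Real.sign (x * y) = Real.sign x * Real.sign y := by
  rcases lt_trichotomy x 0 with h | h | h <;> rcases lt_trichotomy y 0 with h' | h' | h' <;>
    simp [h, h', Real.sign_of_neg, Real.sign_of_pos, mul_neg_of_neg_of_pos, mul_neg_of_pos_of_neg,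
      mul_pos_of_neg_of_neg]

theorem sign_mul_self_of_ne_zero {x : ℝ} (hx : x ≠ 0) : Real.sign x * Real.sign x = 1 := by
  rcases Real.sign_apply_eq_of_ne_zero x hx with h | h <;> simp [h]

section Generic

variable (M : SL(2, ℝ))

/-- The phase of the Kloosterman sum attached to a matrix. -/
def klPhase (ℓ ℓ' : ℝ) (m n : ℤ) (A : Matrix (Fin 2) (Fin 2) ℝ) : ℂ :=
  Complex.exp (2 * (Real.pi : ℂ) * Complex.I *
    (((m : ℝ) / (2 * ℓ) * Real.log |(A 0 0 * A 0 1) / (A 1 0 * A 1 1)| +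
      (n : ℝ) / (2 * ℓ') * Real.log |(A 0 0 * A 1 0) / (A 0 1 * A 1 1)| : ℝ) : ℂ))

/-- The real shift that normalizes a matrix with nonzero entries. -/
def shift (A : Matrix (Fin 2) (Fin 2) ℝ) : ℝ :=
  1 / 2 * Real.log |(A 0 1 * A 1 1) / (A 0 0 * A 1 0)|

theorem exp_half_log {X : ℝ} (hX : X ≠ 0) : Real.exp (1 / 2 * Real.log |X|) = Real.sqrt |X| := by
  rw [mul_comm, ← Real.rpow_def_of_pos (abs_pos.2 hX), Real.sqrt_eq_rpow]

/-- The summand attached to a matrix with nonzero entries is, up to a shift and constant factors,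
the integrand of `I_{ηη'}(m, n; C, α, β)`. -/
theorem stripTerm_shift_mul_expMode (h : ℕ) (ℓ ℓ' : ℝ) (m n : ℤ)
    (hM : mat M 0 0 * mat M 0 1 * mat M 1 0 * mat M 1 1 ≠ 0) {C : ℝ} {α β : ℤˣ}
    (hC : mat M 0 0 * mat M 1 1 = C) (hα : Real.sign (mat M 0 0 * mat M 1 0) = ((α : ℤ) : ℝ))
    (hβ : Real.sign (mat M 1 0 * mat M 1 1) = ((β : ℤ) : ℝ)) {v : ℂ} (hv : v ∈ strip) :
    1 / (ℓ' : ℂ) * (stripTerm h (2 * Real.pi * m / ℓ) M (v + shift (mat M)) *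
      expMode ℓ' (-n) (v + shift (mat M))) =
    hhIntegrand (2 * h) ℓ ℓ' m n C α β v *
      (klPhase ℓ ℓ' m n (mat M) / ((|C * (C - 1)| ^ (((2 * h : ℕ) : ℝ) / 4) : ℝ) : ℂ)) := by
  have hdet := det_mat M
  simp only [stripTerm, linForm, hhIntegrand_eq, numFactor, denFactor, klPhase, shift]
  set a := mat M 0 0
  set b := mat M 0 1
  set c := mat M 1 0
  set d := mat M 1 1
  have ha : a ≠ 0 := by rintro h; simp [h] at hM
  have hb : b ≠ 0 := by rintro h; simp [h] at hM
  have hc : c ≠ 0 := by rintro h; simp [h] at hM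
  have hd : d ≠ 0 := by rintro h; simp [h] at hM
  have hC1 : C - 1 = b * c := by rw [← hC]; linarith
  have hC0 : C ≠ 0 := hC ▸ mul_ne_zero ha hd
  have hC10 : C - 1 ≠ 0 := hC1 ▸ mul_ne_zero hb hc
  have hN0 := norm_numFactor_ge (sub_ne_zero.1 hC10) α hv
  have hD0 := norm_denFactor_ge C β hv
  rw [numFactor] at hN0
  rw [denFactor] at hD0
  -- The shift by `t` is chosen so that `|d/c|` and `|b/a|` become `T` times `ρ` and `ρ'`, which
  -- depend on `C` alone because `ad = C` and `bc = C - 1`.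
  set t := 1 / 2 * Real.log |b * d / (a * c)| with ht
  set T := Real.exp t with hT
  have hTs : T = Real.sqrt |b * d / (a * c)| :=
    exp_half_log (div_ne_zero (mul_ne_zero hb hd) (mul_ne_zero ha hc))
  have hT0 : 0 < T := Real.exp_pos t
  set ρ := Real.sqrt |C / (C - 1)| with hρ
  set ρ' := Real.sqrt |(C - 1) / C| with hρ'
  have hρ0 : 0 < ρ := Real.sqrt_pos.2 (abs_pos.2 (div_ne_zero hC0 hC10))
  have hρT : ρ * T = |d / c| := by
    rw [hρ, hTs, ← Real.sqrt_mul (abs_nonneg _), ← abs_mul, hC1, ← hC, ← Real.sqrt_sq_eq_abs,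
      ← Real.sqrt_sq_eq_abs]
    rw [show a * d / (b * c) * (b * d / (a * c)) = (d / c) ^ 2 by field_simp, Real.sqrt_sq_eq_abs,
      abs_pow, sq_abs]
  have hρT' : ρ' * T = |b / a| := by
    rw [hρ', hTs, ← Real.sqrt_mul (abs_nonneg _), ← abs_mul, hC1, ← hC, ← Real.sqrt_sq_eq_abs,
      ← Real.sqrt_sq_eq_abs]
    rw [show b * c / (a * d) * (b * d / (a * c)) = (b / a) ^ 2 by field_simp, Real.sqrt_sq_eq_abs,
      abs_pow, sq_abs]
  set r := Real.sqrt |a * b / (c * d)| with hr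
  have hab : a * b / (c * d) ≠ 0 := div_ne_zero (mul_ne_zero ha hb) (mul_ne_zero hc hd)
  have hr0 : 0 < r := Real.sqrt_pos.2 (abs_pos.2 hab)
  have hrρ : r * ρ = |a / c| := by
    rw [hr, hρ, ← Real.sqrt_mul (abs_nonneg _), ← abs_mul, hC1, ← hC, ← Real.sqrt_sq_eq_abs,
      ← Real.sqrt_sq_eq_abs]
    rw [show a * b / (c * d) * (a * d / (b * c)) = (a / c) ^ 2 by field_simp, Real.sqrt_sq_eq_abs,
      abs_pow, sq_abs]
  have hα' : ((α : ℤ) : ℝ) = Real.sign a * Real.sign c := by rw [← hα, sign_mul']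
  have hβ' : ((β : ℤ) : ℝ) = Real.sign c * Real.sign d := by rw [← hβ, sign_mul']
  have hsa := sign_mul_self_of_ne_zero ha
  have hsc := sign_mul_self_of_ne_zero hc
  have habs (x : ℝ) : Real.sign x * |x| = x := (eq_sign_mul_abs x).symm
  have hself (x : ℝ) : x * Real.sign x = |x| := by
    rcases lt_trichotomy x 0 with h | h | h
    · rw [Real.sign_of_neg h, abs_of_neg h]; ring
    · simp [h]
    · rw [Real.sign_of_pos h, abs_of_pos h]; ring
  have hdβ : d = c * T * (((β : ℤ) : ℝ) * ρ) := by
    have h1 : c * T * (((β : ℤ) : ℝ) * ρ) = c * ((β : ℤ) : ℝ) * (ρ * T) := by ring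
    rw [h1, hρT, hβ', abs_div]
    rw [mul_div_assoc', eq_div_iff (abs_pos.2 hc).ne']
    linear_combination (-|c|) * habs d - Real.sign d * |d| * hself c
  have hbα : b = a * T * ((α : ℤ) : ℝ) * (Real.sign (C - 1) * ρ') := by
    have h1 : a * T * ((α : ℤ) : ℝ) * (Real.sign (C - 1) * ρ') =
      a * ((α : ℤ) : ℝ) * Real.sign (C - 1) * (ρ' * T) := by ring
    rw [h1, hρT', hα', hC1, sign_mul', abs_div]
    rw [mul_div_assoc', eq_div_iff (abs_pos.2 ha).ne']
    linear_combination (-|a|) * habs b - Real.sign b * |b| * hself a -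
      a * Real.sign a * Real.sign b * |b| * hsc
  have hαα : ((α : ℤ) : ℂ) * ((α : ℤ) : ℂ) = 1 := by
    rcases Int.units_eq_one_or α with h | h <;> simp [h]
  have hαac : ((α : ℤ) : ℝ) * (a * c) = |a * c| := by
    rw [← hα]
    nth_rewrite 2 [eq_sign_mul_abs (a * c)]
    rw [← mul_assoc, sign_mul_self_of_ne_zero (mul_ne_zero ha hc), one_mul]
  have hs0 : 0 < Real.sin v.im := Real.sin_pos_of_pos_of_lt_pi hv.1 hv.2
  set E := Complex.exp v with hE
  have hexp : Complex.exp (v + t) = T * E := by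
    rw [Complex.exp_add, hT, Complex.ofReal_exp, mul_comm]
  set N := ((α : ℤ) : ℂ) * E + ((Real.sign (C - 1) * ρ' : ℝ) : ℂ) with hN
  set D := E + ((β : ℤ) : ℂ) * ((ρ : ℝ) : ℂ) with hD
  have hN0' : N ≠ 0 := norm_pos_iff.1 (lt_of_lt_of_le (by positivity) hN0)
  have hD0' : D ≠ 0 := norm_pos_iff.1 (lt_of_lt_of_le (by positivity) hD0)
  have hA : (a : ℂ) * Complex.exp (v + t) + b = (a * T * ((α : ℤ) : ℂ)) * N := by
    have hbα' : (b : ℂ) = a * T * ((α : ℤ) : ℂ) * ((Real.sign (C - 1) * ρ' : ℝ) : ℂ) := by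
      rw [hbα]; push_cast; rfl
    rw [hexp, hN, hbα']
    linear_combination (-(a : ℂ) * T * E) * hαα
  have hB : (c : ℂ) * Complex.exp (v + t) + d = (c * T) * D := by
    have hdβ' : (d : ℂ) = c * T * (((β : ℤ) : ℂ) * ((ρ : ℝ) : ℂ)) := by
      rw [hdβ]; push_cast; rfl
    rw [hexp, hD, hdβ']; ring
  have hTc : (T : ℂ) ≠ 0 := by exact_mod_cast hT0.ne'
  have hcc : (c : ℂ) ≠ 0 := by exact_mod_cast hc
  have hW : (a * T * ((α : ℤ) : ℂ)) * N / ((c * T) * D) = (r : ℂ) * ((ρ : ℂ) * (N / D)) := by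
    have h1 : a * ((α : ℤ) : ℝ) / c = r * ρ := by
      rw [hrρ, abs_div, div_eq_div_iff hc (abs_pos.2 hc).ne', hα']
      linear_combination (Real.sign c * |c|) * hself a + |a| * habs c
    have h2 : (a : ℂ) * ((α : ℤ) : ℂ) / c = r * ρ := by exact_mod_cast congrArg Complex.ofReal h1
    rw [← mul_assoc, ← h2]
    field_simp
  have hW0 : (ρ : ℂ) * (N / D) ≠ 0 :=
    mul_ne_zero (by exact_mod_cast hρ0.ne') (div_ne_zero hN0' hD0')
  -- The constant `r` is positive, so the power splits; its contribution is the `m`-part of the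
  -- phase. The `n`-part comes from the shift in `expMode`.
  have hcpow : ((r : ℂ) * ((ρ : ℂ) * (N / D))) ^ (((2 * Real.pi * m / ℓ : ℝ) : ℂ) * Complex.I) =
      Complex.exp (2 * Real.pi * Complex.I *
        ((m : ℝ) / (2 * ℓ) * Real.log |a * b / (c * d)| : ℝ)) *
      ((ρ : ℂ) * (N / D)) ^ (((2 * Real.pi * m / ℓ : ℝ) : ℂ) * Complex.I) := by
    rw [Complex.cpow_def_of_ne_zero (mul_ne_zero (by exact_mod_cast hr0.ne') hW0),
      Complex.cpow_def_of_ne_zero hW0, Complex.log_ofReal_mul hr0 hW0, add_mul, Complex.exp_add]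
    congr 2
    rw [hr, Real.log_sqrt (abs_nonneg _)]
    push_cast
    ring
  have hmode : expMode ℓ' (-n) (v + t) = expMode ℓ' (-n) v *
      Complex.exp (2 * Real.pi * Complex.I *
        ((n : ℝ) / (2 * ℓ') * Real.log |a * c / (b * d)| : ℝ)) := by
    rw [expMode, expMode, ← Complex.exp_add]
    congr 1
    rw [ht, ← inv_div (a * c) (b * d), abs_inv, Real.log_inv]
    push_cast
    ring
  have hphase : Complex.exp (2 * (Real.pi : ℂ) * Complex.I *
      (((m : ℝ) / (2 * ℓ) * Real.log |a * b / (c * d)| +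
        (n : ℝ) / (2 * ℓ') * Real.log |a * c / (b * d)| : ℝ) : ℂ)) =
      Complex.exp (2 * Real.pi * Complex.I *
        ((m : ℝ) / (2 * ℓ) * Real.log |a * b / (c * d)| : ℝ)) *
      Complex.exp (2 * Real.pi * Complex.I *
        ((n : ℝ) / (2 * ℓ') * Real.log |a * c / (b * d)| : ℝ)) := by
    rw [← Complex.exp_add]; congr 1; push_cast; ring
  -- `|C(C-1)| = |abcd| = (|ac| T)²`. The constants pulled out of the two linear forms multiply to
  -- `|ac| T²`, and `e^{h(v+t)}` returns one factor `T^h`; this leaves `|C(C-1)|^{h/2}`.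
  have hpow : (((|C * (C - 1)| ^ (((2 * h : ℕ) : ℝ) / 4) : ℝ)) : ℂ) =
      ((|a * c| : ℝ) : ℂ) ^ h * (T : ℂ) ^ h := by
    have h1 : Real.sqrt |C * (C - 1)| = |a * c| * T := by
      rw [hTs, ← Real.sqrt_sq (abs_nonneg (a * c)), ← Real.sqrt_mul (sq_nonneg _), sq_abs,
        ← abs_of_nonneg (sq_nonneg (a * c)), ← abs_mul, hC1, ← hC]
      congr 2
      field_simp
    have h2 : |C * (C - 1)| ^ (((2 * h : ℕ) : ℝ) / 4) = (|a * c| * T) ^ h := by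
      rw [← h1, Real.sqrt_eq_rpow, ← Real.rpow_natCast, ← Real.rpow_mul (abs_nonneg _)]
      congr 1; push_cast; ring
    rw [h2]; push_cast; ring
  have heh : Complex.exp (h * (v + t)) = Complex.exp (h * v) * (T : ℂ) ^ h := by
    rw [mul_add, Complex.exp_add, hT, Complex.ofReal_exp, ← Complex.exp_nat_mul]
  have hden : ((a * T * ((α : ℤ) : ℂ)) * N) ^ h * ((c * T) * D) ^ h =
      ((|a * c| : ℝ) : ℂ) ^ h * (T : ℂ) ^ h * (T : ℂ) ^ h * (N ^ h * D ^ h) := by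
    rw [← hαac]; push_cast; simp only [mul_pow]; ring
  have hac : ((|a * c| : ℝ) : ℂ) ≠ 0 := by
    exact_mod_cast (abs_pos.2 (mul_ne_zero ha hc)).ne'
  rw [hA, hB, hW, hcpow, hmode, hphase, hpow, heh, hden]
  field_simp

end Generic

/-! ### Unfolding, and the Fourier coefficients of the three kinds of summands. -/

/-- The line is tiled by the translates of `[0, ℓ]`; rescaling reduces this to unit intervals. -/
theorem hasSum_intervalIntegral_shift {f : ℝ → ℂ} (hf : Integrable f) {ℓ : ℝ} (hℓ : 0 < ℓ) :
    HasSum (fun j : ℤ ↦ ∫ x in (0 : ℝ)..ℓ, f (x + j * ℓ)) (∫ x, f x) := by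
  have h1 := ((hf.comp_mul_left' hℓ.ne').hasSum_intervalIntegral_comp_add_int).mul_left (ℓ : ℂ)
  have hℓ' : (ℓ : ℂ) ≠ 0 := by exact_mod_cast hℓ.ne'
  rw [Measure.integral_comp_mul_left, abs_of_pos (inv_pos.2 hℓ), Complex.real_smul,
    Complex.ofReal_inv, mul_inv_cancel_left₀ hℓ'] at h1
  convert! h1 using 2 with j
  have h2 := intervalIntegral.integral_comp_mul_left (a := 0) (b := 1) (fun x ↦ f (x + j * ℓ))
    hℓ.ne'
  rw [mul_zero, mul_one, Complex.real_smul, Complex.ofReal_inv, eq_inv_mul_iff_mul_eq₀ hℓ'] at h2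
  rw [← h2]
  congr 1
  refine intervalIntegral.integral_congr fun x _ ↦ ?_
  congr 1; ring

theorem stripCoeff_congr {F G : ℂ → ℂ} (h : ∀ u ∈ strip, F u = G u) (ℓ : ℝ) (n : ℤ) {y : ℝ}
    (h0 : 0 < y) (h1 : y < Real.pi) : stripCoeff F ℓ n y = stripCoeff G ℓ n y := by
  unfold stripCoeff
  congr 1
  refine intervalIntegral.integral_congr fun x _ ↦ ?_
  simp only [h _ (line_mem_strip h0 h1 x)]

theorem stripCoeff_expMode {ℓ : ℝ} (hℓ : 0 < ℓ) (K : ℂ) (m n : ℤ) (y : ℝ) :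
    stripCoeff (fun u ↦ K * expMode ℓ m u) ℓ n y = if n = m then K else 0 := by
  have hℓ' : (ℓ : ℂ) ≠ 0 := by exact_mod_cast hℓ.ne'
  simp only [stripCoeff, mul_assoc, ← expMode_add]
  rw [intervalIntegral.integral_const_mul, integral_expMode hℓ]
  by_cases h : n = m
  · rw [if_pos h, if_pos (by omega)]; field_simp
  · rw [if_neg h, if_neg (by omega)]; simp

/-- The summand attached to a diagonal matrix. -/
theorem stripTerm_diag (h : ℕ) (ℓ : ℝ) (m : ℤ) {M : SL(2, ℝ)} {a : ℝ} (ha : a ≠ 0)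
    (hM : mat M = !![a, 0; 0, 1 / a]) {u : ℂ} (hu : u ∈ strip) :
    stripTerm h (2 * Real.pi * m / ℓ) M u =
      ((a ^ 2 : ℝ) : ℂ) ^ (2 * (Real.pi : ℂ) * Complex.I * (m : ℂ) / (ℓ : ℂ)) * expMode ℓ m u := by
  have ha' : (a : ℂ) ≠ 0 := by exact_mod_cast ha
  have hE := Complex.exp_ne_zero u
  have ha2 : (0 : ℝ) < a ^ 2 := by positivity
  have hκ : ((2 * Real.pi * m / ℓ : ℝ) : ℂ) * Complex.I =
      2 * (Real.pi : ℂ) * Complex.I * (m : ℂ) / (ℓ : ℂ) := by push_cast; ring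
  have hW : (a : ℂ) * Complex.exp u / (1 / a) = ((a ^ 2 : ℝ) : ℂ) * Complex.exp u := by
    push_cast; field_simp
  simp only [stripTerm, linForm, hM, Matrix.of_apply, Matrix.cons_val', Matrix.cons_val_zero,
    Matrix.cons_val_one, Matrix.cons_val_fin_one, Complex.ofReal_zero, add_zero, zero_mul,
    zero_add]
  rw [Complex.ofReal_div, Complex.ofReal_one, hW, hκ,
    Complex.cpow_def_of_ne_zero (mul_ne_zero (by exact_mod_cast ha2.ne') hE),
    Complex.log_ofReal_mul ha2 hE, log_exp_of_mem hu, add_mul, Complex.exp_add,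
    Complex.cpow_def_of_ne_zero (by exact_mod_cast ha2.ne'), Complex.ofReal_log ha2.le, expMode,
    Complex.exp_nat_mul, mul_comm u, mul_pow, one_div, inv_pow]
  field_simp

/-- The summand attached to an antidiagonal matrix. -/
theorem stripTerm_antidiag (h : ℕ) (ℓ : ℝ) (m : ℤ) {M : SL(2, ℝ)} {b : ℝ} (hb : b ≠ 0)
    (hM : mat M = !![0, b; -(1 / b), 0]) {u : ℂ} (hu : u ∈ strip) :
    stripTerm h (2 * Real.pi * m / ℓ) M u =
      ((-1) ^ h * ((Real.exp (2 * Real.pi ^ 2 * ((-m : ℤ) : ℝ) / ℓ) : ℝ) : ℂ) *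
        ((b ^ 2 : ℝ) : ℂ) ^ (-(2 * (Real.pi : ℂ) * Complex.I * ((-m : ℤ) : ℂ) / (ℓ : ℂ)))) *
        expMode ℓ (-m) u := by
  have hb' : (b : ℂ) ≠ 0 := by exact_mod_cast hb
  have hE := Complex.exp_ne_zero u
  have hb2 : (0 : ℝ) < b ^ 2 := by positivity
  have hκ : -(2 * (Real.pi : ℂ) * Complex.I * ((-m : ℤ) : ℂ) / (ℓ : ℂ)) =
      2 * (Real.pi : ℂ) * Complex.I * (m : ℂ) / (ℓ : ℂ) := by push_cast; ring
  have hκ' : ((2 * Real.pi * m / ℓ : ℝ) : ℂ) * Complex.I =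
      2 * (Real.pi : ℂ) * Complex.I * (m : ℂ) / (ℓ : ℂ) := by push_cast; ring
  have hE' : Complex.exp (Real.pi * Complex.I - u) = -(Complex.exp u)⁻¹ := by
    rw [Complex.exp_sub, Complex.exp_pi_mul_I, neg_div, one_div]
  -- The map is `z ↦ -b²/z`, and `-1/e^u = e^{πi - u}` with `πi - u` again in the strip, so this is
  -- its principal logarithm. The summand `πi` produces the real factor `e^{-2π²m/ℓ}`.
  have hlog : Complex.log (Complex.exp (Real.pi * Complex.I - u)) = Real.pi * Complex.I - u := by
    have h1 : (Real.pi * Complex.I - u).im = Real.pi - u.im := by simp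
    exact Complex.log_exp (by rw [h1]; linarith [hu.2, Real.pi_pos]) (by rw [h1]; linarith [hu.1])
  have hW : (b : ℂ) / (-(1 / b) * Complex.exp u) =
      ((b ^ 2 : ℝ) : ℂ) * Complex.exp (Real.pi * Complex.I - u) := by
    rw [hE']; push_cast; field_simp
  simp only [stripTerm, linForm, hM, Matrix.of_apply, Matrix.cons_val', Matrix.cons_val_zero,
    Matrix.cons_val_one, Matrix.cons_val_fin_one, Complex.ofReal_zero, add_zero, zero_mul,
    zero_add]
  rw [Complex.ofReal_neg, Complex.ofReal_div, Complex.ofReal_one, hW, hκ, hκ',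
    Complex.cpow_def_of_ne_zero (mul_ne_zero (by exact_mod_cast hb2.ne') (Complex.exp_ne_zero _)),
    Complex.log_ofReal_mul hb2 (Complex.exp_ne_zero _), hlog, add_mul, Complex.exp_add,
    Complex.cpow_def_of_ne_zero (by exact_mod_cast hb2.ne'), Complex.ofReal_log hb2.le, expMode,
    Complex.exp_nat_mul, ← mul_pow]
  have h1 : Complex.exp ((Real.pi * Complex.I - u) *
      (2 * (Real.pi : ℂ) * Complex.I * (m : ℂ) / (ℓ : ℂ))) =
      ((Real.exp (2 * Real.pi ^ 2 * ((-m : ℤ) : ℝ) / ℓ) : ℝ) : ℂ) *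
      Complex.exp (2 * (Real.pi : ℂ) * Complex.I * ((-m : ℤ) : ℂ) / (ℓ : ℂ) * u) := by
    rw [Complex.ofReal_exp, ← Complex.exp_add]
    congr 1
    push_cast
    linear_combination (2 * Real.pi ^ 2 * m / ℓ : ℂ) * Complex.I_sq
  have h2 : (b : ℂ) * (-(1 / b) * Complex.exp u) = -1 * Complex.exp u := by field_simp
  rw [h1, h2, mul_pow]
  have h3 : ((-1 : ℂ) ^ h) * (-1) ^ h = 1 := by rw [← mul_pow]; simp
  have h4 : ((-1 : ℂ) ^ h) ≠ 0 := pow_ne_zero _ (by norm_num)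
  rw [div_eq_iff (mul_ne_zero h4 (pow_ne_zero _ hE))]
  linear_combination (-Complex.exp (Complex.log ((b ^ 2 : ℝ) : ℂ) *
    (2 * (Real.pi : ℂ) * Complex.I * (m : ℂ) / (ℓ : ℂ))) *
    (((Real.exp (2 * Real.pi ^ 2 * ((-m : ℤ) : ℝ) / ℓ) : ℝ) : ℂ) *
      Complex.exp (2 * (Real.pi : ℂ) * Complex.I * ((-m : ℤ) : ℂ) / (ℓ : ℂ) * u)) *
      Complex.exp u ^ h) * h3

section Generic

variable {M : SL(2, ℝ)} {C : ℝ} {α β : ℤˣ} {y : ℝ}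

theorem line_add (y x t : ℝ) : line y (x + t) = line y x + t := by
  simp only [line]; push_cast; ring

/-- For a matrix with nonzero entries, the summand is integrable on horizontal lines, and its
Fourier integral is given by `I_{ηη'}(m, n; C, α, β)`. -/
theorem integrable_and_integral_stripTerm {h : ℕ} (hh : 1 ≤ h) (ℓ : ℝ) {ℓ' : ℝ} (hℓ' : 0 < ℓ')
    (m n : ℤ) (hM : mat M 0 0 * mat M 0 1 * mat M 1 0 * mat M 1 1 ≠ 0)
    (hC : mat M 0 0 * mat M 1 1 = C) (hα : Real.sign (mat M 0 0 * mat M 1 0) = ((α : ℤ) : ℝ))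
    (hβ : Real.sign (mat M 1 0 * mat M 1 1) = ((β : ℤ) : ℝ)) (h0 : 0 < y) (h1 : y < Real.pi) :
    Integrable (fun x ↦ stripTerm h (2 * Real.pi * m / ℓ) M (line y x) *
      expMode ℓ' (-n) (line y x)) ∧
    1 / (ℓ' : ℂ) * ∫ x, stripTerm h (2 * Real.pi * m / ℓ) M (line y x) *
      expMode ℓ' (-n) (line y x) = hhIntegral (2 * h) ℓ ℓ' m n C α β y *
        (klPhase ℓ ℓ' m n (mat M) / ((|C * (C - 1)| ^ (((2 * h : ℕ) : ℝ) / 4) : ℝ) : ℂ)) := by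
  have hℓc : (1 / (ℓ' : ℂ)) ≠ 0 := one_div_ne_zero (by exact_mod_cast hℓ'.ne')
  have hdet := det_mat M
  have hC0 : C ≠ 0 := by
    rintro rfl
    exact hM (by rw [mul_right_comm, mul_right_comm (mat M 0 0), hC]; ring)
  have hC1 : C ≠ 1 := by
    rintro rfl
    have h2 : mat M 0 1 * mat M 1 0 = 0 := by linarith
    exact hM (by rw [mul_assoc (mat M 0 0), h2]; ring)
  set f : ℝ → ℂ := fun x ↦ stripTerm h (2 * Real.pi * m / ℓ) M (line y x) *
      expMode ℓ' (-n) (line y x) with hf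
  set w := klPhase ℓ ℓ' m n (mat M) / ((|C * (C - 1)| ^ (((2 * h : ℕ) : ℝ) / 4) : ℝ) : ℂ)
  have hint := integrable_hhIntegrand hh ℓ ℓ' m n hC0 hC1 α β h0 h1
  have heq (x : ℝ) : 1 / (ℓ' : ℂ) * f (x + shift (mat M)) =
      hhIntegrand (2 * h) ℓ ℓ' m n C α β (line y x) * w := by
    simp only [hf, line_add]
    exact stripTerm_shift_mul_expMode M h ℓ ℓ' m n hM hC hα hβ (line_mem_strip h0 h1 x)
  constructor
  · have h2 : Integrable fun x ↦ 1 / (ℓ' : ℂ) * f (x + shift (mat M)) := by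
      simp only [heq]
      exact hint.mul_const w
    have h3 := (h2.const_mul (1 / (ℓ' : ℂ))⁻¹).comp_sub_right (shift (mat M))
    simpa only [inv_mul_cancel_left₀ hℓc, sub_add_cancel] using h3
  · rw [← integral_add_right_eq_self f (shift (mat M)), ← integral_const_mul]
    simp only [heq]
    rw [integral_mul_const, hhIntegral]

end Generic

/-! ### The Poincaré series as a periodic holomorphic function on the strip. -/

section Cosets

variable {Γ : Subgroup SL(2, ℝ)} {η η' : OnePoint ℝ × OnePoint ℝ} {σ σ' : SL(2, ℝ)}

variable (Γ η σ σ') in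
/-- The summand of the Poincaré series in the coordinate `u = log z`. -/
def cosetTerm (h : ℕ) (m : ℤ) (q : CosetSpace Γ η) (u : ℂ) : ℂ :=
  stripTerm h (2 * Real.pi * m / hypLength Γ σ) (σ⁻¹ * (q.out : SL(2, ℝ)) * σ') u

/-- Any representative may be used: two of them differ on the left by a sign and a matrix `expSL (j
* ℓ)`, and `stripTerm` is invariant under both. -/
theorem cosetTerm_mk (hΓ : DiscreteTopology Γ) (hη : IsHyperbolicPair Γ η)
    (hσ : IsScaling σ η) (h : ℕ) (m : ℤ) (γ : Γ) {u : ℂ} (hu : u ∈ strip) :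
    cosetTerm Γ η σ σ' h m (Quotient.mk _ γ) u =
      stripTerm h (2 * Real.pi * m / hypLength Γ σ) (σ⁻¹ * (γ : SL(2, ℝ)) * σ') u := by
  obtain ⟨j, hj⟩ := exists_expSL_mul_of_mk_eq (γ := γ)
    (γ' := (Quotient.mk _ γ : CosetSpace Γ η).out) hΓ hη hσ (Quotient.out_eq _).symm σ'
  have hℓ := hypLength_pos hΓ hη hσ
  rw [cosetTerm]
  rcases hj with hj | hj
  · rw [hj, stripTerm_expSL_mul hℓ _ _ _ _ hu]
  · rw [hj, stripTerm_neg, stripTerm_expSL_mul hℓ _ _ _ _ hu]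

/-- The Weierstrass majorant behind absolute convergence, holomorphy and termwise integration. -/
theorem exists_summable_bound_cosetTerm (hΓ : DiscreteTopology Γ) (hη : IsHyperbolicPair Γ η)
    (hσ : IsScaling σ η) {h : ℕ} (hh : 2 ≤ h) (m : ℤ) {K : Set ℂ} (hK : IsCompact K)
    (hKs : K ⊆ strip) : ∃ b : CosetSpace Γ η → ℝ, Summable b ∧
      ∀ q, ∀ u ∈ K, ‖cosetTerm Γ η σ σ' h m q u‖ ≤ b q := by
  obtain ⟨c, hc⟩ := exists_norm_stripTerm_le hh (2 * Real.pi * m / hypLength Γ σ) hK hKs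
  exact ⟨_, (summable_rowNorm hΓ hη hσ σ').mul_left c, fun q u hu ↦ hc _ u hu⟩

theorem summable_cosetTerm (hΓ : DiscreteTopology Γ) (hη : IsHyperbolicPair Γ η)
    (hσ : IsScaling σ η) {h : ℕ} (hh : 2 ≤ h) (m : ℤ) {u : ℂ} (hu : u ∈ strip) :
    Summable fun q ↦ cosetTerm Γ η σ σ' h m q u := by
  obtain ⟨b, hb, hle⟩ := exists_summable_bound_cosetTerm (σ' := σ') hΓ hη hσ hh m
    (isCompact_singleton (x := u)) (Set.singleton_subset_iff.2 hu)
  exact Summable.of_norm_bounded hb fun q ↦ hle q u rfl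

variable (Γ η σ σ') in
/-- The Poincaré series in the coordinate `u = log z`. -/
def cosetSeries (h : ℕ) (m : ℤ) (u : ℂ) : ℂ := ∑' q, cosetTerm Γ η σ σ' h m q u

theorem differentiableOn_cosetSeries (hΓ : DiscreteTopology Γ) (hη : IsHyperbolicPair Γ η)
    (hσ : IsScaling σ η) {h : ℕ} (hh : 2 ≤ h) (m : ℤ) :
    DifferentiableOn ℂ (cosetSeries Γ η σ σ' h m) strip := by
  intro u hu
  obtain ⟨ε, hε, hball⟩ := Metric.nhds_basis_closedBall.mem_iff.1 (isOpen_strip.mem_nhds hu)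
  obtain ⟨b, hb, hle⟩ := exists_summable_bound_cosetTerm (σ' := σ') hΓ hη hσ hh m
    (isCompact_closedBall u ε) hball
  have hd := Complex.differentiableOn_tsum_of_summable_norm hb
    (fun q ↦ (differentiableOn_stripTerm h _ _).mono (Metric.ball_subset_closedBall.trans hball))
    Metric.isOpen_ball fun q w hw ↦ hle q w (Metric.ball_subset_closedBall hw)
  exact (hd.differentiableAt (Metric.ball_mem_nhds u hε)).differentiableWithinAt

variable (η) in
/-- Right multiplication by an element of `Γ` on `Γ_η \ Γ`. -/
def cosetMul (τ : Γ) : CosetSpace Γ η ≃ CosetSpace Γ η where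
  toFun := Quotient.map' (· * τ) fun a b h ↦ by
    rw [QuotientGroup.rightRel_apply] at h ⊢; simpa [mul_assoc] using h
  invFun := Quotient.map' (· * τ⁻¹) fun a b h ↦ by
    rw [QuotientGroup.rightRel_apply] at h ⊢; simpa [mul_assoc] using h
  left_inv q := by
    induction q using Quotient.inductionOn'
    simp [Quotient.map'_mk'']
  right_inv q := by
    induction q using Quotient.inductionOn'
    simp [Quotient.map'_mk'']

theorem cosetMul_mk (τ γ : Γ) : cosetMul η τ (Quotient.mk _ γ) = Quotient.mk _ (γ * τ) := rfl

theorem add_mem_strip {u : ℂ} (hu : u ∈ strip) (t : ℝ) : u + t ∈ strip := by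
  simpa [strip] using hu

theorem cosetTerm_mul (hΓ : DiscreteTopology Γ) (hη : IsHyperbolicPair Γ η)
    (hσ : IsScaling σ η) (h : ℕ) (m : ℤ) (γ τ : Γ) {t : ℝ}
    (hτ : σ'⁻¹ * (τ : SL(2, ℝ)) * σ' = expSL t ∨ σ'⁻¹ * (τ : SL(2, ℝ)) * σ' = -expSL t) {u : ℂ}
    (hu : u ∈ strip) : cosetTerm Γ η σ σ' h m (Quotient.mk _ (γ * τ)) u =
      cosetTerm Γ η σ σ' h m (Quotient.mk _ γ) (u + t) := by
  have h1 : σ⁻¹ * ((γ * τ : Γ) : SL(2, ℝ)) * σ' = (σ⁻¹ * γ * σ') * (σ'⁻¹ * τ * σ') := by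
    rw [Subgroup.coe_mul]; group
  rw [cosetTerm_mk hΓ hη hσ h m _ hu, cosetTerm_mk hΓ hη hσ h m _ (add_mem_strip hu t), h1]
  rcases hτ with h2 | h2
  · rw [h2, stripTerm_mul_expSL]
  · rw [h2, mul_neg, stripTerm_neg, stripTerm_mul_expSL]

/-- Right multiplication by an element of `Γ_η'` whose conjugate is `±expSL ℓ'` permutes the cosets
and translates every summand by `ℓ'`. -/
theorem cosetSeries_periodic (hΓ : DiscreteTopology Γ) (hη : IsHyperbolicPair Γ η)
    (hσ : IsScaling σ η) (hη' : IsHyperbolicPair Γ η') (hσ' : IsScaling σ' η') (h : ℕ) (m : ℤ)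
    {u : ℂ} (hu : u ∈ strip) : cosetSeries Γ η σ σ' h m (u + hypLength Γ σ') =
      cosetSeries Γ η σ σ' h m u := by
  obtain ⟨τ, -, hτ⟩ := exists_mem_pairStabilizer hΓ hη' hσ' 1
  rw [Int.cast_one, one_mul] at hτ
  rw [cosetSeries, cosetSeries, ← (cosetMul η τ).tsum_eq (fun q ↦ cosetTerm Γ η σ σ' h m q u)]
  refine tsum_congr fun q ↦ ?_
  obtain ⟨γ, rfl⟩ := Quotient.exists_rep q
  rw [cosetMul_mk, cosetTerm_mul hΓ hη hσ h m γ τ hτ hu]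

theorem exp_mul_slash_poincareTerm (h : ℕ) (m : ℤ) (q : CosetSpace Γ η) {u : ℂ} (hu : u ∈ strip) :
    Complex.exp (h * u) * SlashAction.map ((2 * h : ℕ) : ℤ) (σ' : GL (Fin 2) ℝ)
      (poincareTerm Γ η σ (2 * h) m q) (expPoint u hu) = cosetTerm Γ η σ σ' h m q u := by
  rw [poincareTerm, ← SlashAction.slash_mul, ← map_mul, exp_mul_slash_hypMode, cosetTerm]

theorem exp_mul_slash_poincareSeries (h : ℕ) (m : ℤ) {u : ℂ} (hu : u ∈ strip) :
    Complex.exp (h * u) * SlashAction.map ((2 * h : ℕ) : ℤ) (σ' : GL (Fin 2) ℝ)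
      (poincareSeries Γ η σ (2 * h) m) (expPoint u hu) = cosetSeries Γ η σ σ' h m u := by
  rw [slash_SL_apply, poincareSeries, ← tsum_mul_right, ← tsum_mul_left, cosetSeries]
  refine tsum_congr fun q ↦ ?_
  rw [← exp_mul_slash_poincareTerm h m q hu, slash_SL_apply]

theorem summable_poincareTerm (hΓ : DiscreteTopology Γ) (hη : IsHyperbolicPair Γ η)
    (hσ : IsScaling σ η) {h : ℕ} (hh : 2 ≤ h) (m : ℤ) (z : ℍ) :
    Summable fun q ↦ poincareTerm Γ η σ (2 * h) m q z := by
  obtain ⟨u, hu, rfl⟩ := exists_expPoint z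
  refine (summable_mul_left_iff (Complex.exp_ne_zero (h * u))).1 ?_
  -- With `σ' = 1` the strip coordinate is that of `z` itself.
  refine (summable_cosetTerm (σ' := 1) hΓ hη hσ hh m hu).congr fun q ↦ ?_
  rw [← exp_mul_slash_poincareTerm h m q hu, map_one, SlashAction.slash_one]

/-- Expansions of the Poincaré series correspond to exponential expansions on the strip. -/
theorem isHypExpansion_iff (h : ℕ) (m : ℤ) (c : ℤ → ℂ) :
    IsHypExpansion Γ σ' (2 * h) (poincareSeries Γ η σ (2 * h) m) c ↔
      ∀ u ∈ strip, HasSum (fun n : ℤ ↦ c n * expMode (hypLength Γ σ') n u)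
        (cosetSeries Γ η σ σ' h m u) := by
  have key (u : ℂ) (hu : u ∈ strip) :
      HasSum (fun n : ℤ ↦ c n * hypMode (2 * h) (hypLength Γ σ') n (expPoint u hu))
        (SlashAction.map ((2 * h : ℕ) : ℤ) (σ' : GL (Fin 2) ℝ)
          (poincareSeries Γ η σ (2 * h) m) (expPoint u hu)) ↔
      HasSum (fun n : ℤ ↦ c n * expMode (hypLength Γ σ') n u) (cosetSeries Γ η σ σ' h m u) := by
    rw [← hasSum_mul_left_iff (Complex.exp_ne_zero (h * u)), exp_mul_slash_poincareSeries]
    simp only [mul_left_comm, exp_mul_hypMode]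
  constructor
  · exact fun H u hu ↦ (key u hu).1 (H _)
  · intro H z
    obtain ⟨u, hu, rfl⟩ := exists_expPoint z
    exact (key u hu).2 (H u hu)

/-- The Fourier coefficients of the Poincaré series may be computed termwise. -/
theorem hasSum_stripCoeff_cosetTerm (hΓ : DiscreteTopology Γ) (hη : IsHyperbolicPair Γ η)
    (hσ : IsScaling σ η) {h : ℕ} (hh : 2 ≤ h) (m n : ℤ) (ℓ : ℝ) {y : ℝ} (h0 : 0 < y)
    (h1 : y < Real.pi) : HasSum (fun q ↦ stripCoeff (cosetTerm Γ η σ σ' h m q) ℓ n y)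
      (stripCoeff (cosetSeries Γ η σ σ' h m) ℓ n y) := by
  -- Dominated convergence for series needs a countable index set. A summable family with no zero
  -- term has one.
  have hcount : Countable (CosetSpace Γ η) := by
    have hs := (summable_rowNorm hΓ hη hσ σ').countable_support
    refine Set.countable_univ_iff.1 (hs.mono fun q _ ↦ ?_)
    have h0 := rowNorm_pos (σ⁻¹ * (q.out : SL(2, ℝ)) * σ') 0
    have h1 := rowNorm_pos (σ⁻¹ * (q.out : SL(2, ℝ)) * σ') 1
    exact (inv_pos.2 (pow_pos (mul_pos h0 h1) 2)).ne'
  have hcompact : IsCompact (line y '' Set.uIcc 0 ℓ) := isCompact_uIcc.image (continuous_line y)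
  obtain ⟨b, hb, hle⟩ := exists_summable_bound_cosetTerm (σ' := σ') hΓ hη hσ hh m hcompact
    (by rintro _ ⟨x, -, rfl⟩; exact line_mem_strip h0 h1 x)
  have hnorm (x : ℝ) : ‖expMode ℓ (-n) (line y x)‖ = ‖expMode ℓ (-n) (line y 0)‖ := by
    rw [norm_expMode, norm_expMode, line_im, line_im]
  refine HasSum.mul_left _ (intervalIntegral.hasSum_integral_of_dominated_convergence
    (fun q _ ↦ b q * ‖expMode ℓ (-n) (line y 0)‖) (fun q ↦ ?_)
    (fun q ↦ .of_forall fun x hx ↦ ?_) (.of_forall fun _ _ ↦ hb.mul_right _)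
    intervalIntegrable_const (.of_forall fun x _ ↦ ?_))
  · exact ((continuous_comp_line (differentiableOn_stripTerm h _ _).continuousOn h0 h1).mul
      ((differentiable_expMode ℓ (-n)).continuous.comp
        (continuous_line y))).aestronglyMeasurable
  · rw [norm_mul, hnorm]
    exact mul_le_mul_of_nonneg_right (hle q _ ⟨x, Set.uIoc_subset_uIcc hx, rfl⟩) (norm_nonneg _)
  · exact (summable_cosetTerm hΓ hη hσ hh m (line_mem_strip h0 h1 x)).hasSum.mul_right _

end Cosets

/-! ### Cosets and double cosets of matrices without zero entries. -/

/-- All entries of the matrix are nonzero. -/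
def IsGeneric (A : Matrix (Fin 2) (Fin 2) ℝ) : Prop := A 0 0 * A 0 1 * A 1 0 * A 1 1 ≠ 0

theorem isGeneric_neg (M : SL(2, ℝ)) : IsGeneric (mat (-M)) ↔ IsGeneric (mat M) := by
  simp only [IsGeneric, mat_neg]; ring_nf

theorem isGeneric_expSL_mul (t : ℝ) (M : SL(2, ℝ)) :
    IsGeneric (mat (expSL t * M)) ↔ IsGeneric (mat M) := by
  simp [IsGeneric, mat_expSL_mul_zero, mat_expSL_mul_one, Real.exp_ne_zero]

theorem isGeneric_mul_expSL (t : ℝ) (M : SL(2, ℝ)) :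
    IsGeneric (mat (M * expSL t)) ↔ IsGeneric (mat M) := by
  simp [IsGeneric, mat_mul_expSL_zero, mat_mul_expSL_one, Real.exp_ne_zero]

section

variable {Γ : Subgroup SL(2, ℝ)} {η η' : OnePoint ℝ × OnePoint ℝ} {σ σ' : SL(2, ℝ)}

variable (Γ η σ σ') in
/-- The cosets whose matrices have nonzero entries. -/
def genericCosets : Set (CosetSpace Γ η) :=
  {q | IsGeneric (mat (σ⁻¹ * (q.out : SL(2, ℝ)) * σ'))}

variable (Γ η η' σ σ') in
/-- The double cosets whose matrices have nonzero entries. -/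
def genericDoubleCosets : Set (DoubleCosets Γ η η') := {D | IsGeneric (repMat σ σ' D)}

theorem conj_mul_right (γ τ : Γ) : σ⁻¹ * ((γ * τ : Γ) : SL(2, ℝ)) * σ' =
    (σ⁻¹ * γ * σ') * (σ'⁻¹ * τ * σ') := by
  rw [Subgroup.coe_mul]; group

theorem isGeneric_left (hΓ : DiscreteTopology Γ) (hη : IsHyperbolicPair Γ η)
    (hσ : IsScaling σ η) {τ : Γ} (hτ : τ ∈ pairStabilizer Γ η) (γ : Γ) :
    IsGeneric (mat (σ⁻¹ * ((τ * γ : Γ) : SL(2, ℝ)) * σ')) ↔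
      IsGeneric (mat (σ⁻¹ * (γ : SL(2, ℝ)) * σ')) := by
  obtain ⟨j, hj⟩ := exists_eq_expSL_of_mem hΓ hη hσ hτ
  rw [conj_mul]
  rcases hj with h | h
  · rw [h, isGeneric_expSL_mul]
  · rw [h, neg_mul, isGeneric_neg, isGeneric_expSL_mul]

theorem isGeneric_right (hΓ : DiscreteTopology Γ) (hη' : IsHyperbolicPair Γ η')
    (hσ' : IsScaling σ' η') {τ : Γ} (hτ : τ ∈ pairStabilizer Γ η') (γ : Γ) :
    IsGeneric (mat (σ⁻¹ * ((γ * τ : Γ) : SL(2, ℝ)) * σ')) ↔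
      IsGeneric (mat (σ⁻¹ * (γ : SL(2, ℝ)) * σ')) := by
  obtain ⟨j, hj⟩ := exists_eq_expSL_of_mem hΓ hη' hσ' hτ
  rw [conj_mul_right]
  rcases hj with h | h
  · rw [h, isGeneric_mul_expSL]
  · rw [h, mul_neg, isGeneric_neg, isGeneric_mul_expSL]

theorem mk_mem_genericCosets (hΓ : DiscreteTopology Γ) (hη : IsHyperbolicPair Γ η)
    (hσ : IsScaling σ η) (γ : Γ) : (Quotient.mk _ γ : CosetSpace Γ η) ∈ genericCosets Γ η σ σ' ↔
      IsGeneric (mat (σ⁻¹ * (γ : SL(2, ℝ)) * σ')) := by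
  have h := (mk_eq_mk_iff (η := η) γ _).1 (Quotient.out_eq (Quotient.mk _ γ : CosetSpace Γ η)).symm
  rw [genericCosets, Set.mem_ofPred_eq, ← isGeneric_left (σ' := σ') hΓ hη hσ h γ,
    inv_mul_cancel_right]

/-- The `±1`-freeness of the right action: if the cosets agree, then `M diag(e^{t/2}, e^{-t/2}) M⁻¹`
is diagonal, and its upper right entry `ab(e^{-t/2} - e^{t/2})` vanishes only for `t = 0`, since `ab
≠ 0`. -/
theorem mk_mul_eq_iff (hΓ : DiscreteTopology Γ)
    (hσ : IsScaling σ η) (hη' : IsHyperbolicPair Γ η') (hσ' : IsScaling σ' η') {γ : Γ}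
    (hγ : IsGeneric (mat (σ⁻¹ * (γ : SL(2, ℝ)) * σ'))) {τ τ' : Γ}
    (hτ : τ' * τ⁻¹ ∈ pairStabilizer Γ η') :
    (Quotient.mk _ (γ * τ) : CosetSpace Γ η) = Quotient.mk _ (γ * τ') ↔
      σ'⁻¹ * ((τ' * τ⁻¹ : Γ) : SL(2, ℝ)) * σ' = 1 ∨ σ'⁻¹ * ((τ' * τ⁻¹ : Γ) : SL(2, ℝ)) * σ' = -1 := by
  obtain ⟨j, hj⟩ := exists_eq_expSL_of_mem hΓ hη' hσ' hτ
  set M := σ⁻¹ * (γ : SL(2, ℝ)) * σ' with hM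
  have h1 : σ⁻¹ * ((γ * τ' * (γ * τ)⁻¹ : Γ) : SL(2, ℝ)) * σ =
      M * (σ'⁻¹ * ((τ' * τ⁻¹ : Γ) : SL(2, ℝ)) * σ') * M⁻¹ := by
    simp only [Subgroup.coe_mul, Subgroup.coe_inv, hM]; group
  rw [mk_eq_mk_iff, mem_pairStabilizer_iff hσ, h1]
  set X := σ'⁻¹ * ((τ' * τ⁻¹ : Γ) : SL(2, ℝ)) * σ'
  constructor
  · rintro ⟨h2, -⟩
    obtain ⟨e1, e2, e3, e4⟩ := mat_inv M
    have hab : mat M 0 0 * mat M 0 1 ≠ 0 := fun h ↦ hγ (by simp only [h, zero_mul])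
    set t := (j : ℝ) * hypLength Γ σ' with ht
    have h3 : mat (M * expSL t * M⁻¹) 0 1 = 0 := by
      rcases hj with hj | hj
      · rwa [hj] at h2
      · rwa [hj, mul_neg, neg_mul, mat_neg, neg_eq_zero] at h2
    rw [mat_mul, mat_mul_expSL_zero, mat_mul_expSL_one, e2, e4] at h3
    have h4 : mat M 0 0 * mat M 0 1 * (Real.exp (-(t / 2)) - Real.exp (t / 2)) = 0 := by linarith
    have h5 := Real.exp_injective (sub_eq_zero.1 ((mul_eq_zero.1 h4).resolve_left hab))
    have h6 : t = 0 := by linarith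
    rwa [h6, expSL_zero] at hj
  · rintro (h | h)
    · rw [h]; simp [mat]
    · rw [h]; simp [mat]

/-- The fibres of `Γ_η \ Γ → Γ_η \ Γ / Γ_η'` over the double cosets of matrices with nonzero
entries are parametrized by `ℤ`. -/
theorem exists_genericEquiv (hΓ : DiscreteTopology Γ) (hη : IsHyperbolicPair Γ η)
    (hσ : IsScaling σ η) (hη' : IsHyperbolicPair Γ η') (hσ' : IsScaling σ' η') :
    ∃ (τ : ℤ → Γ) (e : genericDoubleCosets Γ η η' σ σ' × ℤ ≃ genericCosets Γ η σ σ'),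
      (∀ j, σ'⁻¹ * (τ j : SL(2, ℝ)) * σ' = expSL (j * hypLength Γ σ') ∨
        σ'⁻¹ * (τ j : SL(2, ℝ)) * σ' = -expSL (j * hypLength Γ σ')) ∧
      ∀ D j, (e (D, j) : CosetSpace Γ η) = Quotient.mk _ (Quotient.out D.1 * τ j) := by
  choose τ hτ hτe using exists_mem_pairStabilizer hΓ hη' hσ'
  have hℓ := hypLength_pos hΓ hη' hσ'
  have hmem (D : genericDoubleCosets Γ η η' σ σ') (j : ℤ) :
      (Quotient.mk _ (Quotient.out D.1 * τ j) : CosetSpace Γ η) ∈ genericCosets Γ η σ σ' := by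
    rw [mk_mem_genericCosets hΓ hη hσ, isGeneric_right hΓ hη' hσ' (hτ j)]
    exact D.2
  let f : genericDoubleCosets Γ η η' σ σ' × ℤ → genericCosets Γ η σ σ' := fun p ↦ ⟨_, hmem p.1 p.2⟩
  have hf : Function.Bijective f := by
    constructor
    · rintro ⟨D, i⟩ ⟨D', j⟩ h
      have h1 : (Quotient.mk _ (Quotient.out D.1 * τ i) : CosetSpace Γ η) =
        Quotient.mk _ (Quotient.out D'.1 * τ j) := congrArg Subtype.val h
      have hD : D = D' := by
        apply Subtype.ext
        rw [← DoubleCoset.out_eq' _ _ D.1, ← DoubleCoset.out_eq' _ _ D'.1, DoubleCoset.eq]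
        refine ⟨_, (mk_eq_mk_iff _ _).1 h1, τ i * (τ j)⁻¹,
          mul_mem (hτ i) (inv_mem (hτ j)), ?_⟩
        group
      subst hD
      have h2 := (mk_mul_eq_iff hΓ hσ hη' hσ' D.2 (mul_mem (hτ j) (inv_mem (hτ i)))).1 h1
      have h3 : σ'⁻¹ * ((τ j * (τ i)⁻¹ : Γ) : SL(2, ℝ)) * σ' =
          (σ'⁻¹ * τ j * σ') * (σ'⁻¹ * τ i * σ')⁻¹ := by
        simp only [Subgroup.coe_mul, Subgroup.coe_inv]; group
      rw [h3] at h2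
      -- `τ_j τ_i⁻¹` corresponds to `±expSL ((j - i) ℓ')`. It is `±1` only for `i = j`, the
      -- exponential entries being positive.
      have h4 : expSL (j * hypLength Γ σ' + -(i * hypLength Γ σ')) = 1 ∨
          expSL (j * hypLength Γ σ' + -(i * hypLength Γ σ')) = -1 := by
        rw [expSL_add, expSL_neg]
        rcases hτe i with e1 | e1 <;> rcases hτe j with e2 | e2 <;> rw [e1, e2] at h2 <;>
          simpa [neg_eq_iff_eq_neg, or_comm, -mul_inv_rev] using h2
      have h5 : Real.exp ((j * hypLength Γ σ' + -(i * hypLength Γ σ')) / 2) = 1 := by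
        rcases h4 with h4 | h4
        · have := congrArg (fun g ↦ mat g 0 0) h4
          simpa [mat_expSL, expDiag, mat] using this
        · have := congrArg (fun g ↦ mat g 0 0) h4
          simp only [mat_expSL, mat_neg] at this
          simp only [expDiag, Matrix.of_apply, Matrix.cons_val', Matrix.cons_val_zero, mat,
            Matrix.SpecialLinearGroup.coe_one, Matrix.one_apply_eq, Matrix.cons_val_fin_one] at this
          have := Real.exp_pos ((j * hypLength Γ σ' + -(i * hypLength Γ σ')) / 2)
          linarith
      rw [Real.exp_eq_one_iff] at h5
      have h6 : ((j : ℝ) - i) * hypLength Γ σ' = 0 := by linarith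
      have h7 : (j : ℝ) = i := sub_eq_zero.1 ((mul_eq_zero.1 h6).resolve_right hℓ.ne')
      rw [show i = j by exact_mod_cast h7.symm]
    · rintro ⟨q, hq⟩
      obtain ⟨γ, rfl⟩ := Quotient.exists_rep q
      obtain ⟨x, y, hx, hy, hxy⟩ := DoubleCoset.mk_out_eq_mul (pairStabilizer Γ η)
        (pairStabilizer Γ η') γ
      set D : DoubleCosets Γ η η' := DoubleCoset.mk (pairStabilizer Γ η) (pairStabilizer Γ η') γ
      have hD : D ∈ genericDoubleCosets Γ η η' σ σ' := by
        change IsGeneric (mat (σ⁻¹ * ((Quotient.out D : Γ) : SL(2, ℝ)) * σ'))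
        rw [hxy, isGeneric_right hΓ hη' hσ' hy, isGeneric_left hΓ hη hσ hx]
        exact (mk_mem_genericCosets hΓ hη hσ γ).1 hq
      -- The chosen representative of the double coset is `x γ y`, so `γ` lies in the coset of that
      -- representative times `y⁻¹`, and `y⁻¹` agrees with some `τ_j` up to sign.
      obtain ⟨j, hj⟩ := exists_eq_expSL_of_mem hΓ hη' hσ' (inv_mem hy)
      refine ⟨(⟨D, hD⟩, j), Subtype.ext ?_⟩
      have h1 : (Quotient.mk _ γ : CosetSpace Γ η) = Quotient.mk _ (Quotient.out D * y⁻¹) := by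
        rw [mk_eq_mk_iff, hxy]
        simpa [mul_assoc] using hx
      change (Quotient.mk _ (Quotient.out D * τ j) : CosetSpace Γ η) = Quotient.mk _ γ
      rw [h1, mk_mul_eq_iff hΓ hσ hη' hσ' hD (mul_mem (inv_mem hy) (inv_mem (hτ j)))]
      have h3 : σ'⁻¹ * ((y⁻¹ * (τ j)⁻¹ : Γ) : SL(2, ℝ)) * σ' =
          (σ'⁻¹ * ((y⁻¹ : Γ) : SL(2, ℝ)) * σ') * (σ'⁻¹ * τ j * σ')⁻¹ := by
        simp only [Subgroup.coe_mul, Subgroup.coe_inv]; group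
      rw [h3]
      rcases hτe j with e1 | e1 <;> rcases hj with e2 | e2 <;> rw [e1, e2] <;> simp
  exact ⟨τ, Equiv.ofBijective f hf, hτe, fun D j ↦ rfl⟩

/-! ### Finiteness of the Kloosterman sums. -/

theorem le_one_add_pow_four (x : ℝ) : |x| ≤ 1 + x ^ 4 := by
  have h : |x| ^ 4 = x ^ 4 := by rw [show 4 = 2 * 2 by norm_num, pow_mul, pow_mul, sq_abs]
  rw [← h]
  nlinarith [sq_nonneg (|x| ^ 2 - 1 / 2), sq_nonneg (|x| - 1 / 2)]

/-- With `x = |ab/cd|` and `z = |ac/bd|`, the relations `xz = (a/d)²`, `x/z = (b/c)²` and `bc = ad -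
1` give `a⁴ = (ad)² xz`, `b⁴ = (ad - 1)² x/z` and similarly for `c` and `d`. So `ad` together with
bounds on `x` and `z` bounds all entries; `|t| ≤ 1 + t⁴` avoids fourth roots. -/
theorem size_le_of_ratio_le {M : SL(2, ℝ)} (hM : IsGeneric (mat M)) {X Z : ℝ}
    (h1 : 1 ≤ |mat M 0 0 * mat M 0 1 / (mat M 1 0 * mat M 1 1)|)
    (h1' : |mat M 0 0 * mat M 0 1 / (mat M 1 0 * mat M 1 1)| ≤ X)
    (h2 : 1 ≤ |mat M 0 0 * mat M 1 0 / (mat M 0 1 * mat M 1 1)|)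
    (h2' : |mat M 0 0 * mat M 1 0 / (mat M 0 1 * mat M 1 1)| ≤ Z) :
    size M ≤ 4 + (mat M 0 0 * mat M 1 1) ^ 2 * (X * Z + 1) +
      (mat M 0 0 * mat M 1 1 - 1) ^ 2 * (X + Z) := by
  have hdet := det_mat M
  unfold IsGeneric at hM
  unfold size rowNorm
  set a := mat M 0 0
  set b := mat M 0 1
  set c := mat M 1 0
  set d := mat M 1 1
  have ha : a ≠ 0 := by rintro h; simp [h] at hM
  have hb : b ≠ 0 := by rintro h; simp [h] at hM
  have hc : c ≠ 0 := by rintro h; simp [h] at hM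
  have hd : d ≠ 0 := by rintro h; simp [h] at hM
  set x := |a * b / (c * d)| with hx
  set z := |a * c / (b * d)| with hz
  have hbc : a * d - 1 = b * c := by linarith
  have hxz : x * z = a ^ 2 / d ^ 2 := by
    rw [hx, hz, ← abs_mul, show a * b / (c * d) * (a * c / (b * d)) = a ^ 2 / d ^ 2 by field_simp]
    exact abs_of_nonneg (by positivity)
  have hzx : x / z = b ^ 2 / c ^ 2 := by
    rw [hx, hz, ← abs_div, show a * b / (c * d) / (a * c / (b * d)) = b ^ 2 / c ^ 2 by field_simp]
    exact abs_of_nonneg (by positivity)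
  have hx0 : 0 < x := by linarith
  have hz0 : 0 < z := by linarith
  have hX0 : 0 < X := by linarith
  have ea : a ^ 4 ≤ (a * d) ^ 2 * (X * Z) := by
    have : a ^ 4 = (a * d) ^ 2 * (x * z) := by rw [hxz]; field_simp
    rw [this]; gcongr
  have ed : d ^ 4 ≤ (a * d) ^ 2 := by
    have h3 : d ^ 2 ≤ a ^ 2 := by
      have : 1 ≤ a ^ 2 / d ^ 2 := by rw [← hxz]; nlinarith
      rwa [le_div_iff₀ (by positivity), one_mul] at this
    nlinarith [sq_nonneg d]
  have eb : b ^ 4 ≤ (a * d - 1) ^ 2 * X := by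
    have : b ^ 4 = (b * c) ^ 2 * (x / z) := by rw [hzx]; field_simp
    rw [this, hbc]
    gcongr
    exact (div_le_self hx0.le h2).trans h1'
  have ec : c ^ 4 ≤ (a * d - 1) ^ 2 * Z := by
    have : c ^ 4 = (b * c) ^ 2 * (z / x) := by rw [← inv_div x z, hzx]; field_simp
    rw [this, hbc]
    gcongr
    exact (div_le_self hz0.le h1).trans h2'
  have := le_one_add_pow_four a
  have := le_one_add_pow_four b
  have := le_one_add_pow_four c
  have := le_one_add_pow_four d
  linarith

/-- There are finitely many double cosets of matrices with nonzero entries and given product of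
the diagonal entries. -/
theorem finite_doubleCosets (hΓ : DiscreteTopology Γ) (hη : IsHyperbolicPair Γ η)
    (hσ : IsScaling σ η) (hη' : IsHyperbolicPair Γ η') (hσ' : IsScaling σ' η') (C : ℝ) :
    {D : DoubleCosets Γ η η' | IsGeneric (repMat σ σ' D) ∧
      repMat σ σ' D 0 0 * repMat σ σ' D 1 1 = C}.Finite := by
  have hℓ := hypLength_pos hΓ hη hσ
  have hℓ' := hypLength_pos hΓ hη' hσ'
  set ℓ := hypLength Γ σ
  set ℓ' := hypLength Γ σ'
  set R := 4 + C ^ 2 * (Real.exp (2 * ℓ) * Real.exp (2 * ℓ') + 1) +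
      (C - 1) ^ 2 * (Real.exp (2 * ℓ) + Real.exp (2 * ℓ'))
  refine ((finite_size_translate_le hΓ σ⁻¹ σ' R).image
    (DoubleCoset.mk (pairStabilizer Γ η) (pairStabilizer Γ η'))).subset ?_
  rintro D ⟨hgen, hC⟩
  set γ := Quotient.out D with hγ
  set M := σ⁻¹ * ((γ : Γ) : SL(2, ℝ)) * σ' with hM
  change IsGeneric (mat M) at hgen
  change mat M 0 0 * mat M 1 1 = C at hC
  have hgen' := hgen
  unfold IsGeneric at hgen'
  have ha : mat M 0 0 ≠ 0 := by rintro h; simp [h] at hgen'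
  have hb : mat M 0 1 ≠ 0 := by rintro h; simp [h] at hgen'
  have hc : mat M 1 0 ≠ 0 := by rintro h; simp [h] at hgen'
  have hd : mat M 1 1 ≠ 0 := by rintro h; simp [h] at hgen'
  -- Left multiplication by `expSL (i * ℓ)` multiplies `ab/cd` by `e^{2iℓ}` and keeps `ac/bd`; right
  -- multiplication by `expSL (j * ℓ')` does the opposite with `e^{2jℓ'}`. Both keep `ad`. Hence the
  -- periods `2ℓ` and `2ℓ'`.
  obtain ⟨i, hi1, hi2⟩ := exists_int_exp_mul_mem (ℓ := 2 * ℓ) (by linarith)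
    (abs_pos.2 (div_ne_zero (mul_ne_zero ha hb) (mul_ne_zero hc hd)))
  obtain ⟨j, hj1, hj2⟩ := exists_int_exp_mul_mem (ℓ := 2 * ℓ') (by linarith)
    (abs_pos.2 (div_ne_zero (mul_ne_zero ha hc) (mul_ne_zero hb hd)))
  obtain ⟨τ, hτ, hτe⟩ := exists_mem_pairStabilizer hΓ hη hσ i
  obtain ⟨τ', hτ', hτe'⟩ := exists_mem_pairStabilizer hΓ hη' hσ' j
  refine ⟨τ * γ * τ', ?_, ?_⟩
  · change size (σ⁻¹ * ((τ * γ * τ' : Γ) : SL(2, ℝ)) * σ') ≤ R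
    have hs : size (σ⁻¹ * ((τ * γ * τ' : Γ) : SL(2, ℝ)) * σ') =
        size (expSL (i * ℓ) * M * expSL (j * ℓ')) := by
      rw [conj_mul_right, conj_mul]
      rcases hτe with h | h <;> rcases hτe' with h' | h' <;> rw [h, h'] <;>
        simp [size_neg, ℓ, ℓ', hM]
    rw [hs]
    set p := Real.exp (i * ℓ / 2) with hp
    set r := Real.exp (j * ℓ' / 2) with hr
    have hp0 : 0 < p := Real.exp_pos _
    have hr0 : 0 < r := Real.exp_pos _
    have e00 : mat (expSL (i * ℓ) * M * expSL (j * ℓ')) 0 0 = p * mat M 0 0 * r := by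
      rw [mat_mul_expSL_zero, mat_expSL_mul_zero]
    have e01 : mat (expSL (i * ℓ) * M * expSL (j * ℓ')) 0 1 = p * mat M 0 1 * r⁻¹ := by
      rw [mat_mul_expSL_one, mat_expSL_mul_zero, Real.exp_neg]
    have e10 : mat (expSL (i * ℓ) * M * expSL (j * ℓ')) 1 0 = p⁻¹ * mat M 1 0 * r := by
      rw [mat_mul_expSL_zero, mat_expSL_mul_one, Real.exp_neg]
    have e11 : mat (expSL (i * ℓ) * M * expSL (j * ℓ')) 1 1 = p⁻¹ * mat M 1 1 * r⁻¹ := by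
      rw [mat_mul_expSL_one, mat_expSL_mul_one, Real.exp_neg, Real.exp_neg]
    have hp4 : Real.exp (i * (2 * ℓ)) = p ^ 4 := by
      rw [hp, ← Real.exp_nat_mul]; congr 1; push_cast; ring
    have hr4 : Real.exp (j * (2 * ℓ')) = r ^ 4 := by
      rw [hr, ← Real.exp_nat_mul]; congr 1; push_cast; ring
    have q1 : |p * mat M 0 0 * r * (p * mat M 0 1 * r⁻¹) /
        (p⁻¹ * mat M 1 0 * r * (p⁻¹ * mat M 1 1 * r⁻¹))| =
        Real.exp (i * (2 * ℓ)) * |mat M 0 0 * mat M 0 1 / (mat M 1 0 * mat M 1 1)| := by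
      have h : |p ^ 4 * (mat M 0 0 * mat M 0 1 / (mat M 1 0 * mat M 1 1))| = p ^ 4 * |mat M 0 0 * mat M 0 1 / (mat M 1 0 * mat M 1 1)| := by
        rw [abs_mul, abs_of_pos (pow_pos hp0 4)]
      rw [hp4, ← h]
      congr 1; field_simp
    have q2 : |p * mat M 0 0 * r * (p⁻¹ * mat M 1 0 * r) /
        (p * mat M 0 1 * r⁻¹ * (p⁻¹ * mat M 1 1 * r⁻¹))| =
        Real.exp (j * (2 * ℓ')) * |mat M 0 0 * mat M 1 0 / (mat M 0 1 * mat M 1 1)| := by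
      have h : |r ^ 4 * (mat M 0 0 * mat M 1 0 / (mat M 0 1 * mat M 1 1))| = r ^ 4 * |mat M 0 0 * mat M 1 0 / (mat M 0 1 * mat M 1 1)| := by
        rw [abs_mul, abs_of_pos (pow_pos hr0 4)]
      rw [hr4, ← h]
      congr 1; field_simp
    have hCC : p * mat M 0 0 * r * (p⁻¹ * mat M 1 1 * r⁻¹) = C := by
      rw [← hC]; field_simp
    have hfin := size_le_of_ratio_le (M := expSL (i * ℓ) * M * expSL (j * ℓ'))
      (X := Real.exp (2 * ℓ)) (Z := Real.exp (2 * ℓ'))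
      ((isGeneric_mul_expSL _ _).2 ((isGeneric_expSL_mul _ _).2 hgen))
    rw [e00, e01, e10, e11, q1, q2, hCC] at hfin
    exact hfin hi1 hi2 hj1 hj2
  · rw [← DoubleCoset.out_eq' _ _ D, eq_comm, DoubleCoset.eq]
    exact ⟨τ, hτ, τ', hτ', rfl⟩

theorem ne_of_mem_cSet {C : ℝ} (hC : C ∈ cSet Γ σ σ') : C ≠ 0 ∧ C ≠ 1 := by
  obtain ⟨γ, -, hγ, hγC⟩ := hC
  have hdet := det_mat (σ⁻¹ * (γ : SL(2, ℝ)) * σ')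
  constructor
  · rw [← hγC]
    intro h
    exact hγ (by rw [mul_right_comm, mul_right_comm (mat _ 0 0), h]; ring)
  · intro h
    rw [h] at hγC
    have h4 : mat (σ⁻¹ * γ * σ') 0 1 * mat (σ⁻¹ * γ * σ') 1 0 = 0 := by linarith
    exact hγ (by rw [mul_assoc (mat (σ⁻¹ * γ * σ') 0 0), h4]; ring)

/-- The sign condition gives `ac ≠ 0`, while `C ≠ 1` gives `bc = C - 1 ≠ 0` and `C ≠ 0` gives `d ≠
0`. -/
theorem kloostermanIndex_isGeneric {C : ℝ} (hC : C ∈ cSet Γ σ σ') {α β : ℤˣ}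
    {D : DoubleCosets Γ η η'} (hD : D ∈ kloostermanIndex Γ η η' σ σ' C α β) :
    IsGeneric (repMat σ σ' D) := by
  obtain ⟨h1, h2, -⟩ := hD
  obtain ⟨hC0, hC1⟩ := ne_of_mem_cSet hC
  have hdet' : repMat σ σ' D 0 0 * repMat σ σ' D 1 1 - repMat σ σ' D 0 1 * repMat σ σ' D 1 0 = 1 :=
    det_mat _
  have hα : ((α : ℤ) : ℝ) ≠ 0 := fun h ↦ by have := abs_unit_cast α; rw [h] at this; simp at this
  have hac : repMat σ σ' D 0 0 * repMat σ σ' D 1 0 ≠ 0 := fun h ↦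
    hα (by rw [← h2, h, Real.sign_zero])
  have hbc : repMat σ σ' D 0 1 * repMat σ σ' D 1 0 ≠ 0 := fun h ↦ hC1 (by rw [← h1]; linarith)
  have hd : repMat σ σ' D 1 1 ≠ 0 := fun h ↦ hC0 (by rw [← h1, h, mul_zero])
  unfold IsGeneric
  rw [mul_assoc (repMat σ σ' D 0 0)]
  exact mul_ne_zero (mul_ne_zero (left_ne_zero_of_mul hac) hbc) hd

theorem finite_kloostermanIndex (hΓ : DiscreteTopology Γ) (hη : IsHyperbolicPair Γ η)
    (hσ : IsScaling σ η) (hη' : IsHyperbolicPair Γ η') (hσ' : IsScaling σ' η') {C : ℝ}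
    (hC : C ∈ cSet Γ σ σ') (α β : ℤˣ) : (kloostermanIndex Γ η η' σ σ' C α β).Finite :=
  (finite_doubleCosets hΓ hη hσ hη' hσ' C).subset fun _ hD ↦
    ⟨kloostermanIndex_isGeneric hC hD, hD.1⟩

/-! ### Elements carrying `η'` to `η` or to the reversed pair. -/

theorem actPair_mul (g g' : SL(2, ℝ)) (ξ : OnePoint ℝ × OnePoint ℝ) :
    actPair (g * g') ξ = actPair g (actPair g' ξ) := by
  simp only [actPair, map_mul, mul_smul]

theorem actPair_eq_iff_of_isScaling (hσ : IsScaling σ η) (hσ' : IsScaling σ' η') (γ : SL(2, ℝ)) :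
    actPair γ η' = η ↔ mat (σ⁻¹ * γ * σ') 0 1 = 0 ∧ mat (σ⁻¹ * γ * σ') 1 0 = 0 := by
  rw [← fixes_iff, ← hσ, ← hσ', actPair_mul, actPair_mul]
  constructor
  · intro h
    rw [h, ← actPair_mul, inv_mul_cancel]
    simp [actPair]
  · intro h
    have h2 := congrArg (actPair σ) h
    rwa [← actPair_mul, mul_inv_cancel, actPair, map_one, one_smul] at h2

/-- The matrix `(0 1; -1 0)`. -/
def weyl : SL(2, ℝ) := ⟨!![0, 1; -1, 0], by simp⟩

theorem isScaling_mul_weyl (hσ : IsScaling σ η) : IsScaling (σ * weyl) η.swap := by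
  have h : actPair weyl (((0 : ℝ) : OnePoint ℝ), OnePoint.infty) =
      (OnePoint.infty, ((0 : ℝ) : OnePoint ℝ)) := by
    simp only [actPair, Prod.smul_mk, OnePoint.smul_some_eq_ite, OnePoint.smul_infty_eq_ite]
    change ((if weyl.1 1 0 * 0 + weyl.1 1 1 = 0 then OnePoint.infty else
      ((_ : ℝ) : OnePoint ℝ)), (if weyl.1 1 0 = 0 then OnePoint.infty else
      ((weyl.1 0 0 / weyl.1 1 0 : ℝ) : OnePoint ℝ))) = _
    simp [weyl]
  rw [IsScaling, actPair_mul, h, ← hσ]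
  rfl

/-- Reduces to the diagonal case: `σ * weyl` is a scaling matrix for the reversed pair, and `weyl⁻¹`
interchanges the rows up to sign. -/
theorem actPair_eq_swap_iff (hσ : IsScaling σ η) (hσ' : IsScaling σ' η') (γ : SL(2, ℝ)) :
    actPair γ η' = η.swap ↔ mat (σ⁻¹ * γ * σ') 0 0 = 0 ∧ mat (σ⁻¹ * γ * σ') 1 1 = 0 := by
  rw [actPair_eq_iff_of_isScaling (isScaling_mul_weyl hσ) hσ',
    show (σ * weyl)⁻¹ * γ * σ' = weyl⁻¹ * (σ⁻¹ * γ * σ') by group,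
    mat_mul weyl⁻¹ (σ⁻¹ * γ * σ') 0 1, mat_mul weyl⁻¹ (σ⁻¹ * γ * σ') 1 0]
  obtain ⟨e1, e2, e3, e4⟩ := mat_inv weyl
  have w00 : mat weyl 0 0 = 0 := rfl
  have w01 : mat weyl 0 1 = 1 := rfl
  have w10 : mat weyl 1 0 = -1 := rfl
  have w11 : mat weyl 1 1 = 0 := rfl
  rw [e1, e2, e3, e4, w00, w01, w10, w11]
  simp only [zero_mul, neg_neg, one_mul, add_zero, zero_add, neg_mul, neg_eq_zero]
  exact and_comm

theorem exists_isDiagParam (hσ : IsScaling σ η) (hσ' : IsScaling σ' η') :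
    ∃ a, IsDiagParam Γ η η' σ σ' a := by
  by_cases h : PairEquiv Γ η' η
  · obtain ⟨δ, hδ, he⟩ := h
    obtain ⟨h1, h2⟩ := (actPair_eq_iff_of_isScaling hσ hσ' δ).1 he
    have hd := det_mat (σ⁻¹ * δ * σ')
    rw [h1, zero_mul, sub_zero] at hd
    have ha : mat (σ⁻¹ * δ * σ') 0 0 ≠ 0 := by rintro h; simp [h] at hd
    refine ⟨mat (σ⁻¹ * δ * σ') 0 0, ha, fun _ ↦ ⟨δ, hδ, ?_⟩⟩
    nth_rewrite 1 [Matrix.eta_fin_two (mat (σ⁻¹ * δ * σ'))]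
    rw [h1, h2, one_div, ← eq_inv_of_mul_eq_one_right hd]
  · exact ⟨1, one_ne_zero, fun h' ↦ absurd h' h⟩

theorem exists_isAntidiagParam (hσ : IsScaling σ η) (hσ' : IsScaling σ' η') :
    ∃ b, IsAntidiagParam Γ η η' σ σ' b := by
  by_cases h : PairEquiv Γ η' η.swap
  · obtain ⟨δ, hδ, he⟩ := h
    obtain ⟨h1, h2⟩ := (actPair_eq_swap_iff hσ hσ' δ).1 he
    have hd := det_mat (σ⁻¹ * δ * σ')
    rw [h1, zero_mul, zero_sub] at hd
    have hb : mat (σ⁻¹ * δ * σ') 0 1 ≠ 0 := by rintro h; simp [h] at hd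
    refine ⟨mat (σ⁻¹ * δ * σ') 0 1, hb, fun _ ↦ ⟨δ, hδ, ?_⟩⟩
    have hc : mat (σ⁻¹ * δ * σ') 1 0 = -(1 / mat (σ⁻¹ * δ * σ') 0 1) := by
      field_simp; linarith
    nth_rewrite 1 [Matrix.eta_fin_two (mat (σ⁻¹ * δ * σ'))]
    rw [h1, h2, hc]
  · exact ⟨1, one_ne_zero, fun h' ↦ absurd h' h⟩

end

/-! ### Assembly of the Fourier coefficient. -/

section

variable {Γ : Subgroup SL(2, ℝ)} {η η' ξ : OnePoint ℝ × OnePoint ℝ} {σ σ' : SL(2, ℝ)}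

variable (Γ η η' ξ) in
/-- The cosets of the elements that map the pair `η'` to `ξ`. -/
def mappingCosets : Set (CosetSpace Γ η) := {q | actPair (q.out : SL(2, ℝ)) η' = ξ}

theorem mem_pairStabilizer_of_actPair (hξ : ξ = η ∨ ξ = η.swap) {γ : Γ}
    (h : actPair γ ξ = ξ) : γ ∈ pairStabilizer Γ η := by
  rcases hξ with rfl | rfl
  · exact h
  · exact congrArg Prod.swap h

theorem actPair_of_mem_pairStabilizer (hξ : ξ = η ∨ ξ = η.swap) {γ : Γ}
    (h : γ ∈ pairStabilizer Γ η) : actPair γ ξ = ξ := by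
  rcases hξ with rfl | rfl
  · exact h
  · have h' : actPair γ η = η := h
    exact congrArg Prod.swap h'

theorem actPair_one (ζ : OnePoint ℝ × OnePoint ℝ) : actPair 1 ζ = ζ := by
  rw [actPair, map_one, one_smul]

theorem actPair_inv_eq {γ : SL(2, ℝ)} {ζ ζ' : OnePoint ℝ × OnePoint ℝ} (h : actPair γ ζ = ζ') :
    actPair γ⁻¹ ζ' = ζ := by
  rw [← h, ← actPair_mul, inv_mul_cancel, actPair_one]

/-- Two elements carrying `η'` to `ξ` differ on the left by an element fixing `ξ`, and fixing `η` or
its reversal amounts to lying in `Γ_η`. -/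
theorem mappingCosets_eq_singleton (hξ : ξ = η ∨ ξ = η.swap) {δ : Γ} (hδ : actPair δ η' = ξ) :
    mappingCosets Γ η η' ξ = {Quotient.mk _ δ} := by
  ext q
  rw [Set.mem_singleton_iff]
  constructor
  · intro hq
    have hq' : actPair (q.out : SL(2, ℝ)) η' = ξ := hq
    rw [← Quotient.out_eq q, mk_eq_mk_iff]
    refine mem_pairStabilizer_of_actPair hξ ?_
    rw [Subgroup.coe_mul, Subgroup.coe_inv, actPair_mul, actPair_inv_eq hq', hδ]
  · rintro rfl
    have h1 := (mk_eq_mk_iff (η := η) δ _).1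
      (Quotient.out_eq (Quotient.mk _ δ : CosetSpace Γ η)).symm
    have h2 := actPair_of_mem_pairStabilizer hξ h1
    rw [← hδ, ← actPair_mul, ← Subgroup.coe_mul, inv_mul_cancel_right] at h2
    exact h2.trans hδ

theorem mappingCosets_eq_empty (h : ¬ PairEquiv Γ η' ξ) : mappingCosets Γ η η' ξ = ∅ :=
  Set.eq_empty_of_forall_notMem fun q hq ↦ h ⟨_, q.out.2, hq⟩

theorem tsum_mappingCosets_diag (hΓ : DiscreteTopology Γ) (hη : IsHyperbolicPair Γ η)
    (hσ : IsScaling σ η) (hη' : IsHyperbolicPair Γ η') (hσ' : IsScaling σ' η') (h : ℕ) (m n : ℤ)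
    {y a : ℝ} (h0 : 0 < y) (h1 : y < Real.pi) (ha : IsDiagParam Γ η η' σ σ' a) :
    ∑' q : mappingCosets Γ η η' η,
        stripCoeff (cosetTerm Γ η σ σ' h m q) (hypLength Γ σ') n y =
      extraDiag Γ η η' (hypLength Γ σ') m n a := by
  rw [extraDiag]
  by_cases hP : PairEquiv Γ η' η
  · obtain ⟨ha0, hex⟩ := ha
    obtain ⟨δ, hδ, hM⟩ := hex hP
    have h01 : mat (σ⁻¹ * δ * σ') 0 1 = 0 := by rw [hM]; rfl
    have h10 : mat (σ⁻¹ * δ * σ') 1 0 = 0 := by rw [hM]; rfl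
    have hact := (actPair_eq_iff_of_isScaling hσ hσ' δ).2 ⟨h01, h10⟩
    rw [mappingCosets_eq_singleton (δ := ⟨δ, hδ⟩) (Or.inl rfl) hact,
      tsum_singleton (f := fun q ↦ stripCoeff (cosetTerm Γ η σ σ' h m q) (hypLength Γ σ') n y),
      stripCoeff_congr (fun u hu ↦ by
        rw [cosetTerm_mk hΓ hη hσ h m ⟨δ, hδ⟩ hu, hypLength_eq_of_diag hδ h01 h10,
          stripTerm_diag h _ m ha0 hM hu]) _ _ h0 h1,
      stripCoeff_expMode (hypLength_pos hΓ hη' hσ')]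
    by_cases hn : n = m
    · subst hn; rw [if_pos rfl, if_pos ⟨hP, rfl⟩]
    · rw [if_neg hn, if_neg fun h ↦ hn h.2]
  · rw [mappingCosets_eq_empty hP, if_neg fun h ↦ hP h.1]
    exact tsum_empty

theorem tsum_mappingCosets_antidiag (hΓ : DiscreteTopology Γ) (hη : IsHyperbolicPair Γ η)
    (hσ : IsScaling σ η) (hη' : IsHyperbolicPair Γ η') (hσ' : IsScaling σ' η') (h : ℕ) (m n : ℤ)
    {y b : ℝ} (h0 : 0 < y) (h1 : y < Real.pi) (hb : IsAntidiagParam Γ η η' σ σ' b) :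
    ∑' q : mappingCosets Γ η η' η.swap,
        stripCoeff (cosetTerm Γ η σ σ' h m q) (hypLength Γ σ') n y =
      extraAntidiag Γ η η' (2 * h) (hypLength Γ σ') m n b := by
  rw [extraAntidiag, Nat.mul_div_cancel_left h two_pos]
  by_cases hP : PairEquiv Γ η' η.swap
  · obtain ⟨hb0, hex⟩ := hb
    obtain ⟨δ, hδ, hM⟩ := hex hP
    have h00 : mat (σ⁻¹ * δ * σ') 0 0 = 0 := by rw [hM]; rfl
    have h11 : mat (σ⁻¹ * δ * σ') 1 1 = 0 := by rw [hM]; rfl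
    have hact := (actPair_eq_swap_iff hσ hσ' δ).2 ⟨h00, h11⟩
    rw [mappingCosets_eq_singleton (δ := ⟨δ, hδ⟩) (Or.inr rfl) hact,
      tsum_singleton (f := fun q ↦ stripCoeff (cosetTerm Γ η σ σ' h m q) (hypLength Γ σ') n y),
      stripCoeff_congr (fun u hu ↦ by
        rw [cosetTerm_mk hΓ hη hσ h m ⟨δ, hδ⟩ hu, hypLength_eq_of_antidiag hδ h00 h11,
          stripTerm_antidiag h _ m hb0 hM hu]) _ _ h0 h1,
      stripCoeff_expMode (hypLength_pos hΓ hη' hσ')]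
    by_cases hn : n = -m
    · subst hn; rw [if_pos rfl, if_pos ⟨hP, rfl⟩]
    · rw [if_neg hn, if_neg fun h ↦ hn h.2]
  · rw [mappingCosets_eq_empty hP, if_neg fun h ↦ hP h.1]
    exact tsum_empty

/-- The trichotomy of the matrices, read as a partition of the cosets; the determinant excludes a
matrix that is both diagonal and antidiagonal. -/
theorem tsum_cosets_eq (hΓ : DiscreteTopology Γ) (hη : IsHyperbolicPair Γ η)
    (hσ : IsScaling σ η) (hη' : IsHyperbolicPair Γ η') (hσ' : IsScaling σ' η')
    {f : CosetSpace Γ η → ℂ} (hf : Summable f) :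
    ∑' q, f q = ∑' q : genericCosets Γ η σ σ', f q + ∑' q : mappingCosets Γ η η' η, f q +
      ∑' q : mappingCosets Γ η η' η.swap, f q := by
  rw [tsum_subtype, tsum_subtype, tsum_subtype,
    ← (hf.indicator _).tsum_add (hf.indicator _),
    ← ((hf.indicator _).add (hf.indicator _)).tsum_add (hf.indicator _)]
  refine tsum_congr fun q ↦ ?_
  have hG : q ∈ genericCosets Γ η σ σ' ↔ IsGeneric (mat (σ⁻¹ * (q.out : SL(2, ℝ)) * σ')) := Iff.rfl
  have hD : q ∈ mappingCosets Γ η η' η ↔ _ := actPair_eq_iff_of_isScaling hσ hσ' q.out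
  have hA : q ∈ mappingCosets Γ η η' η.swap ↔ _ := actPair_eq_swap_iff hσ hσ' q.out
  have hdet := det_mat (σ⁻¹ * (q.out : SL(2, ℝ)) * σ')
  rcases mat_trichotomy hΓ hη hσ hη' hσ' q.out with h | h | h
  · have hD' : q ∉ mappingCosets Γ η η' η := fun h' ↦ h (by rw [(hD.1 h').1]; ring)
    have hA' : q ∉ mappingCosets Γ η η' η.swap := fun h' ↦ h (by rw [(hA.1 h').1]; ring)
    rw [Set.indicator_of_mem (hG.2 h), Set.indicator_of_notMem hD',
      Set.indicator_of_notMem hA', add_zero, add_zero]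
  · have hG' : q ∉ genericCosets Γ η σ σ' := fun h' ↦ hG.1 h' (by rw [h.1]; ring)
    have hA' : q ∉ mappingCosets Γ η η' η.swap := fun h' ↦ by
      rw [(hA.1 h').1, h.1] at hdet; simp at hdet
    rw [Set.indicator_of_notMem hG', Set.indicator_of_mem (hD.2 h),
      Set.indicator_of_notMem hA', add_zero, zero_add]
  · have hG' : q ∉ genericCosets Γ η σ σ' := fun h' ↦ hG.1 h' (by rw [h.1]; ring)
    have hD' : q ∉ mappingCosets Γ η η' η := fun h' ↦ by
      rw [(hD.1 h').1, h.1] at hdet; simp at hdet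
    rw [Set.indicator_of_notMem hG', Set.indicator_of_notMem hD',
      Set.indicator_of_mem (hA.2 h), add_zero, zero_add]

/-- Unfolding: the coefficients of the cosets in a generic double coset add up to an integral over
the whole line. -/
theorem hasSum_stripCoeff_mul (hΓ : DiscreteTopology Γ) (hη : IsHyperbolicPair Γ η)
    (hσ : IsScaling σ η) (hη' : IsHyperbolicPair Γ η') (hσ' : IsScaling σ' η') {h : ℕ}
    (hh : 1 ≤ h) (m n : ℤ) {y : ℝ} (h0 : 0 < y) (h1 : y < Real.pi) {τ : ℤ → Γ}
    (hτ : ∀ j, σ'⁻¹ * (τ j : SL(2, ℝ)) * σ' = expSL (j * hypLength Γ σ') ∨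
      σ'⁻¹ * (τ j : SL(2, ℝ)) * σ' = -expSL (j * hypLength Γ σ')) {γ : Γ}
    (hγ : IsGeneric (mat (σ⁻¹ * γ * σ'))) {C : ℝ} {α β : ℤˣ}
    (hC : mat (σ⁻¹ * γ * σ') 0 0 * mat (σ⁻¹ * γ * σ') 1 1 = C)
    (hα : Real.sign (mat (σ⁻¹ * γ * σ') 0 0 * mat (σ⁻¹ * γ * σ') 1 0) = ((α : ℤ) : ℝ))
    (hβ : Real.sign (mat (σ⁻¹ * γ * σ') 1 0 * mat (σ⁻¹ * γ * σ') 1 1) = ((β : ℤ) : ℝ)) :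
    HasSum (fun j ↦ stripCoeff (cosetTerm Γ η σ σ' h m (Quotient.mk _ (γ * τ j)))
        (hypLength Γ σ') n y)
      (hhIntegral (2 * h) (hypLength Γ σ) (hypLength Γ σ') m n C α β y *
        (klPhase (hypLength Γ σ) (hypLength Γ σ') m n (mat (σ⁻¹ * γ * σ')) /
          ((|C * (C - 1)| ^ (((2 * h : ℕ) : ℝ) / 4) : ℝ) : ℂ))) := by
  have hℓ' := hypLength_pos hΓ hη' hσ'
  obtain ⟨hint, heq⟩ := integrable_and_integral_stripTerm hh (hypLength Γ σ) hℓ' m n hγ hC hα hβ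
    h0 h1
  rw [← heq]
  refine ((hasSum_intervalIntegral_shift hint hℓ').mul_left _).congr_fun fun j ↦ ?_
  rw [stripCoeff]
  congr 1
  refine intervalIntegral.integral_congr fun x _ ↦ ?_
  have hu := line_mem_strip h0 h1 x
  -- The mode has period `ℓ'`, so translating the whole integrand by `jℓ'` only affects the summand;
  -- this is the effect of `τ_j`.
  have hper : Function.Periodic (expMode (hypLength Γ σ') (-n)) (hypLength Γ σ') :=
    expMode_periodic hℓ' (-n)
  have hper' := hper.int_mul j (line y x)
  have hmk := (cosetTerm_mul hΓ hη hσ h m γ (τ j) (hτ j) hu).trans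
    (cosetTerm_mk hΓ hη hσ h m γ (add_mem_strip hu _))
  simp only [hmk, line_add, Complex.ofReal_mul, Complex.ofReal_intCast, hper']

/-- The sign of a real number as a unit, with the value `-1` at zero. -/
def signUnit (x : ℝ) : ℤˣ := if 0 < x then 1 else -1

theorem sign_eq_signUnit {x : ℝ} (hx : x ≠ 0) : Real.sign x = ((signUnit x : ℤ) : ℝ) := by
  rcases lt_or_gt_of_ne hx with h | h
  · rw [Real.sign_of_neg h, signUnit, if_neg h.not_gt]; simp
  · rw [Real.sign_of_pos h, signUnit, if_pos h]; simp

theorem unit_cast_injective {α β : ℤˣ} (h : ((α : ℤ) : ℝ) = ((β : ℤ) : ℝ)) : α = β :=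
  Units.ext (by exact_mod_cast h)

/-- The generic double cosets are partitioned by the index sets of the Kloosterman sums. -/
theorem bijective_kloostermanIndex : Function.Bijective
    (fun s : Σ p : cSet Γ σ σ' × ℤˣ × ℤˣ, kloostermanIndex Γ η η' σ σ' p.1 p.2.1 p.2.2 ↦
      (⟨s.2.1, kloostermanIndex_isGeneric s.1.1.2 s.2.2⟩ : genericDoubleCosets Γ η η' σ σ')) := by
  constructor
  · rintro ⟨⟨⟨C, hC⟩, α, β⟩, D, hD⟩ ⟨⟨⟨C', hC'⟩, α', β'⟩, D', hD'⟩ h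
    obtain rfl : D = D' := congrArg Subtype.val h
    obtain ⟨e1, e2, e3⟩ := hD
    obtain ⟨e1', e2', e3'⟩ := hD'
    obtain rfl : C = C' := e1.symm.trans e1'
    obtain rfl : α = α' := unit_cast_injective (e2.symm.trans e2')
    obtain rfl : β = β' := unit_cast_injective (e3.symm.trans e3')
    rfl
  · rintro ⟨D, hD⟩
    have hD' : IsGeneric (repMat σ σ' D) := hD
    have hac : repMat σ σ' D 0 0 * repMat σ σ' D 1 0 ≠ 0 := fun h ↦ hD' (by
      rw [mul_right_comm (repMat σ σ' D 0 0), h, zero_mul, zero_mul])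
    have hcd : repMat σ σ' D 1 0 * repMat σ σ' D 1 1 ≠ 0 := fun h ↦ hD' (by
      rw [mul_assoc, h, mul_zero])
    exact ⟨⟨(⟨_, _, (Quotient.out D : Γ).2, hD, rfl⟩, _, _),
      D, rfl, sign_eq_signUnit hac, sign_eq_signUnit hcd⟩, rfl⟩

/-- The sum over generic cosets is rearranged as a sum over `(C, α, β)`, then over the double cosets
of that type, then over `ℤ`. The innermost sum unfolds to `I` times a phase, and the phases add up
to `S`. The regrouping is legitimate because the sum over all cosets is summable. -/
theorem hasSum_mainTerm (hΓ : DiscreteTopology Γ) (hη : IsHyperbolicPair Γ η)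
    (hσ : IsScaling σ η) (hη' : IsHyperbolicPair Γ η') (hσ' : IsScaling σ' η') {h : ℕ}
    (hh : 1 ≤ h) (m n : ℤ) {y : ℝ} (h0 : 0 < y) (h1 : y < Real.pi)
    (hs : Summable fun q ↦ stripCoeff (cosetTerm Γ η σ σ' h m q) (hypLength Γ σ') n y) :
    HasSum (fun p : cSet Γ σ σ' × ℤˣ × ℤˣ ↦ mainTerm Γ η η' σ σ' (2 * h) m n y p.1 p.2.1 p.2.2)
      (∑' q : genericCosets Γ η σ σ',
        stripCoeff (cosetTerm Γ η σ σ' h m q) (hypLength Γ σ') n y) := by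
  obtain ⟨τ, e, hτ, he⟩ := exists_genericEquiv (Γ := Γ) hΓ hη hσ hη' hσ'
  have hsum := e.hasSum_iff.2 (hs.subtype (genericCosets Γ η σ σ')).hasSum
  let E := Equiv.ofBijective _ (bijective_kloostermanIndex (Γ := Γ) (η := η) (η' := η') (σ := σ)
    (σ' := σ'))
  have hsum' := ((Equiv.prodCongr E (Equiv.refl ℤ)).hasSum_iff.2 hsum).prod_fiberwise
    (g := fun s ↦ hhIntegral (2 * h) (hypLength Γ σ) (hypLength Γ σ') m n s.1.1 s.1.2.1 s.1.2.2 y *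
        (klPhase (hypLength Γ σ) (hypLength Γ σ') m n (repMat σ σ' s.2.1) /
          ((|(s.1.1 : ℝ) * (s.1.1 - 1)| ^ (((2 * h : ℕ) : ℝ) / 4) : ℝ) : ℂ))) fun s ↦ by
    refine (hasSum_stripCoeff_mul hΓ hη hσ hη' hσ' hh m n h0 h1 hτ (E s).2 s.2.2.1 s.2.2.2.1
      s.2.2.2.2).congr_fun fun j ↦ ?_
    simp only [Function.comp_apply, Equiv.prodCongr_apply, Prod.map_apply, Equiv.refl_apply, he]
  refine hsum'.sigma fun p ↦ ?_
  -- Finiteness turns the sum over the fibre and the `finsum` defining `S` into the same finite sum;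
  -- an infinite support would make the latter `0` by convention.
  have := (finite_kloostermanIndex hΓ hη hσ hη' hσ' p.1.2 p.2.1 p.2.2).fintype
  convert! hasSum_fintype _ using 1
  rw [mainTerm, kloostermanSum, ← finsum_set_coe_eq_finsum_mem, finsum_eq_sum_of_fintype,
    mul_div_assoc, Finset.sum_div, Finset.mul_sum]
  rfl

end

end HypPoincare

end

/-! ### The theorem. -/

theorem theorem8p15
    (Γ : Subgroup (Matrix.SpecialLinearGroup (Fin 2) ℝ))
    (hΓ : HypPoincare.IsFuchsianFirstKind Γ)
    (k : ℕ) (hk : Even k) (hk4 : 4 ≤ k)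
    (η η' : OnePoint ℝ × OnePoint ℝ)
    (hη : HypPoincare.IsHyperbolicPair Γ η) (hη' : HypPoincare.IsHyperbolicPair Γ η')
    (σ σ' : Matrix.SpecialLinearGroup (Fin 2) ℝ)
    (hσ : HypPoincare.IsScaling σ η) (hσ' : HypPoincare.IsScaling σ' η') (m : ℤ) :
    -- the Poincaré series converges absolutely
    (∀ z : UpperHalfPlane, Summable fun q ↦ HypPoincare.poincareTerm Γ η σ k m q z) ∧
    -- the Kloosterman sums are finite sums
    (∀ C ∈ HypPoincare.cSet Γ σ σ', ∀ α β : ℤˣ,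
      (HypPoincare.kloostermanIndex Γ η η' σ σ' C α β).Finite) ∧
    -- the integrals converge absolutely
    (∀ C ∈ HypPoincare.cSet Γ σ σ', ∀ α β : ℤˣ,
      (((α * β : ℤˣ) : ℤ) : ℝ) = Real.sign C → ∀ (n : ℤ) (y : ℝ), 0 < y → y < Real.pi →
        MeasureTheory.Integrable (fun x : ℝ ↦
          HypPoincare.hhIntegrand k (HypPoincare.hypLength Γ σ) (HypPoincare.hypLength Γ σ')
            m n C α β ((x : ℂ) + (y : ℂ) * Complex.I))) ∧
    -- the numbers `a` and `b` exist
    (∃ a, HypPoincare.IsDiagParam Γ η η' σ σ' a) ∧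
    (∃ b, HypPoincare.IsAntidiagParam Γ η η' σ σ' b) ∧
    -- the hyperbolic expansion of the Poincaré series, its uniqueness and its coefficients
    ∃ c : ℤ → ℂ,
      HypPoincare.IsHypExpansion Γ σ' k (HypPoincare.poincareSeries Γ η σ k m) c ∧
      (∀ c' : ℤ → ℂ,
        HypPoincare.IsHypExpansion Γ σ' k (HypPoincare.poincareSeries Γ η σ k m) c' → c' = c) ∧
      ∀ a b : ℝ, HypPoincare.IsDiagParam Γ η η' σ σ' a →
        HypPoincare.IsAntidiagParam Γ η η' σ σ' b →
        ∀ (n : ℤ) (y : ℝ), 0 < y → y < Real.pi →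
          Summable (fun p : HypPoincare.cSet Γ σ σ' × ℤˣ × ℤˣ ↦
            HypPoincare.mainTerm Γ η η' σ σ' k m n y p.1 p.2.1 p.2.2) ∧
          c n = (∑' p : HypPoincare.cSet Γ σ σ' × ℤˣ × ℤˣ,
              HypPoincare.mainTerm Γ η η' σ σ' k m n y p.1 p.2.1 p.2.2) +
            HypPoincare.extraDiag Γ η η' (HypPoincare.hypLength Γ σ') m n a +
            HypPoincare.extraAntidiag Γ η η' k (HypPoincare.hypLength Γ σ') m n b := by
  obtain ⟨h, rfl⟩ := hk.two_dvd
  have hh : 2 ≤ h := by omega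
  have hd := hΓ.discrete
  have hℓ' := HypPoincare.hypLength_pos hd hη' hσ'
  have hdiff := HypPoincare.differentiableOn_cosetSeries (σ' := σ') hd hη hσ hh m
  have hper : ∀ u ∈ HypPoincare.strip, _ := fun u hu ↦
    HypPoincare.cosetSeries_periodic hd hη hσ hη' hσ' h m hu
  have hpi : 0 < Real.pi / 2 := by positivity
  have hpi' : Real.pi / 2 < Real.pi := by linarith
  refine ⟨HypPoincare.summable_poincareTerm hd hη hσ hh m,
    fun C hC ↦ HypPoincare.finite_kloostermanIndex hd hη hσ hη' hσ' hC, ?_,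
    HypPoincare.exists_isDiagParam hσ hσ', HypPoincare.exists_isAntidiagParam hσ hσ', ?_⟩
  · intro C hC α β _ n y h0 h1
    obtain ⟨hC0, hC1⟩ := HypPoincare.ne_of_mem_cSet hC
    exact HypPoincare.integrable_hhIntegrand (by omega) _ _ m n hC0 hC1 α β h0 h1
  -- The coefficients are taken at the arbitrary height `π/2`, so that one family `c` serves for all
  -- `y`.
  refine ⟨fun n ↦ HypPoincare.stripCoeff (HypPoincare.cosetSeries Γ η σ σ' h m)
    (HypPoincare.hypLength Γ σ') n (Real.pi / 2), ?_, ?_, ?_⟩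
  · rw [HypPoincare.isHypExpansion_iff]
    exact fun u hu ↦ HypPoincare.hasSum_stripCoeff hℓ' hdiff hper hpi hpi' hu
  · intro c hc
    rw [HypPoincare.isHypExpansion_iff] at hc
    exact funext fun n ↦ HypPoincare.eq_stripCoeff_of_hasSum hℓ'
      (fun x ↦ hc _ (HypPoincare.line_mem_strip hpi hpi' x)) n
  · intro a b ha hb n y h0 h1
    have hS := HypPoincare.hasSum_stripCoeff_cosetTerm (σ' := σ') hd hη hσ hh m n
      (HypPoincare.hypLength Γ σ') h0 h1
    have hmain := HypPoincare.hasSum_mainTerm hd hη hσ hη' hσ' (by omega) m n h0 h1 hS.summable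
    refine ⟨hmain.summable, ?_⟩
    beta_reduce
    -- The height is moved from `π/2` to the given `y` before the coefficient is split over the
    -- three kinds of cosets.
    rw [HypPoincare.stripCoeff_eq hℓ' hdiff hper n hpi hpi' h0 h1, ← hS.tsum_eq,
      HypPoincare.tsum_cosets_eq hd hη hσ hη' hσ' hS.summable, hmain.tsum_eq,
      HypPoincare.tsum_mappingCosets_diag hd hη hσ hη' hσ' h m n h0 h1 ha,
      HypPoincare.tsum_mappingCosets_antidiag hd hη hσ hη' hσ' h m n h0 h1 hb]
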